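/- Let $n\ge 1$. Identify $\mathbb{P}^{2n}=\mathbb{P}(\mathrm{Sym}^{2n}\mathbb{C}^2)$ with the space of nonzero complex binary forms of degree $2n$ up to scalars. Let $\nu_{2n}(\mathbb{P}^1)\subset\mathbb{P}^{2n}$ be the rational normal curve of $2n$-th powers of linear forms, and let $\sigma_n(\nu_{2n}(\mathbb{P}^1))$ be its $n$-th secant variety, the Zariski closure of the union of the linear spans of $n$ points of the curve. Let $Y=\sigma_n(\nu_{2n}(\mathbb{P}^1))^\vee\subset\mathbb{P}^{2n}$ be the dual variety of $\sigma_n(\nu_{2n}(\mathbb{P}^1))$, where $\mathbb{P}^{2n}$ is identified with its dual space by the Bombieri–Weyl form, i.e. by the bilinear form on $\mathrm{Sym}^{2n}\mathbb{C}^2$ with $$\Big\langle \sum_i \tbinom{2n}{i}f_i x^{2n-i}y^i,\ \sum_i \tbinom{2n}{i}g_i x^{2n-i}y^i\Big\rangle=\sum_i\tbinom{2n}{i}f_ig_i .$$ Then $Y=Sq_n:=\{[f^2] : 0\neq f\in \mathrm{Sym}^n\mathbb{C}^2\}$, and $Y$ is isomorphic to $\mathbb{P}^n$ as a projective variety. Moreover,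 for a general hyperplane $H\subset\mathbb{P}^{2n}$ (that is, for all $H$ in some nonempty Zariski open subset of the dual projective space), $Y\cap H$ is isomorphic, as a projective variety, to a smooth quadric hypersurface in $\mathbb{P}^n$ (hence of dimension $n-1$), and its topological Euler characteristic is $$\chi(Y\cap H)=\begin{cases} n & \text{if } n \text{ is even},\\ n+1 & \text{if } n\text{ is odd.}\end{cases}$$ Here $\chi$ is the alternating sum of the dimensions of the singular homology groups with rational coefficients of $Y\cap H$ in the classical topology; these groups are finite dimensional and almost all zero. -/

import Mathlib

open scoped LinearAlgebra.Projectivization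

noncomputable section

namespace SquareVariety

/-! ## Subvarieties of complex projective space

`ℙ ℂ (ι → ℂ)` is the projective space with homogeneous coordinates indexed by the finite type `ι`;
for `ι = Fin (m + 1)` it is the complex projective space of dimension `m`. -/

/-- The classical (Euclidean) topology of complex projective space: the quotient topology from
the space of nonzero vectors. -/
instance projTopology {ι : Type} : TopologicalSpace (ℙ ℂ (ι → ℂ)) :=
  TopologicalSpace.coinduced (Projectivization.mk' ℂ) inferInstance

/-- The set of common zeros of a set of polynomials (used for homogeneous polynomials, for which
the choice of the representative is irrelevant). -/
def zeroLocus {ι : Type} (S : Set (MvPolynomial ι ℂ)) : Set (ℙ ℂ (ι → ℂ)) :=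
  {x | ∀ P ∈ S, MvPolynomial.eval x.rep P = 0}

/-- Zariski closed subsets of projective space. -/
def IsZariskiClosed {ι : Type} (Z : Set (ℙ ℂ (ι → ℂ))) : Prop :=
  ∃ S : Set (MvPolynomial ι ℂ), (∀ P ∈ S, ∃ d : ℕ, P.IsHomogeneous d) ∧ Z = zeroLocus S

/-- The Zariski closure. -/
def zariskiClosure {ι : Type} (X : Set (ℙ ℂ (ι → ℂ))) : Set (ℙ ℂ (ι → ℂ)) :=
  ⋂₀ {Z | IsZariskiClosed Z ∧ X ⊆ Z}

/-- The hyperplane `∑ i, c i * x i = 0`; a hyperplane is a point `c` of the dual projective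
space. -/
def hyperplane {ι : Type} [Fintype ι] (c : ℙ ℂ (ι → ℂ)) : Set (ℙ ℂ (ι → ℂ)) :=
  {x | ∑ i, c.rep i * x.rep i = 0}

/-- A property holds for a general hyperplane if it holds for all members of a nonempty Zariski
open subset of the dual projective space. -/
def ForGeneralHyperplane {ι : Type} [Fintype ι] (p : Set (ℙ ℂ (ι → ℂ)) → Prop) : Prop :=
  ∃ U : Set (ℙ ℂ (ι → ℂ)), IsZariskiClosed Uᶜ ∧ U.Nonempty ∧ ∀ c ∈ U, p (hyperplane c)

/-- The tangent space at `x` to the affine cone over `X`: the common kernel at `x` of the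
differentials of all homogeneous polynomials that vanish on `X`. -/
def coneTangentSpace {ι : Type} [Fintype ι] (X : Set (ℙ ℂ (ι → ℂ))) (x : ℙ ℂ (ι → ℂ)) :
    Submodule ℂ (ι → ℂ) where
  carrier := {v | ∀ (P : MvPolynomial ι ℂ) (d : ℕ), P.IsHomogeneous d →
    (∀ y ∈ X, MvPolynomial.eval y.rep P = 0) →
      ∑ i, MvPolynomial.eval x.rep (MvPolynomial.pderiv i P) * v i = 0}
  add_mem' := by
    intro v w hv hw P d hP hX
    simp only [Pi.add_apply, mul_add, Finset.sum_add_distrib, hv P d hP hX, hw P d hP hX, add_zero]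
  zero_mem' := by
    intro P d _ _
    simp
  smul_mem' := by
    intro t v hv P d hP hX
    simp only [Pi.smul_apply, smul_eq_mul, mul_left_comm _ t, ← Finset.mul_sum, hv P d hP hX,
      mul_zero]

/-- The smooth points of an irreducible variety `X`: the points where the tangent space has the
smallest dimension, that is, where the Jacobian matrix has maximal rank. -/
def smoothLocus {ι : Type} [Fintype ι] (X : Set (ℙ ℂ (ι → ℂ))) : Set (ℙ ℂ (ι → ℂ)) :=
  {x | x ∈ X ∧ ∀ y ∈ X, Module.finrank ℂ (coneTangentSpace X x) ≤
    Module.finrank ℂ (coneTangentSpace X y)}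

/-- The dual variety of an irreducible variety `X`, the Zariski closure of the set of hyperplanes
that contain the tangent space at a smooth point of `X`. A nondegenerate bilinear form `B`
identifies the hyperplane `{v | B b v = 0}` with the point `[b]`. -/
def dualVariety {ι : Type} [Fintype ι] (B : LinearMap.BilinForm ℂ (ι → ℂ))
    (X : Set (ℙ ℂ (ι → ℂ))) : Set (ℙ ℂ (ι → ℂ)) :=
  zariskiClosure {b | ∃ x ∈ smoothLocus X, ∀ v ∈ coneTangentSpace X x, B b.rep v = 0}

/-- The `k`-th secant variety `σ_k(X)`: the Zariski closure of the union of the linear spans of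
`k` points of `X`. -/
def secantVariety {ι : Type} (k : ℕ) (X : Set (ℙ ℂ (ι → ℂ))) : Set (ℙ ℂ (ι → ℂ)) :=
  zariskiClosure {x | ∃ p : Fin k → ℙ ℂ (ι → ℂ), (∀ i, p i ∈ X) ∧
    x.rep ∈ Submodule.span ℂ (Set.range fun i => (p i).rep)}

/-- Regular maps between subvarieties of projective spaces: Zariski locally around every point the
map is given by homogeneous polynomials of one degree without common zero. -/
def IsRegularMap {ι κ : Type} {X : Set (ℙ ℂ (ι → ℂ))} {Z : Set (ℙ ℂ (κ → ℂ))} (φ : X → Z) : Prop :=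
  ∀ x : X, ∃ (d : ℕ) (F : κ → MvPolynomial ι ℂ), (∀ k, (F k).IsHomogeneous d) ∧
    (fun k => MvPolynomial.eval x.1.rep (F k)) ≠ 0 ∧
    ∀ (y : X) (hy : (fun k => MvPolynomial.eval y.1.rep (F k)) ≠ 0),
      (φ y : ℙ ℂ (κ → ℂ)) = Projectivization.mk ℂ (fun k => MvPolynomial.eval y.1.rep (F k)) hy

/-- Isomorphic projective varieties. -/
def AreIsomorphic {ι κ : Type} (X : Set (ℙ ℂ (ι → ℂ))) (Z : Set (ℙ ℂ (κ → ℂ))) : Prop :=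
  ∃ φ : X ≃ Z, IsRegularMap φ ∧ IsRegularMap φ.symm

/-- `Z` is a smooth quadric hypersurface: the zero locus of a quadratic form whose gradient does
not vanish at any point of `Z`. -/
def IsSmoothQuadric {ι : Type} (Z : Set (ℙ ℂ (ι → ℂ))) : Prop :=
  ∃ q : MvPolynomial ι ℂ, q.IsHomogeneous 2 ∧ Z = zeroLocus {q} ∧
    ∀ x ∈ Z, ∃ i, MvPolynomial.eval x.rep (MvPolynomial.pderiv i q) ≠ 0

/-! ## Binary forms -/

/-- The binary form `∑ i, a i * x ^ (d - i) * y ^ i` of degree `d`; this identifies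
`Fin (d + 1) → ℂ` with `Sym^d ℂ²`. -/
def binaryForm (d : ℕ) (a : Fin (d + 1) → ℂ) : MvPolynomial (Fin 2) ℂ :=
  ∑ i : Fin (d + 1), MvPolynomial.C (a i) *
    MvPolynomial.X 0 ^ (d - (i : ℕ)) * MvPolynomial.X 1 ^ (i : ℕ)

/-- The Bombieri-Weyl bilinear form on `Sym^d ℂ²`, which is
`∑ i, (d.choose i) * f i * g i` for the forms `∑ i, (d.choose i) * f i * x ^ (d - i) * y ^ i` and
`∑ i, (d.choose i) * g i * x ^ (d - i) * y ^ i`. -/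
def bombieriWeyl (d : ℕ) : LinearMap.BilinForm ℂ (Fin (d + 1) → ℂ) :=
  Matrix.toBilin' (Matrix.diagonal fun i : Fin (d + 1) => ((d.choose (i : ℕ) : ℂ))⁻¹)

/-- The rational normal curve `ν_d(ℙ¹)` in `ℙ(Sym^d ℂ²)`: the points that are represented by the
`d`-th power of a linear form. -/
def rationalNormalCurve (d : ℕ) : Set (ℙ ℂ (Fin (d + 1) → ℂ)) :=
  {x | ∃ (v : Fin (d + 1) → ℂ) (hv : v ≠ 0), x = Projectivization.mk ℂ v hv ∧
    ∃ l : Fin 2 → ℂ, binaryForm d v = binaryForm 1 l ^ d}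

/-- The variety of squares `Sq_n` in `ℙ(Sym^{2n} ℂ²)`: the points that are represented by the
square of a form of degree `n`. -/
def squares (n : ℕ) : Set (ℙ ℂ (Fin (2 * n + 1) → ℂ)) :=
  {x | ∃ (v : Fin (2 * n + 1) → ℂ) (hv : v ≠ 0), x = Projectivization.mk ℂ v hv ∧
    ∃ a : Fin (n + 1) → ℂ, binaryForm (2 * n) v = binaryForm n a ^ 2}

/-- The dual variety `σ_n(ν_{2n}(ℙ¹))^∨`, in `ℙ(Sym^{2n} ℂ²)` by means of the Bombieri-Weyl
form. -/
def dualOfSecant (n : ℕ) : Set (ℙ ℂ (Fin (2 * n + 1) → ℂ)) :=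
  dualVariety (bombieriWeyl (2 * n)) (secantVariety n (rationalNormalCurve (2 * n)))

/-! ## The topological Euler characteristic -/

/-- The singular homology of `X` with rational coefficients, in degree `i`. -/
def rationalHomology (X : Type) [TopologicalSpace X] (i : ℕ) : ModuleCat.{0} ℚ :=
  ((AlgebraicTopology.singularHomologyFunctor (ModuleCat.{0} ℚ) i).obj (ModuleCat.of ℚ ℚ)).obj
    (TopCat.of X)

/-- The topological Euler characteristic of `X` is defined and equal to `e`: the rational homology
of `X` is finite dimensional in every degree, it vanishes from some degree on, and the alternating
sum of the Betti numbers is `e`. -/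
def HasEulerCharacteristic (X : Type) [TopologicalSpace X] (e : ℤ) : Prop :=
  (∀ i, Module.Finite ℚ (rationalHomology X i)) ∧
    ∃ N : ℕ, (∀ i, N ≤ i → Subsingleton (rationalHomology X i)) ∧
      e = ∑ i ∈ Finset.range N, (-1 : ℤ) ^ i * (Module.finrank ℚ (rationalHomology X i) : ℤ)

end SquareVariety

end

/-!
Why the dual of the secant variety is the variety of squares. A general point of `σ_n(ν_{2n}(ℙ¹))`
is a combination of powers of `n` linear forms `x + t i * y` (`secantPoint`), and forms that vanish
at these points vanish on the whole variety (`eval_rep_eq_zero_of_mem_secantVariety`). The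
differential of an equation of the secant variety at such a point becomes, under the Bombieri-Weyl
form, a binary form of degree `2 * n` with double zeros at the `n` points `t i`, hence a multiple
of the square of `∏ (T - t i)` (`IsSecantEquation.exists_dualGradient_eq`). Being a square is a
closed condition on a form, and being proportional is a closed condition on two differentials. So
the differentials of equations are squares, and any two of them are proportional, at every point of
the variety: tangent hyperplanes are squares (`mem_squares_of_forall`) and tangent spaces have
codimension at most one (`le_finrank_coneTangentSpace`). Conversely the determinant of the Hankel
matrix is an equation whose differential does not vanish at a general point
(`exists_isSecantEquation_dualGradient_eq`), because the Hankel matrix of power sums factors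
through Vandermonde matrices. Hence general points are smooth and all squares of forms with simple
zeros are tangent hyperplanes; these are dense in the squares.

That the squares are closed, and isomorphic to `ℙ^n`, is due to a polynomial formula for the square
root: the power series square root of a form expanded at a point `s`, with denominators cleared, is
given by forms of degree `n + 1` in the coefficients and recovers `f` from `f ^ 2` up to the factor
`f(s) ^ (2 * n + 1)` (`sqrtCoeff_sqCoeff`).

A hyperplane `∑ c k * x k = 0` cuts out of the squares the quadric in `ℙ^n` with matrix
`c (i + j)`, which is smooth if this Hankel matrix is nondegenerate. For its Euler characteristic
the quadric is written as `∑ a i * b i + ∑ w ^ 2 = 0` with at most one square. The open part where a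
coordinate of a hyperbolic plane does not vanish is an affine space, of Euler characteristic `1`,
and it meets the part where some of the other coordinates do not vanish in the complement of a
linear subspace of a complex affine space, of Euler characteristic `0`. So every coordinate `a i`,
`b i` adds `1`, and these open sets cover the quadric (`hasEulerCharacteristic_splitForm`).

This needs the Mayer-Vietoris formula for the Euler characteristic of singular homology
(`HasEulerCharacteristic.of_union`). Barycentric subdivision and its chain homotopy to the identity
are defined for formal combinations of tuples of points of a simplex and carried over to singular
chains; iterated subdivision makes chains small with respect to an open cover of two sets, so that
the sums of chains in the two sets compute the homology of the space.
-/

open scoped LinearAlgebra.Projectivization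

noncomputable section

namespace SquareVariety

/-! ### The Euler characteristic of chain complexes -/

section

open CategoryTheory Limits

/-- A graded rational vector space has Euler characteristic `e`: it is finite dimensional in every
degree, vanishes in large degrees, and the alternating sum of the dimensions is `e`. -/
def GradedChi (H : ℕ → ModuleCat.{0} ℚ) (e : ℤ) : Prop :=
  (∀ i, Module.Finite ℚ (H i)) ∧
    ∃ N : ℕ, (∀ i, N ≤ i → Subsingleton (H i)) ∧
      e = ∑ i ∈ Finset.range N, (-1 : ℤ) ^ i * (Module.finrank ℚ (H i) : ℤ)

theorem hasEulerCharacteristic_iff {X : Type} [TopologicalSpace X] {e : ℤ} :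
    HasEulerCharacteristic X e ↔ GradedChi (rationalHomology X) e := Iff.rfl

/-- The bound beyond which the graded vector space vanishes may be enlarged. -/
theorem GradedChi.exists_bound {H : ℕ → ModuleCat.{0} ℚ} {e : ℤ} (h : GradedChi H e) :
    ∃ N : ℕ, ∀ M, N ≤ M → (∀ i, M ≤ i → Subsingleton (H i)) ∧
      e = ∑ i ∈ Finset.range M, (-1 : ℤ) ^ i * (Module.finrank ℚ (H i) : ℤ) := by
  obtain ⟨-, N, hN, he⟩ := h
  refine ⟨N, fun M hM => ⟨fun i hi => hN i (hM.trans hi), ?_⟩⟩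
  rw [he]
  refine Finset.sum_subset (Finset.range_mono hM) fun i _ hi => ?_
  have := hN i (by simpa using hi)
  simp [Module.finrank_zero_of_subsingleton]

theorem GradedChi.of_equiv {H H' : ℕ → ModuleCat.{0} ℚ} {e : ℤ} (h : GradedChi H e)
    (φ : ∀ i, Nonempty (H i ≃ₗ[ℚ] H' i)) : GradedChi H' e := by
  obtain ⟨hf, N, hN, he⟩ := h
  refine ⟨fun i => ?_, N, fun i hi => ?_, ?_⟩
  · obtain ⟨f⟩ := φ i
    have := hf i
    exact Module.Finite.equiv f
  · obtain ⟨f⟩ := φ i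
    have := hN i hi
    exact f.symm.injective.subsingleton
  · rw [he]
    refine Finset.sum_congr rfl fun i _ => ?_
    obtain ⟨f⟩ := φ i
    rw [f.finrank_eq]

theorem GradedChi.prod {H H' : ℕ → ModuleCat.{0} ℚ} {e e' : ℤ} (h : GradedChi H e)
    (h' : GradedChi H' e') : GradedChi (fun i => ModuleCat.of ℚ (H i × H' i)) (e + e') := by
  obtain ⟨N, hN⟩ := h.exists_bound
  obtain ⟨N', hN'⟩ := h'.exists_bound
  obtain ⟨h1, h2⟩ := hN (max N N') (le_max_left _ _)
  obtain ⟨h1', h2'⟩ := hN' (max N N') (le_max_right _ _)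
  have := h.1
  have := h'.1
  refine ⟨fun i => ?_, max N N', fun i hi => ?_, ?_⟩
  · change Module.Finite ℚ (H i × H' i)
    infer_instance
  · have := h1 i hi
    have := h1' i hi
    change Subsingleton (H i × H' i)
    infer_instance
  · rw [h2, h2', ← Finset.sum_add_distrib]
    refine Finset.sum_congr rfl fun i _ => ?_
    change _ = _ * ((Module.finrank ℚ (H i × H' i) : ℕ) : ℤ)
    rw [Module.finrank_prod]
    push_cast
    ring

/-- Additivity of the Euler characteristic along a long exact sequence
`⋯ → A (i + 1) → B (i + 1) → C (i + 1) → A i → B i → C i → ⋯ → C 0 → 0`. -/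
theorem GradedChi.of_exact {A B C : ℕ → ModuleCat.{0} ℚ} {a b : ℤ} (hA : GradedChi A a)
    (hB : GradedChi B b) (f : ∀ i, A i →ₗ[ℚ] B i) (g : ∀ i, B i →ₗ[ℚ] C i)
    (δ : ∀ i, C (i + 1) →ₗ[ℚ] A i) (h₁ : ∀ i, LinearMap.range (δ i) = LinearMap.ker (f i))
    (h₂ : ∀ i, LinearMap.range (f i) = LinearMap.ker (g i))
    (h₃ : ∀ i, LinearMap.range (g (i + 1)) = LinearMap.ker (δ i))
    (h₀ : Function.Surjective (g 0)) : GradedChi C (b - a) := by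
  have hAf := hA.1
  have hBf := hB.1
  have hCf : ∀ i, Module.Finite ℚ (C i) := by
    intro i
    cases i with
    | zero => exact Module.Finite.of_surjective (g 0) h₀
    | succ i =>
      have e1 : Module.Finite ℚ (LinearMap.ker (δ i)) := by
        rw [← h₃ i]; infer_instance
      have e2 : Module.Finite ℚ (LinearMap.range (δ i)) := inferInstance
      have e3 : Module.Finite ℚ (C (i + 1) ⧸ LinearMap.ker (δ i)) :=
        Module.Finite.equiv (δ i).quotKerEquivRange.symm
      exact Module.Finite.of_submodule_quotient (LinearMap.ker (δ i))
  obtain ⟨N, hN⟩ := hA.exists_bound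
  obtain ⟨N', hN'⟩ := hB.exists_bound
  set M := max N N'
  obtain ⟨hA1, hA2⟩ := hN M (le_max_left _ _)
  obtain ⟨hB1, hB2⟩ := hN' M (le_max_right _ _)
  have hC1 : ∀ i, M + 1 ≤ i → Subsingleton (C i) := by
    intro i hi
    obtain ⟨j, rfl⟩ : ∃ j, i = j + 1 := ⟨i - 1, by omega⟩
    have := hA1 j (by omega)
    have := hB1 (j + 1) (by omega)
    have hd : LinearMap.ker (δ j) = ⊤ := by
      rw [LinearMap.ker_eq_top]; ext x; exact Subsingleton.elim _ _
    have : Subsingleton (LinearMap.ker (δ j)) := by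
      rw [← h₃ j]
      exact (LinearMap.surjective_rangeRestrict (g (j + 1))).subsingleton
    rw [hd] at this
    exact (Submodule.topEquiv (R := ℚ) (M := C (j + 1))).symm.injective.subsingleton
  have rA : ∀ i, Module.finrank ℚ (A i) =
      Module.finrank ℚ (LinearMap.range (f i)) + Module.finrank ℚ (LinearMap.range (δ i)) := by
    intro i
    rw [h₁ i, LinearMap.finrank_range_add_finrank_ker]
  have rB : ∀ i, Module.finrank ℚ (B i) =
      Module.finrank ℚ (LinearMap.range (g i)) + Module.finrank ℚ (LinearMap.range (f i)) := by
    intro i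
    rw [h₂ i, LinearMap.finrank_range_add_finrank_ker]
  have rC : ∀ i, Module.finrank ℚ (C (i + 1)) = Module.finrank ℚ (LinearMap.range (δ i)) +
      Module.finrank ℚ (LinearMap.range (g (i + 1))) := by
    intro i
    rw [h₃ i, LinearMap.finrank_range_add_finrank_ker]
  have rC0 : Module.finrank ℚ (C 0) = Module.finrank ℚ (LinearMap.range (g 0)) := by
    rw [LinearMap.range_eq_top.2 h₀, finrank_top]
  refine ⟨hCf, M + 1, hC1, ?_⟩
  -- by exactness, the partial alternating sums agree up to the rank of the connecting map
  have key : ∀ m : ℕ, ∑ i ∈ Finset.range (m + 1), (-1 : ℤ) ^ i * (Module.finrank ℚ (C i) : ℤ) =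
      ∑ i ∈ Finset.range (m + 1), (-1 : ℤ) ^ i * (Module.finrank ℚ (B i) : ℤ) -
      ∑ i ∈ Finset.range (m + 1), (-1 : ℤ) ^ i * (Module.finrank ℚ (A i) : ℤ) +
      (-1) ^ m * (Module.finrank ℚ (LinearMap.range (δ m)) : ℤ) := by
    intro m
    induction m with
    | zero =>
      simp only [zero_add, Finset.sum_range_one, pow_zero, one_mul, rA 0, rB 0, rC0]
      push_cast
      ring
    | succ m ih =>
      rw [Finset.sum_range_succ, ih, Finset.sum_range_succ _ (m + 1),
        Finset.sum_range_succ _ (m + 1), rA (m + 1), rB (m + 1), rC m]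
      push_cast
      ring
  have := hA1 M le_rfl
  have : Module.finrank ℚ (LinearMap.range (δ M)) = 0 := Module.finrank_zero_of_subsingleton
  rw [key M, this, (hN (M + 1) (by omega)).2, (hN' (M + 1) (by omega)).2]
  simp

/-- Additivity of the Euler characteristic for a short exact sequence of complexes. -/
theorem gradedChi_of_shortExact {S : ShortComplex (ChainComplex (ModuleCat.{0} ℚ) ℕ)}
    (hS : S.ShortExact) {a b : ℤ} (hA : GradedChi (fun i => S.X₁.homology i) a)
    (hB : GradedChi (fun i => S.X₂.homology i) b) :
    GradedChi (fun i => S.X₃.homology i) (b - a) := by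
  have hrel : ∀ i, (ComplexShape.down ℕ).Rel (i + 1) i := fun i => rfl
  refine hA.of_exact hB (fun i => (HomologicalComplex.homologyMap S.f i).hom)
    (fun i => (HomologicalComplex.homologyMap S.g i).hom)
    (fun i => (hS.δ (i + 1) i (hrel i)).hom)
    (fun i => (hS.homology_exact₁ (i + 1) i (hrel i)).moduleCat_range_eq_ker)
    (fun i => (hS.homology_exact₂ i).moduleCat_range_eq_ker)
    (fun i => (hS.homology_exact₃ (i + 1) i (hrel i)).moduleCat_range_eq_ker) ?_
  -- in degree zero homology is a cokernel, so that it preserves epimorphisms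
  have := hS.epi_g
  have hno : ¬ (ComplexShape.down ℕ).Rel 0 ((ComplexShape.down ℕ).next 0) := by
    simp
  have hiso : ∀ K : ChainComplex (ModuleCat.{0} ℚ) ℕ, IsIso (K.homologyι 0) :=
    fun K => ShortComplex.isIso_homologyι (K.sc 0) (K.shape _ _ hno)
  have e : HomologicalComplex.homologyMap S.g 0 ≫ S.X₃.homologyι 0 =
      S.X₂.homologyι 0 ≫ HomologicalComplex.opcyclesMap S.g 0 := by simp
  have : Epi (HomologicalComplex.homologyMap S.g 0 ≫ S.X₃.homologyι 0) := by
    rw [e]; infer_instance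
  have : Epi (HomologicalComplex.homologyMap S.g 0) := by
    have h2 : HomologicalComplex.homologyMap S.g 0 =
      (HomologicalComplex.homologyMap S.g 0 ≫ S.X₃.homologyι 0) ≫ inv (S.X₃.homologyι 0) := by
      rw [Category.assoc, IsIso.hom_inv_id, Category.comp_id]
    rw [h2]
    infer_instance
  exact (ModuleCat.epi_iff_surjective _).1 this

end

/-! ### Concrete chain complexes -/

section

open CategoryTheory Limits

theorem bijective_homologyMap_of_shortExact {S : ShortComplex (ChainComplex (ModuleCat.{0} ℚ) ℕ)}
    (hS : S.ShortExact) (h : ∀ j, S.X₃.ExactAt j) (i : ℕ) :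
    Function.Bijective (HomologicalComplex.homologyMap S.f i).hom := by
  have hmono : Mono (HomologicalComplex.homologyMap S.f i) :=
    (hS.homology_exact₁ (i + 1) i rfl).mono_g ((h (i + 1)).isZero_homology.eq_of_src _ _)
  have hepi : Epi (HomologicalComplex.homologyMap S.f i) :=
    (hS.homology_exact₂ i).epi_f ((h i).isZero_homology.eq_of_tgt _ _)
  exact ⟨(ModuleCat.mono_iff_injective _).1 hmono, (ModuleCat.epi_iff_surjective _).1 hepi⟩

section LinearAlgebra

variable {M : ℕ → Type} [∀ n, AddCommGroup (M n)] [∀ n, Module ℚ (M n)]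
  {M' : ℕ → Type} [∀ n, AddCommGroup (M' n)] [∀ n, Module ℚ (M' n)]

/-- The chain complex of `ℚ`-modules with the given differential. -/
def linComplex (d : ∀ n, M (n + 1) →ₗ[ℚ] M n) (hd : ∀ n x, d n (d (n + 1) x) = 0) :
    ChainComplex (ModuleCat.{0} ℚ) ℕ :=
  ChainComplex.of (fun n => ModuleCat.of ℚ (M n)) (fun n => ModuleCat.ofHom (d n)) fun n => by
    ext x
    exact hd n x

theorem linComplex_d (d : ∀ n, M (n + 1) →ₗ[ℚ] M n) (hd : ∀ n x, d n (d (n + 1) x) = 0) (n : ℕ) :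
    (linComplex d hd).d (n + 1) n = ModuleCat.ofHom (d n) := by
  simp [linComplex]

/-- A linear map commuting with the differentials, as a morphism of complexes. -/
def linComplexMap {d : ∀ n, M (n + 1) →ₗ[ℚ] M n} {hd : ∀ n x, d n (d (n + 1) x) = 0}
    {d' : ∀ n, M' (n + 1) →ₗ[ℚ] M' n} {hd' : ∀ n x, d' n (d' (n + 1) x) = 0}
    (f : ∀ n, M n →ₗ[ℚ] M' n) (hf : ∀ n x, f n (d n x) = d' n (f (n + 1) x)) :
    linComplex d hd ⟶ linComplex d' hd' :=
  ChainComplex.ofHom (fun n => ModuleCat.ofHom (f n)) fun n => by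
    simp only [linComplex, ChainComplex.of_d]
    ext x
    exact (hf n x).symm

/-- The homology of a direct sum of two complexes is the direct sum of the homologies. -/
theorem gradedChi_prod {d : ∀ n, M (n + 1) →ₗ[ℚ] M n} {hd : ∀ n x, d n (d (n + 1) x) = 0}
    {d' : ∀ n, M' (n + 1) →ₗ[ℚ] M' n} {hd' : ∀ n x, d' n (d' (n + 1) x) = 0} {a b : ℤ}
    (ha : GradedChi (fun i => (linComplex d hd).homology i) a)
    (hb : GradedChi (fun i => (linComplex d' hd').homology i) b)
    (h : ∀ n x, (d n).prodMap (d' n) ((d (n + 1)).prodMap (d' (n + 1)) x) = 0) :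
    GradedChi (fun i => (linComplex (M := fun n => M n × M' n) (fun n => (d n).prodMap (d' n))
      h).homology i) (a + b) := by
  set K := linComplex d hd
  set K' := linComplex d' hd'
  set L := linComplex (M := fun n => M n × M' n) (fun n => (d n).prodMap (d' n)) h
  let inl : K ⟶ L := linComplexMap (fun n => LinearMap.inl ℚ (M n) (M' n)) (by intro n x; simp)
  let inr : K' ⟶ L := linComplexMap (fun n => LinearMap.inr ℚ (M n) (M' n)) (by intro n x; simp)
  let fst : L ⟶ K := linComplexMap (fun n => LinearMap.fst ℚ (M n) (M' n)) (by intro n x; simp)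
  let snd : L ⟶ K' := linComplexMap (fun n => LinearMap.snd ℚ (M n) (M' n)) (by intro n x; simp)
  have e1 : inl ≫ fst = 𝟙 K := by ext n x; rfl
  have e2 : inr ≫ snd = 𝟙 K' := by ext n x; rfl
  have e3 : inl ≫ snd = 0 := by ext n x; rfl
  have e4 : inr ≫ fst = 0 := by ext n x; rfl
  have e5 : fst ≫ inl + snd ≫ inr = 𝟙 L := by
    ext n x
    exact (Prod.ext (by change x.1 + 0 = x.1; simp) (by change 0 + x.2 = x.2; simp))
  refine (ha.prod hb).of_equiv fun i => ⟨?_⟩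
  have E1 := congrArg (fun φ : K ⟶ K => (HomologicalComplex.homologyMap φ i).hom) e1
  have E2 := congrArg (fun φ : K' ⟶ K' => (HomologicalComplex.homologyMap φ i).hom) e2
  have E3 := congrArg (fun φ : K ⟶ K' => (HomologicalComplex.homologyMap φ i).hom) e3
  have E4 := congrArg (fun φ : K' ⟶ K => (HomologicalComplex.homologyMap φ i).hom) e4
  have E5 := congrArg (fun φ : L ⟶ L => (HomologicalComplex.homologyMap φ i).hom) e5
  simp only [HomologicalComplex.homologyMap_comp, HomologicalComplex.homologyMap_add,
    HomologicalComplex.homologyMap_id, HomologicalComplex.homologyMap_zero, ModuleCat.hom_comp,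
    ModuleCat.hom_add, ModuleCat.hom_id, ModuleCat.hom_zero] at E1 E2 E3 E4 E5
  refine LinearEquiv.ofLinearMap
    ((HomologicalComplex.homologyMap inl i).hom.coprod (HomologicalComplex.homologyMap inr i).hom)
    ((HomologicalComplex.homologyMap fst i).hom.prod (HomologicalComplex.homologyMap snd i).hom)
    ?_ ?_
  · rw [← E5]
    ext x
    simp
  · ext x
    · simpa using LinearMap.congr_fun E1 x
    · simpa using LinearMap.congr_fun E3 x
    · simpa using LinearMap.congr_fun E4 x
    · simpa using LinearMap.congr_fun E2 x

/-- A degreewise short exact sequence of complexes of modules is short exact. -/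
theorem shortExact_of_degreewise {M'' : ℕ → Type} [∀ n, AddCommGroup (M'' n)]
    [∀ n, Module ℚ (M'' n)]
    {d : ∀ n, M (n + 1) →ₗ[ℚ] M n} {hd : ∀ n x, d n (d (n + 1) x) = 0}
    {d' : ∀ n, M' (n + 1) →ₗ[ℚ] M' n} {hd' : ∀ n x, d' n (d' (n + 1) x) = 0}
    {d'' : ∀ n, M'' (n + 1) →ₗ[ℚ] M'' n} {hd'' : ∀ n x, d'' n (d'' (n + 1) x) = 0}
    (f : ∀ n, M n →ₗ[ℚ] M' n) (hf : ∀ n x, f n (d n x) = d' n (f (n + 1) x))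
    (g : ∀ n, M' n →ₗ[ℚ] M'' n) (hg : ∀ n x, g n (d' n x) = d'' n (g (n + 1) x))
    (hinj : ∀ n, Function.Injective (f n)) (hex : ∀ n, Function.Exact (f n) (g n))
    (hsurj : ∀ n, Function.Surjective (g n)) :
    ∃ h, (ShortComplex.mk (linComplexMap f hf : linComplex d hd ⟶ linComplex d' hd')
      (linComplexMap g hg : linComplex d' hd' ⟶ linComplex d'' hd'') h).ShortExact := by
  have h : (linComplexMap f hf : linComplex d hd ⟶ linComplex d' hd') ≫
      (linComplexMap g hg : linComplex d' hd' ⟶ linComplex d'' hd'') = 0 := by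
    ext n x
    exact (hex n).apply_apply_eq_zero x
  refine ⟨h, HomologicalComplex.shortExact_of_degreewise_shortExact _ fun n => ?_⟩
  exact ModuleCat.shortComplex_shortExact _ (hex n) (hinj n) (hsurj n)

variable (d : ∀ n, M (n + 1) →ₗ[ℚ] M n) (hd : ∀ n x, d n (d (n + 1) x) = 0)

/-- The subcomplex with the given submodules of chains. -/
def subComplex (P : ∀ n, Submodule ℚ (M n)) (hP : ∀ n, ∀ x ∈ P (n + 1), d n x ∈ P n) :
    ChainComplex (ModuleCat.{0} ℚ) ℕ :=
  linComplex (M := fun n => P n) (fun n => (d n).restrict (hP n)) fun n x => by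
    ext
    exact hd n x

/-- The Mayer-Vietoris formula for two subcomplexes, from the short exact sequence
`0 → P ⊓ Q → P × Q → P ⊔ Q → 0`. -/
theorem gradedChi_sup {P Q : ∀ n, Submodule ℚ (M n)} (hP : ∀ n, ∀ x ∈ P (n + 1), d n x ∈ P n)
    (hQ : ∀ n, ∀ x ∈ Q (n + 1), d n x ∈ Q n)
    (hi : ∀ n, ∀ x ∈ P (n + 1) ⊓ Q (n + 1), d n x ∈ P n ⊓ Q n)
    (hs : ∀ n, ∀ x ∈ P (n + 1) ⊔ Q (n + 1), d n x ∈ P n ⊔ Q n) {a b c : ℤ}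
    (ha : GradedChi (fun i => (subComplex d hd P hP).homology i) a)
    (hb : GradedChi (fun i => (subComplex d hd Q hQ).homology i) b)
    (hc : GradedChi (fun i => (subComplex d hd (fun n => P n ⊓ Q n) hi).homology i) c) :
    GradedChi (fun i => (subComplex d hd (fun n => P n ⊔ Q n) hs).homology i) (a + b - c) := by
  have hprod := gradedChi_prod ha hb (by
    intro n x
    ext
    · exact hd n x.1
    · exact hd n x.2)
  let f : ∀ n, ↥(P n ⊓ Q n) →ₗ[ℚ] P n × Q n := fun n =>
    (Submodule.inclusion inf_le_left).prod (Submodule.inclusion inf_le_right)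
  let g : ∀ n, P n × Q n →ₗ[ℚ] ↥(P n ⊔ Q n) := fun n =>
    (Submodule.inclusion le_sup_left).coprod (-(Submodule.inclusion le_sup_right))
  obtain ⟨h, hS⟩ := shortExact_of_degreewise
    (d := fun n => (d n).restrict (hi n)) (hd := fun n x => by ext; exact hd n x)
    (d' := fun n => ((d n).restrict (hP n)).prodMap ((d n).restrict (hQ n)))
    (hd' := fun n x => by
      ext
      · exact hd n x.1
      · exact hd n x.2)
    (d'' := fun n => (d n).restrict (hs n)) (hd'' := fun n x => by ext; exact hd n x)
    f (fun n x => rfl) g (fun n x => by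
      ext
      simp [g])
    (fun n x y hxy => by
      ext
      simpa [f] using congrArg (fun z => (z.1 : M n)) hxy)
    (fun n z => by
      constructor
      · intro hz
        have hz' : (z.1 : M n) = z.2 := by
          have := congrArg (fun w : ↥(P n ⊔ Q n) => (w : M n)) hz
          simpa [g, ← sub_eq_add_neg, sub_eq_zero] using this
        exact ⟨⟨z.1, z.1.2, hz' ▸ z.2.2⟩, Prod.ext rfl (Subtype.ext hz')⟩
      · rintro ⟨x, rfl⟩
        ext
        simp [f, g])
    (fun n z => by
      obtain ⟨x, hx, y, hy, hxy⟩ := Submodule.mem_sup.1 z.2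
      exact ⟨(⟨x, hx⟩, -⟨y, hy⟩), by ext; simpa [g] using hxy⟩)
  exact gradedChi_of_shortExact hS hc hprod

/-- If every chain is carried into the subcomplex `P` by an iterate of a chain map `s` that
preserves `P` and is homotopic to the identity, by a homotopy that preserves `P`, then `P` has the
same homology as the whole complex. -/
theorem nonempty_homology_equiv_of_homotopy {P : ∀ n, Submodule ℚ (M n)}
    (hP : ∀ n, ∀ x ∈ P (n + 1), d n x ∈ P n) (s : ∀ n, M n →ₗ[ℚ] M n)
    (T : ∀ n, M n →ₗ[ℚ] M (n + 1)) (hT0 : ∀ x, d 0 (T 0 x) = x - s 0 x)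
    (hT : ∀ n x, d (n + 1) (T (n + 1) x) = x - s (n + 1) x - T n (d n x))
    (hs : ∀ n x, d n (s (n + 1) x) = s n (d n x))
    (hsP : ∀ n, ∀ x ∈ P n, s n x ∈ P n) (hTP : ∀ n, ∀ x ∈ P n, T n x ∈ P (n + 1))
    (hk : ∀ n x, ∃ k : ℕ, ((s n) ^ k) x ∈ P n) (i : ℕ) :
    Nonempty ((subComplex d hd P hP).homology i ≃ₗ[ℚ] (linComplex d hd).homology i) := by
  -- the quotient complex is exact: modulo `P`, a cycle differs from its images under the iterates
  -- of `s` by boundaries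
  have key0 : ∀ (k : ℕ) (x : M 0), ∃ w, x - ((s 0) ^ k) x = d 0 w := by
    intro k
    induction k with
    | zero => exact fun x => ⟨0, by simp⟩
    | succ k ih =>
      intro x
      obtain ⟨w, hw⟩ := ih (s 0 x)
      refine ⟨T 0 x + w, ?_⟩
      rw [map_add, ← hw, hT0, pow_succ, Module.End.mul_apply]
      abel
  have key : ∀ (k n : ℕ) (x : M (n + 1)), d n x ∈ P n →
      ∃ w, x - ((s (n + 1)) ^ k) x - d (n + 1) w ∈ P (n + 1) := by
    intro k
    induction k with
    | zero => exact fun n x _ => ⟨0, by simp⟩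
    | succ k ih =>
      intro n x hx
      obtain ⟨w, hw⟩ := ih n (s (n + 1) x) (by rw [hs]; exact hsP n _ hx)
      refine ⟨T (n + 1) x + w, ?_⟩
      have h2 := (P (n + 1)).add_mem hw (hTP n _ hx)
      rw [map_add, hT, pow_succ, Module.End.mul_apply]
      convert h2 using 1
      abel
  let dq : ∀ n, (M (n + 1) ⧸ P (n + 1)) →ₗ[ℚ] (M n ⧸ P n) := fun n =>
    (P (n + 1)).mapQ (P n) (d n) (hP n)
  have hdq : ∀ n x, dq n (dq (n + 1) x) = 0 := by
    intro n x
    obtain ⟨x, rfl⟩ := Submodule.Quotient.mk_surjective _ x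
    simp [dq, hd]
  obtain ⟨h, hS⟩ := shortExact_of_degreewise
    (d := fun n => (d n).restrict (hP n)) (hd := fun n x => by ext; exact hd n x)
    (d' := d) (hd' := hd) (d'' := dq) (hd'' := hdq)
    (fun n => (P n).subtype) (fun n x => rfl) (fun n => (P n).mkQ) (fun n x => rfl)
    (fun n => Subtype.val_injective)
    (fun n x => by simp [Submodule.Quotient.mk_eq_zero])
    (fun n => Submodule.Quotient.mk_surjective _)
  have hex : ∀ j, (linComplex (M := fun n => M n ⧸ P n) dq hdq).ExactAt j := by
    intro j
    cases j with
    | zero =>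
      rw [HomologicalComplex.exactAt_iff' _ 1 0 0 (by simp) (by simp),
        ShortComplex.moduleCat_exact_iff]
      intro (x : M 0 ⧸ P 0) _
      obtain ⟨x, rfl⟩ := Submodule.Quotient.mk_surjective _ x
      obtain ⟨k, hk⟩ := hk 0 x
      obtain ⟨w, hw⟩ := key0 k x
      refine ⟨(P 1).mkQ w, ?_⟩
      change ((linComplex (M := fun n => M n ⧸ P n) dq hdq).d 1 0).hom _ = _
      have : (linComplex (M := fun n => M n ⧸ P n) dq hdq).d 1 0 = ModuleCat.ofHom (dq 0) :=
        linComplex_d ..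
      rw [this]
      change (P 0).mkQ (d 0 w) = (P 0).mkQ x
      rw [← hw, map_sub, sub_eq_self]
      simpa using hk
    | succ n =>
      rw [HomologicalComplex.exactAt_iff' _ (n + 2) (n + 1) n (by simp) (by simp),
        ShortComplex.moduleCat_exact_iff]
      intro (x : M (n + 1) ⧸ P (n + 1)) hx
      obtain ⟨x, rfl⟩ := Submodule.Quotient.mk_surjective _ x
      have e2 : (linComplex (M := fun n => M n ⧸ P n) dq hdq).d (n + 1) n = ModuleCat.ofHom (dq n) :=
        linComplex_d ..
      have e1 : (linComplex (M := fun n => M n ⧸ P n) dq hdq).d (n + 2) (n + 1) = ModuleCat.ofHom (dq (n + 1)) :=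
        linComplex_d ..
      change ((linComplex (M := fun n => M n ⧸ P n) dq hdq).d (n + 1) n).hom _ = _ at hx
      rw [e2] at hx
      have hx' : d n x ∈ P n := (Submodule.Quotient.mk_eq_zero _).1 hx
      obtain ⟨k, hk⟩ := hk (n + 1) x
      obtain ⟨w, hw⟩ := key k n x hx'
      refine ⟨(P (n + 2)).mkQ w, ?_⟩
      change ((linComplex (M := fun n => M n ⧸ P n) dq hdq).d (n + 2) (n + 1)).hom _ = _
      rw [e1]
      change (P (n + 1)).mkQ (d (n + 1) w) = (P (n + 1)).mkQ x
      rw [eq_comm, ← sub_eq_zero, ← map_sub, ← LinearMap.mem_ker, Submodule.ker_mkQ]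
      convert (P (n + 1)).add_mem hw hk using 1
      abel
  exact ⟨LinearEquiv.ofBijective _ (bijective_homologyMap_of_shortExact hS hex i)⟩

end LinearAlgebra

end

/-! ### Barycentric subdivision of tuples -/

section

open CategoryTheory Limits

section Faces

variable {S : ℕ → Type} (δ : ∀ n, Fin (n + 2) → S (n + 1) → S n)

/-- The alternating sum of the faces, on rational chains. -/
def faceBoundary (n : ℕ) : (S (n + 1) →₀ ℚ) →ₗ[ℚ] (S n →₀ ℚ) :=
  Finsupp.linearCombination ℚ fun σ =>
    ∑ i : Fin (n + 2), (-1 : ℚ) ^ (i : ℕ) • Finsupp.single (δ n i σ) 1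

theorem faceBoundary_single (n : ℕ) (σ : S (n + 1)) :
    faceBoundary δ n (Finsupp.single σ 1) =
      ∑ i : Fin (n + 2), (-1 : ℚ) ^ (i : ℕ) • Finsupp.single (δ n i σ) 1 := by
  simp [faceBoundary]

/-- The square of the boundary is zero, by the simplicial identity for the faces. -/
theorem faceBoundary_faceBoundary
    (h : ∀ n (i j : Fin (n + 2)), i ≤ j → ∀ σ,
      δ n i (δ (n + 1) j.succ σ) = δ n j (δ (n + 1) i.castSucc σ)) (n : ℕ)
    (x : S (n + 2) →₀ ℚ) : faceBoundary δ n (faceBoundary δ (n + 1) x) = 0 := by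
  induction x using Finsupp.induction_linear with
  | zero => simp
  | add x y hx hy => rw [map_add, map_add, hx, hy, add_zero]
  | single σ a =>
    rw [← mul_one a, ← smul_eq_mul, ← Finsupp.smul_single, map_smul, map_smul,
      faceBoundary_single, map_sum]
    convert smul_zero a using 2
    simp only [map_smul, faceBoundary_single, Finset.smul_sum, smul_smul]
    rw [← Finset.sum_product', Finset.univ_product_univ]
    -- the terms cancel in pairs by the simplicial identity
    refine Finset.sum_involution (fun ji _ =>
      if hlt : ji.2.castSucc < ji.1 then (ji.2.castSucc, ji.1.pred (Fin.ne_zero_of_lt hlt))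
      else (ji.2.succ, ji.1.castPred (by
        have := ji.2.castSucc_lt_last
        exact (lt_of_le_of_lt (not_lt.1 hlt) this).ne))) ?_ ?_ (fun _ _ => Finset.mem_univ _) ?_
    · rintro ⟨j, i⟩ _
      by_cases hlt : i.castSucc < j
      · simp only [hlt, dif_pos]
        obtain ⟨j, rfl⟩ := Fin.exists_succ_eq.2 (Fin.ne_zero_of_lt hlt)
        have hij : i ≤ j := Fin.castSucc_lt_succ_iff.1 hlt
        simp only [Fin.pred_succ, Fin.val_succ, Fin.val_castSucc, h n i j hij]
        rw [← add_smul]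
        convert zero_smul ℚ _
        ring
      · simp only [hlt, dif_neg, not_false_iff]
        have hne : j ≠ Fin.last _ := (lt_of_le_of_lt (not_lt.1 hlt) i.castSucc_lt_last).ne
        obtain ⟨j, rfl⟩ := Fin.exists_castSucc_eq.2 hne
        have hij : j ≤ i := by simpa using hlt
        simp only [Fin.castPred_castSucc, Fin.val_succ, Fin.val_castSucc, h n j i hij]
        rw [← add_smul]
        convert zero_smul ℚ _
        ring
    · rintro ⟨j, i⟩ _ _
      by_cases hlt : i.castSucc < j
      · simp only [hlt, dif_pos, ne_eq, Prod.mk.injEq, not_and]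
        intro h1
        exact absurd h1 hlt.ne
      · simp only [hlt, dif_neg, not_false_iff, ne_eq, Prod.mk.injEq, not_and]
        intro h1
        exfalso
        apply hlt
        rw [← h1]
        exact Fin.castSucc_lt_succ
    · rintro ⟨j, i⟩ _
      by_cases hlt : i.castSucc < j
      · obtain ⟨j, rfl⟩ := Fin.exists_succ_eq.2 (Fin.ne_zero_of_lt hlt)
        have hij : i ≤ j := Fin.castSucc_lt_succ_iff.1 hlt
        simp [hlt, not_lt.2 hij]
      · have hne : j ≠ Fin.last _ := (lt_of_le_of_lt (not_lt.1 hlt) i.castSucc_lt_last).ne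
        obtain ⟨j, rfl⟩ := Fin.exists_castSucc_eq.2 hne
        have hij : j ≤ i := by simpa using hlt
        simp [hij, not_lt.2 hij]

theorem faceBoundary_mapDomain {S' : ℕ → Type} (δ' : ∀ n, Fin (n + 2) → S' (n + 1) → S' n)
    (f : ∀ n, S n → S' n) (hf : ∀ n i σ, f n (δ n i σ) = δ' n i (f (n + 1) σ)) (n : ℕ)
    (x : S (n + 1) →₀ ℚ) :
    faceBoundary δ' n (Finsupp.mapDomain (f (n + 1)) x) =
      Finsupp.mapDomain (f n) (faceBoundary δ n x) := by
  induction x using Finsupp.induction_linear with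
  | zero => simp
  | add x y hx hy => rw [Finsupp.mapDomain_add, map_add, map_add, hx, hy, Finsupp.mapDomain_add]
  | single σ a =>
    rw [← mul_one a, ← smul_eq_mul, ← Finsupp.smul_single, Finsupp.mapDomain_smul, map_smul,
      map_smul, Finsupp.mapDomain_smul, Finsupp.mapDomain_single, faceBoundary_single,
      faceBoundary_single, Finsupp.mapDomain_finsetSum]
    simp only [Finsupp.mapDomain_smul, Finsupp.mapDomain_single, hf]

end Faces

section Tuples

variable {P : Type}

/-- The faces of a tuple of points. -/
def tupleFace (P : Type) (n : ℕ) (i : Fin (n + 2)) (v : Fin (n + 2) → P) : Fin (n + 1) → P :=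
  v ∘ i.succAbove

/-- The boundary on formal combinations of tuples of points. -/
abbrev tupleBd (P : Type) (n : ℕ) :
    ((Fin (n + 2) → P) →₀ ℚ) →ₗ[ℚ] ((Fin (n + 1) → P) →₀ ℚ) :=
  faceBoundary (S := fun n => Fin (n + 1) → P) (tupleFace P) n

theorem tupleBd_tupleBd (n : ℕ) (x : (Fin (n + 3) → P) →₀ ℚ) :
    tupleBd P n (tupleBd P (n + 1) x) = 0 := by
  refine faceBoundary_faceBoundary (S := fun n => Fin (n + 1) → P) _ (fun n i j hij v => ?_) n x
  funext k
  simp only [tupleFace, Function.comp_apply]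
  congr 1
  have := Fin.succAbove_succAbove_succAbove_predAbove (n := n + 1) j.succ i k
  rw [Fin.succAbove_of_castSucc_lt j.succ i (Fin.castSucc_lt_succ_iff.2 hij)] at this
  rw [← this]
  congr 2
  rw [Fin.predAbove_of_castSucc_lt _ _ (Fin.castSucc_lt_succ_iff.2 hij)]
  simp

/-- The cone with apex `b`. -/
def tupleCone (b : P) (n : ℕ) : ((Fin (n + 1) → P) →₀ ℚ) →ₗ[ℚ] ((Fin (n + 2) → P) →₀ ℚ) :=
  Finsupp.lmapDomain ℚ ℚ fun v => Fin.cons b v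

theorem tupleFace_zero_cons (b : P) (n : ℕ) (v : Fin (n + 1) → P) :
    tupleFace P n 0 (Fin.cons b v : Fin (n + 2) → P) = v := by
  funext k
  simp [tupleFace]

theorem tupleFace_succ_cons (b : P) (n : ℕ) (i : Fin (n + 2)) (v : Fin (n + 2) → P) :
    tupleFace P (n + 1) i.succ (Fin.cons b v : Fin (n + 3) → P) =
      Fin.cons b (tupleFace P n i v) := by
  funext k
  refine Fin.cases ?_ (fun k => ?_) k
  · simp [tupleFace]
  · simp [tupleFace]

theorem tupleBd_cone_succ (b : P) (n : ℕ) (x : (Fin (n + 2) → P) →₀ ℚ) :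
    tupleBd P (n + 1) (tupleCone b (n + 1) x) = x - tupleCone b n (tupleBd P n x) := by
  induction x using Finsupp.induction_linear with
  | zero => simp
  | add x y hx hy => rw [map_add, map_add, map_add, hx, hy, map_add]; abel
  | single v a =>
    rw [← mul_one a, ← smul_eq_mul, ← Finsupp.smul_single, map_smul, map_smul, map_smul, map_smul,
      ← smul_sub]
    congr 1
    rw [faceBoundary_single, map_sum]
    simp only [map_smul, tupleCone, Finsupp.lmapDomain_apply, Finsupp.mapDomain_single]
    rw [faceBoundary_single, Fin.sum_univ_succ]
    simp only [tupleFace_zero_cons, tupleFace_succ_cons]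
    simp [pow_succ, sub_eq_add_neg]

theorem tupleBd_cone_zero (b : P) (v : Fin 1 → P) :
    tupleBd P 0 (tupleCone b 0 (Finsupp.single v 1)) =
      Finsupp.single v 1 - Finsupp.single (fun _ => b) 1 := by
  simp only [tupleCone, Finsupp.lmapDomain_apply, Finsupp.mapDomain_single]
  rw [faceBoundary_single, Fin.sum_univ_two, tupleFace_zero_cons]
  have : tupleFace P 0 1 (Fin.cons b v : Fin 2 → P) = fun _ => b := by
    funext k
    fin_cases k
    simp [tupleFace]
  simp [this, sub_eq_add_neg]

/-- In the boundary of the cone over the boundary of an edge, the contributions of the apex from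
the two endpoints cancel. -/
theorem tupleBd_cone_tupleBd_zero (b : P) (x : (Fin 2 → P) →₀ ℚ) :
    tupleBd P 0 (tupleCone b 0 (tupleBd P 0 x)) = tupleBd P 0 x := by
  induction x using Finsupp.induction_linear with
  | zero => simp
  | add x y hx hy => simp only [map_add, hx, hy]
  | single v a =>
    rw [← mul_one a, ← smul_eq_mul, ← Finsupp.smul_single]
    simp only [map_smul]
    congr 1
    rw [faceBoundary_single, Fin.sum_univ_two]
    simp only [map_add, map_smul, tupleBd_cone_zero]
    simp only [Fin.val_zero, Fin.val_one, pow_zero, pow_one, one_smul, neg_smul]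
    abel

variable (β : ∀ n, (Fin (n + 1) → P) → P)

/-- The subdivision of formal combinations of tuples, where `β` gives the point at which a tuple is
subdivided: the cone from this point over the subdivided boundary. -/
def tupleSd : ∀ n, ((Fin (n + 1) → P) →₀ ℚ) →ₗ[ℚ] ((Fin (n + 1) → P) →₀ ℚ)
  | 0 => LinearMap.id
  | n + 1 => Finsupp.linearCombination ℚ fun v =>
      tupleCone (β (n + 1) v) n (tupleSd n (tupleBd P n (Finsupp.single v 1)))

/-- The chain homotopy between the identity and the subdivision. -/
def tupleHomotopy : ∀ n, ((Fin (n + 1) → P) →₀ ℚ) →ₗ[ℚ] ((Fin (n + 2) → P) →₀ ℚ)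
  | 0 => 0
  | n + 1 => Finsupp.linearCombination ℚ fun v =>
      tupleCone (β (n + 1) v) (n + 1)
        (Finsupp.single v 1 - tupleHomotopy n (tupleBd P n (Finsupp.single v 1)))

theorem tupleSd_zero (x : (Fin 1 → P) →₀ ℚ) : tupleSd β 0 x = x := rfl

theorem tupleSd_single (n : ℕ) (v : Fin (n + 2) → P) : tupleSd β (n + 1) (Finsupp.single v 1) =
    tupleCone (β (n + 1) v) n (tupleSd β n (tupleBd P n (Finsupp.single v 1))) := by
  simp [tupleSd]

theorem tupleHomotopy_zero (x : (Fin 1 → P) →₀ ℚ) : tupleHomotopy β 0 x = 0 := rfl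

theorem tupleHomotopy_single (n : ℕ) (v : Fin (n + 2) → P) :
    tupleHomotopy β (n + 1) (Finsupp.single v 1) = tupleCone (β (n + 1) v) (n + 1)
      (Finsupp.single v 1 - tupleHomotopy β n (tupleBd P n (Finsupp.single v 1))) := by
  simp [tupleHomotopy]

theorem finsupp_linearMap_ext {α N : Type} [AddCommGroup N] [Module ℚ N] {f g : (α →₀ ℚ) →ₗ[ℚ] N}
    (h : ∀ a, f (Finsupp.single a 1) = g (Finsupp.single a 1)) (x : α →₀ ℚ) : f x = g x :=
  LinearMap.congr_fun (Finsupp.lhom_ext' fun a => LinearMap.ext_ring (h a)) x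

theorem tupleBd_sd (n : ℕ) (x : (Fin (n + 2) → P) →₀ ℚ) :
    tupleBd P n (tupleSd β (n + 1) x) = tupleSd β n (tupleBd P n x) := by
  induction n with
  | zero =>
    refine finsupp_linearMap_ext (f := tupleBd P 0 ∘ₗ tupleSd β 1)
      (g := tupleSd β 0 ∘ₗ tupleBd P 0) (fun v => ?_) x
    simp only [LinearMap.comp_apply, tupleSd_single, tupleSd_zero, tupleBd_cone_tupleBd_zero]
  | succ n ih =>
    refine finsupp_linearMap_ext (f := tupleBd P (n + 1) ∘ₗ tupleSd β (n + 2))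
      (g := tupleSd β (n + 1) ∘ₗ tupleBd P (n + 1)) (fun v => ?_) x
    simp only [LinearMap.comp_apply]
    rw [tupleSd_single, tupleBd_cone_succ, ih, tupleBd_tupleBd, map_zero, map_zero, sub_zero]

theorem tupleBd_homotopy (n : ℕ) (x : (Fin (n + 2) → P) →₀ ℚ) :
    tupleBd P (n + 1) (tupleHomotopy β (n + 1) x) =
      x - tupleSd β (n + 1) x - tupleHomotopy β n (tupleBd P n x) := by
  refine finsupp_linearMap_ext (f := tupleBd P (n + 1) ∘ₗ tupleHomotopy β (n + 1))
    (g := LinearMap.id - tupleSd β (n + 1) - tupleHomotopy β n ∘ₗ tupleBd P n) (fun v => ?_) x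
  simp only [LinearMap.comp_apply, LinearMap.sub_apply, LinearMap.id_apply]
  rw [tupleHomotopy_single, tupleBd_cone_succ, map_sub (tupleBd P n)]
  cases n with
  | zero =>
    rw [tupleHomotopy_zero, tupleSd_single, tupleSd_zero]
    simp only [map_zero, sub_zero]
  | succ n =>
    rw [tupleBd_homotopy n, tupleBd_tupleBd, map_zero, tupleSd_single (n := n + 1)]
    simp only [sub_sub_cancel, sub_zero]
    abel

variable {P' : Type} (β' : ∀ n, (Fin (n + 1) → P') → P') (φ : P → P')

theorem tupleBd_map (n : ℕ) (x : (Fin (n + 2) → P) →₀ ℚ) :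
    tupleBd P' n (Finsupp.mapDomain (fun v => φ ∘ v) x) =
      Finsupp.mapDomain (fun v => φ ∘ v) (tupleBd P n x) :=
  faceBoundary_mapDomain (S := fun n => Fin (n + 1) → P) (S' := fun n => Fin (n + 1) → P') _ _
    (fun _ v => φ ∘ v) (fun _ _ _ => rfl) n x

theorem tupleCone_map (b : P) (n : ℕ) (x : (Fin (n + 1) → P) →₀ ℚ) :
    tupleCone (φ b) n (Finsupp.mapDomain (fun v => φ ∘ v) x) =
      Finsupp.mapDomain (fun v => φ ∘ v) (tupleCone b n x) := by
  simp only [tupleCone, Finsupp.lmapDomain_apply, ← Finsupp.mapDomain_comp]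
  congr 1
  funext v
  funext k
  refine Fin.cases ?_ (fun k => ?_) k <;> simp

variable {β β' φ}

theorem tupleSd_map (hφ : ∀ n v, φ (β n v) = β' n (φ ∘ v)) (n : ℕ)
    (x : (Fin (n + 1) → P) →₀ ℚ) :
    tupleSd β' n (Finsupp.mapDomain (fun v => φ ∘ v) x) =
      Finsupp.mapDomain (fun v => φ ∘ v) (tupleSd β n x) := by
  induction n with
  | zero => rfl
  | succ n ih =>
    refine finsupp_linearMap_ext
      (f := tupleSd β' (n + 1) ∘ₗ Finsupp.lmapDomain ℚ ℚ fun v => φ ∘ v)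
      (g := (Finsupp.lmapDomain ℚ ℚ fun v => φ ∘ v) ∘ₗ tupleSd β (n + 1)) (fun v => ?_) x
    simp only [LinearMap.comp_apply, Finsupp.lmapDomain_apply]
    rw [tupleSd_single, ← tupleCone_map, ← ih, ← tupleBd_map, Finsupp.mapDomain_single,
      tupleSd_single, hφ]

theorem tupleHomotopy_map (hφ : ∀ n v, φ (β n v) = β' n (φ ∘ v)) (n : ℕ)
    (x : (Fin (n + 1) → P) →₀ ℚ) :
    tupleHomotopy β' n (Finsupp.mapDomain (fun v => φ ∘ v) x) =
      Finsupp.mapDomain (fun v => φ ∘ v) (tupleHomotopy β n x) := by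
  induction n with
  | zero => simp [tupleHomotopy]
  | succ n ih =>
    refine finsupp_linearMap_ext
      (f := tupleHomotopy β' (n + 1) ∘ₗ Finsupp.lmapDomain ℚ ℚ fun v => φ ∘ v)
      (g := (Finsupp.lmapDomain ℚ ℚ fun v => φ ∘ v) ∘ₗ tupleHomotopy β (n + 1)) (fun v => ?_) x
    have hsub : ∀ a b : (Fin (n + 2) → P) →₀ ℚ, Finsupp.mapDomain (fun v => φ ∘ v) (a - b) =
        Finsupp.mapDomain (fun v => φ ∘ v) a - Finsupp.mapDomain (fun v => φ ∘ v) b :=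
      map_sub (Finsupp.lmapDomain ℚ ℚ fun v => φ ∘ v)
    simp only [LinearMap.comp_apply, Finsupp.lmapDomain_apply]
    rw [tupleHomotopy_single, ← tupleCone_map, hsub, ← ih, ← tupleBd_map,
      Finsupp.mapDomain_single, tupleHomotopy_single, hφ]

end Tuples

end

/-! ### Barycentric subdivision of singular chains -/

section

open CategoryTheory Limits

section Affine

/-- The standard topological simplex of dimension `n`. -/
abbrev Simp (n : ℕ) : Type := stdSimplex ℝ (Fin (n + 1))

/-- The affine map of simplices with the given images of the vertices. -/
def affineMap {n m : ℕ} (v : Fin (n + 1) → Simp m) : C(Simp n, Simp m) where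
  toFun t := ⟨∑ i, t.1 i • (v i).1, (convex_stdSimplex ℝ _).sum_mem (fun i _ => t.2.1 i) t.2.2
    fun i _ => (v i).2⟩
  continuous_toFun := by
    refine Continuous.subtype_mk ?_ _
    refine continuous_finsetSum _ fun i _ => ?_
    exact ((continuous_apply i).comp continuous_subtype_val).smul continuous_const

theorem affineMap_val {n m : ℕ} (v : Fin (n + 1) → Simp m) (t : Simp n) :
    (affineMap v t).1 = ∑ i, t.1 i • (v i).1 := rfl

theorem affineMap_vertex_apply {n m : ℕ} (v : Fin (n + 1) → Simp m) (j : Fin (n + 1)) :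
    affineMap v (stdSimplex.vertex j) = v j := by
  apply Subtype.ext
  rw [affineMap_val, Finset.sum_eq_single j]
  · simp
  · intro i _ hij
    simp [Pi.single_eq_of_ne hij]
  · simp

theorem affineMap_affineMap {n m k : ℕ} (w : Fin (m + 1) → Simp k) (v : Fin (n + 1) → Simp m)
    (t : Simp n) : affineMap w (affineMap v t) = affineMap (fun j => affineMap w (v j)) t := by
  apply Subtype.ext
  simp only [affineMap_val, Finset.sum_apply, Pi.smul_apply, Finset.sum_smul, Finset.smul_sum,
    smul_assoc]
  exact Finset.sum_comm

theorem affineMap_map {n m k : ℕ} (v : Fin (m + 1) → Simp k) (f : Fin (n + 1) → Fin (m + 1))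
    (t : Simp n) : affineMap v (stdSimplex.map f t) = affineMap (v ∘ f) t := by
  apply Subtype.ext
  have h : (stdSimplex.map f t).1 = FunOnFinite.linearMap ℝ ℝ f t.1 := rfl
  simp only [affineMap_val, h, FunOnFinite.linearMap_apply_apply, Finset.sum_smul,
    Function.comp_apply]
  rw [← Finset.sum_fiberwise Finset.univ f]
  refine Finset.sum_congr rfl fun j _ => Finset.sum_congr rfl fun i hi => ?_
  rw [(Finset.mem_filter.1 hi).2]

theorem affineMap_vertex (n : ℕ) :
    affineMap (fun j : Fin (n + 1) => (stdSimplex.vertex j : Simp n)) = ContinuousMap.id _ := by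
  ext t : 1
  apply Subtype.ext
  ext k
  rw [affineMap_val, Finset.sum_apply, Finset.sum_eq_single k]
  · simp
  · intro i _ hij
    simp [Pi.single_eq_of_ne' hij]
  · simp

/-- The barycenter of a tuple of points. -/
def tupleBarycenter (m n : ℕ) (v : Fin (n + 1) → Simp m) : Simp m :=
  affineMap v stdSimplex.barycenter

theorem affineMap_tupleBarycenter {m k : ℕ} (w : Fin (m + 1) → Simp k) (n : ℕ)
    (v : Fin (n + 1) → Simp m) :
    affineMap w (tupleBarycenter m n v) = tupleBarycenter k n (affineMap w ∘ v) :=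
  affineMap_affineMap _ _ _

theorem dist_affineMap_le {n m : ℕ} {v : Fin (n + 1) → Simp m} {p : Simp m} {r : ℝ}
    (h : ∀ j, dist (v j) p ≤ r) (t : Simp n) : dist (affineMap v t) p ≤ r := by
  have := (convex_closedBall p.1 r).sum_mem (t := Finset.univ) (w := t.1) (z := fun i => (v i).1)
    (fun i _ => t.2.1 i) t.2.2 fun i _ => h i
  exact this

/-- The barycenter is closer to a vertex by the factor `n / (n + 1)`, since the vertex itself is one
of the `n + 1` points of the average. -/
theorem dist_tupleBarycenter_le {n m : ℕ} {v : Fin (n + 1) → Simp m} {D : ℝ}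
    (h : ∀ i j, dist (v i) (v j) ≤ D) (j : Fin (n + 1)) :
    dist (v j) (tupleBarycenter m n v) ≤ n / (n + 1) * D := by
  have hn : (n + 1 : ℝ) ≠ 0 := by positivity
  have e : (tupleBarycenter m n v).1 - (v j).1 =
      ∑ i, ((n + 1 : ℝ)⁻¹) • ((v i).1 - (v j).1) := by
    rw [tupleBarycenter, affineMap_val]
    simp only [stdSimplex.barycenter_apply, Fintype.card_fin, smul_sub, Finset.sum_sub_distrib,
      Finset.sum_const, Finset.card_univ, ← Nat.cast_smul_eq_nsmul ℝ, smul_smul]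
    push_cast
    rw [mul_inv_cancel₀ hn, one_smul]
  rw [dist_comm, Subtype.dist_eq, dist_eq_norm, e]
  refine (norm_sum_le _ _).trans ?_
  rw [← Finset.add_sum_erase _ _ (Finset.mem_univ j), sub_self, smul_zero, norm_zero, zero_add]
  refine (Finset.sum_le_card_nsmul _ _ ((n + 1 : ℝ)⁻¹ * D) fun i _ => ?_).trans ?_
  · rw [norm_smul, Real.norm_of_nonneg (by positivity)]
    refine mul_le_mul_of_nonneg_left ?_ (by positivity)
    rw [← dist_eq_norm]
    exact h i j
  · rw [Finset.card_erase_of_mem (Finset.mem_univ j), Finset.card_univ, Fintype.card_fin,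
      Nat.add_sub_cancel, nsmul_eq_mul, ← mul_assoc, div_eq_mul_inv]

/-- Barycentric subdivision shrinks the diameter of an `n`-simplex by the factor `n / (n + 1)`. The
first condition, that the pieces stay within every ball that contains the vertices, carries the
induction. -/
theorem tupleSd_single_mem {m : ℕ} (n : ℕ) (v : Fin (n + 1) → Simp m) (D : ℝ) (hD : 0 ≤ D)
    (h : ∀ i j, dist (v i) (v j) ≤ D) :
    tupleSd (tupleBarycenter m) n (Finsupp.single v 1) ∈ Finsupp.supported ℚ ℚ
      {w : Fin (n + 1) → Simp m | (∀ p r, (∀ j, dist (v j) p ≤ r) → ∀ i, dist (w i) p ≤ r) ∧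
        ∀ i j, dist (w i) (w j) ≤ n / (n + 1) * D} := by
  induction n with
  | zero =>
    rw [tupleSd_zero]
    refine Finsupp.single_mem_supported _ _ ⟨fun p r hp => hp, fun i j => ?_⟩
    rw [show i = j from Fin.ext (by omega)]
    simp
  | succ n ih =>
    rw [tupleSd_single, faceBoundary_single, map_sum, map_sum]
    refine Submodule.sum_mem _ fun i _ => ?_
    rw [map_smul, map_smul]
    refine Submodule.smul_mem _ _ ?_
    have hi := ih (tupleFace _ n i v) fun a b => h _ _
    rw [tupleCone, Finsupp.lmapDomain_apply]
    have hfac : (n : ℝ) / (n + 1) * D ≤ ((n + 1 : ℕ) : ℝ) / ((n + 1 : ℕ) + 1) * D := by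
      refine mul_le_mul_of_nonneg_right ?_ hD
      rw [div_le_div_iff₀ (by positivity) (by positivity)]
      push_cast
      nlinarith
    have hmap := Submodule.mem_map_of_mem (f := Finsupp.lmapDomain ℚ ℚ
      fun w : Fin (n + 1) → Simp m => (Fin.cons (tupleBarycenter m (n + 1) v) w :
        Fin (n + 2) → Simp m)) hi
    rw [Finsupp.lmapDomain_supported] at hmap
    refine Finsupp.supported_mono ?_ hmap
    rintro _ ⟨w, ⟨hw1, hw2⟩, rfl⟩
    have hb : ∀ j, dist (v j) (tupleBarycenter m (n + 1) v) ≤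
        ((n + 1 : ℕ) : ℝ) / ((n + 1 : ℕ) + 1) * D := dist_tupleBarycenter_le h
    have hwb : ∀ j, dist (w j) (tupleBarycenter m (n + 1) v) ≤
        ((n + 1 : ℕ) : ℝ) / ((n + 1 : ℕ) + 1) * D := hw1 _ _ fun j => hb _
    beta_reduce
    refine ⟨fun p r hp j => ?_, fun j k => ?_⟩
    · refine Fin.cases ?_ (fun j => ?_) j
      · rw [Fin.cons_zero]
        exact dist_affineMap_le hp _
      · rw [Fin.cons_succ]
        exact hw1 p r (fun j => hp _) j
    · refine Fin.cases ?_ (fun j => ?_) j <;> refine Fin.cases ?_ (fun k => ?_) k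
      · rw [dist_self]; positivity
      · rw [Fin.cons_zero, Fin.cons_succ, dist_comm]
        exact hwb k
      · rw [Fin.cons_zero, Fin.cons_succ]
        exact hwb j
      · rw [Fin.cons_succ, Fin.cons_succ]
        exact (hw2 j k).trans hfac

theorem tupleSd_pow_mem {m n : ℕ} (D : ℝ) (hD : 0 ≤ D) (k : ℕ) (x : (Fin (n + 1) → Simp m) →₀ ℚ)
    (hx : x ∈ Finsupp.supported ℚ ℚ
      {w : Fin (n + 1) → Simp m | ∀ i j, dist (w i) (w j) ≤ D}) :
    (tupleSd (tupleBarycenter m) n ^ k) x ∈ Finsupp.supported ℚ ℚ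
      {w : Fin (n + 1) → Simp m | ∀ i j, dist (w i) (w j) ≤ (n / (n + 1)) ^ k * D} := by
  induction k with
  | zero => simpa using hx
  | succ k ih =>
    rw [pow_succ' (tupleSd (tupleBarycenter m) n), Module.End.mul_apply]
    set y := (tupleSd (tupleBarycenter m) n ^ k) x
    rw [Finsupp.supported_eq_span_single] at ih
    refine Submodule.span_induction (p := fun y _ => tupleSd (tupleBarycenter m) n y ∈ _)
      ?_ ?_ ?_ ?_ ih
    · rintro _ ⟨w, hw, rfl⟩
      refine Finsupp.supported_mono ?_ (tupleSd_single_mem n w _ (by positivity) hw)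
      rintro u ⟨-, hu⟩ i j
      refine (hu i j).trans (le_of_eq ?_)
      ring
    · rw [map_zero]; exact Submodule.zero_mem _
    · intro a b _ _ ha hb
      rw [map_add]; exact Submodule.add_mem _ ha hb
    · intro c a _ ha
      rw [map_smul]; exact Submodule.smul_mem _ _ ha

end Affine

section Singular

variable (X : Type) [TopologicalSpace X]

/-- The faces of a singular simplex. -/
def singFace (n : ℕ) (i : Fin (n + 2)) (σ : C(Simp (n + 1), X)) : C(Simp n, X) :=
  σ.comp ⟨stdSimplex.map i.succAbove, stdSimplex.continuous_map _⟩

/-- The boundary of singular chains. -/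
abbrev singBd (n : ℕ) : (C(Simp (n + 1), X) →₀ ℚ) →ₗ[ℚ] (C(Simp n, X) →₀ ℚ) :=
  faceBoundary (S := fun n => C(Simp n, X)) (singFace X) n

variable {X}

/-- The singular chain obtained by applying a singular simplex to affine simplices. -/
def pushTuple {m : ℕ} (σ : C(Simp m, X)) (n : ℕ) :
    ((Fin (n + 1) → Simp m) →₀ ℚ) →ₗ[ℚ] (C(Simp n, X) →₀ ℚ) :=
  Finsupp.lmapDomain ℚ ℚ fun v => σ.comp (affineMap v)

theorem pushTuple_single {m : ℕ} (σ : C(Simp m, X)) (n : ℕ) (v : Fin (n + 1) → Simp m) :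
    pushTuple σ n (Finsupp.single v 1) = Finsupp.single (σ.comp (affineMap v)) 1 := by
  simp [pushTuple]

theorem singBd_pushTuple {m : ℕ} (σ : C(Simp m, X)) (n : ℕ) (x : (Fin (n + 2) → Simp m) →₀ ℚ) :
    singBd X n (pushTuple σ (n + 1) x) = pushTuple σ n (tupleBd (Simp m) n x) := by
  refine faceBoundary_mapDomain (S := fun n => Fin (n + 1) → Simp m)
    (S' := fun n => C(Simp n, X)) (tupleFace (Simp m)) (singFace X)
    (fun _ v => σ.comp (affineMap v)) (fun n i v => ?_) n x
  ext t
  simp only [singFace, tupleFace, ContinuousMap.comp_apply, ContinuousMap.coe_mk, affineMap_map]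

theorem pushTuple_comp {m k : ℕ} (σ : C(Simp k, X)) (w : Fin (m + 1) → Simp k) (n : ℕ)
    (x : (Fin (n + 1) → Simp m) →₀ ℚ) :
    pushTuple σ n (Finsupp.mapDomain (fun v => affineMap w ∘ v) x) =
      pushTuple (σ.comp (affineMap w)) n x := by
  rw [pushTuple, pushTuple, Finsupp.lmapDomain_apply, Finsupp.lmapDomain_apply,
    ← Finsupp.mapDomain_comp]
  congr 1
  funext v
  ext t
  simp only [Function.comp_apply, ContinuousMap.comp_apply, affineMap_affineMap]
  rfl

/-- The tuple of the vertices of the standard simplex, as a chain. -/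
def vertexTuple (n : ℕ) : (Fin (n + 1) → Simp n) →₀ ℚ :=
  Finsupp.single (fun j => stdSimplex.vertex j) 1

theorem pushTuple_vertexTuple {n : ℕ} (σ : C(Simp n, X)) :
    pushTuple σ n (vertexTuple n) = Finsupp.single σ 1 := by
  rw [vertexTuple, pushTuple_single, affineMap_vertex, ContinuousMap.comp_id]

theorem mapDomain_vertexTuple {n k : ℕ} (w : Fin (n + 1) → Simp k) :
    Finsupp.mapDomain (fun v => affineMap w ∘ v) (vertexTuple n) = Finsupp.single w 1 := by
  rw [vertexTuple, Finsupp.mapDomain_single]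
  congr 1
  funext j
  exact affineMap_vertex_apply w j

/-- Barycentric subdivision of singular chains. -/
def singSd (X : Type) [TopologicalSpace X] (n : ℕ) :
    (C(Simp n, X) →₀ ℚ) →ₗ[ℚ] (C(Simp n, X) →₀ ℚ) :=
  Finsupp.linearCombination ℚ fun σ =>
    pushTuple σ n (tupleSd (tupleBarycenter n) n (vertexTuple n))

/-- The chain homotopy between the identity and barycentric subdivision. -/
def singHomotopy (X : Type) [TopologicalSpace X] (n : ℕ) :
    (C(Simp n, X) →₀ ℚ) →ₗ[ℚ] (C(Simp (n + 1), X) →₀ ℚ) :=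
  Finsupp.linearCombination ℚ fun σ =>
    pushTuple σ (n + 1) (tupleHomotopy (tupleBarycenter n) n (vertexTuple n))

theorem singSd_single (n : ℕ) (σ : C(Simp n, X)) : singSd X n (Finsupp.single σ 1) =
    pushTuple σ n (tupleSd (tupleBarycenter n) n (vertexTuple n)) := by
  simp [singSd]

theorem singHomotopy_single (n : ℕ) (σ : C(Simp n, X)) : singHomotopy X n (Finsupp.single σ 1) =
    pushTuple σ (n + 1) (tupleHomotopy (tupleBarycenter n) n (vertexTuple n)) := by
  simp [singHomotopy]

theorem singSd_pushTuple {m : ℕ} (σ : C(Simp m, X)) (n : ℕ) (x : (Fin (n + 1) → Simp m) →₀ ℚ) :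
    singSd X n (pushTuple σ n x) = pushTuple σ n (tupleSd (tupleBarycenter m) n x) := by
  refine finsupp_linearMap_ext (f := singSd X n ∘ₗ pushTuple σ n)
    (g := pushTuple σ n ∘ₗ tupleSd (tupleBarycenter m) n) (fun v => ?_) x
  simp only [LinearMap.comp_apply]
  rw [pushTuple_single, singSd_single, ← pushTuple_comp, ← tupleSd_map (fun n u =>
    affineMap_tupleBarycenter v n u), mapDomain_vertexTuple]

theorem singHomotopy_pushTuple {m : ℕ} (σ : C(Simp m, X)) (n : ℕ)
    (x : (Fin (n + 1) → Simp m) →₀ ℚ) : singHomotopy X n (pushTuple σ n x) =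
      pushTuple σ (n + 1) (tupleHomotopy (tupleBarycenter m) n x) := by
  refine finsupp_linearMap_ext (f := singHomotopy X n ∘ₗ pushTuple σ n)
    (g := pushTuple σ (n + 1) ∘ₗ tupleHomotopy (tupleBarycenter m) n) (fun v => ?_) x
  simp only [LinearMap.comp_apply]
  rw [pushTuple_single, singHomotopy_single, ← pushTuple_comp, ← tupleHomotopy_map (fun n u =>
    affineMap_tupleBarycenter v n u), mapDomain_vertexTuple]

theorem singSd_pow_pushTuple {m : ℕ} (σ : C(Simp m, X)) (n k : ℕ)
    (x : (Fin (n + 1) → Simp m) →₀ ℚ) : (singSd X n ^ k) (pushTuple σ n x) =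
      pushTuple σ n ((tupleSd (tupleBarycenter m) n ^ k) x) := by
  induction k generalizing x with
  | zero => rfl
  | succ k ih => rw [pow_succ, pow_succ, Module.End.mul_apply, Module.End.mul_apply,
      singSd_pushTuple, ih]

theorem singBd_singSd (n : ℕ) (x : C(Simp (n + 1), X) →₀ ℚ) :
    singBd X n (singSd X (n + 1) x) = singSd X n (singBd X n x) := by
  refine finsupp_linearMap_ext (f := singBd X n ∘ₗ singSd X (n + 1))
    (g := singSd X n ∘ₗ singBd X n) (fun σ => ?_) x
  simp only [LinearMap.comp_apply]
  rw [← pushTuple_vertexTuple σ, singSd_pushTuple, singBd_pushTuple, singBd_pushTuple,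
    singSd_pushTuple, tupleBd_sd]

theorem singBd_singHomotopy_zero (x : C(Simp 0, X) →₀ ℚ) :
    singBd X 0 (singHomotopy X 0 x) = x - singSd X 0 x := by
  refine finsupp_linearMap_ext (f := singBd X 0 ∘ₗ singHomotopy X 0)
    (g := LinearMap.id - singSd X 0) (fun σ => ?_) x
  simp only [LinearMap.comp_apply, LinearMap.sub_apply, LinearMap.id_apply]
  rw [← pushTuple_vertexTuple σ, singSd_pushTuple, singHomotopy_pushTuple, tupleHomotopy_zero,
    tupleSd_zero, map_zero, map_zero, sub_self]

theorem singBd_singHomotopy (n : ℕ) (x : C(Simp (n + 1), X) →₀ ℚ) :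
    singBd X (n + 1) (singHomotopy X (n + 1) x) =
      x - singSd X (n + 1) x - singHomotopy X n (singBd X n x) := by
  refine finsupp_linearMap_ext (f := singBd X (n + 1) ∘ₗ singHomotopy X (n + 1))
    (g := LinearMap.id - singSd X (n + 1) - singHomotopy X n ∘ₗ singBd X n) (fun σ => ?_) x
  simp only [LinearMap.comp_apply, LinearMap.sub_apply, LinearMap.id_apply]
  rw [← pushTuple_vertexTuple σ, singSd_pushTuple, singHomotopy_pushTuple, singBd_pushTuple,
    singBd_pushTuple, singHomotopy_pushTuple, tupleBd_homotopy, map_sub, map_sub]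

theorem singBd_singBd (n : ℕ) (x : C(Simp (n + 2), X) →₀ ℚ) :
    singBd X n (singBd X (n + 1) x) = 0 := by
  refine finsupp_linearMap_ext (f := singBd X n ∘ₗ singBd X (n + 1)) (g := 0) (fun σ => ?_) x
  simp only [LinearMap.comp_apply]
  rw [← pushTuple_vertexTuple σ, singBd_pushTuple, singBd_pushTuple, tupleBd_tupleBd, map_zero,
    LinearMap.zero_apply]

/-- The singular simplices with image in `A`. -/
def simplicesIn (A : Set X) (n : ℕ) : Set C(Simp n, X) := {σ | ∀ t, σ t ∈ A}

/-- The singular chains of `X` with image in `A`. -/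
abbrev chainsIn (A : Set X) (n : ℕ) : Submodule ℚ (C(Simp n, X) →₀ ℚ) :=
  Finsupp.supported ℚ ℚ (simplicesIn A n)

theorem pushTuple_mem_chainsIn {A : Set X} {m : ℕ} {σ : C(Simp m, X)} (hσ : σ ∈ simplicesIn A m)
    (n : ℕ) (x : (Fin (n + 1) → Simp m) →₀ ℚ) : pushTuple σ n x ∈ chainsIn A n := by
  have hx : x ∈ Finsupp.supported ℚ ℚ (Set.univ : Set (Fin (n + 1) → Simp m)) := by simp
  have := Submodule.mem_map_of_mem (f := pushTuple σ n) hx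
  rw [pushTuple, Finsupp.lmapDomain_supported] at this
  refine Finsupp.supported_mono ?_ this
  rintro _ ⟨v, -, rfl⟩
  exact fun t => hσ _

/-- A linear map preserves the chains with image in `A` if it does so on simplices. -/
theorem map_mem_chainsIn {A : Set X} {n k : ℕ} (f : (C(Simp n, X) →₀ ℚ) →ₗ[ℚ] (C(Simp k, X) →₀ ℚ))
    (hf : ∀ σ ∈ simplicesIn A n, f (Finsupp.single σ 1) ∈ chainsIn A k)
    {x : C(Simp n, X) →₀ ℚ} (hx : x ∈ chainsIn A n) : f x ∈ chainsIn A k := by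
  rw [chainsIn, Finsupp.supported_eq_span_single] at hx
  refine Submodule.span_induction (p := fun y _ => f y ∈ chainsIn A k) ?_ ?_ ?_ ?_ hx
  · rintro _ ⟨w, hw, rfl⟩
    exact hf w hw
  · rw [map_zero]; exact Submodule.zero_mem _
  · intro a b _ _ ha hb
    rw [map_add]; exact Submodule.add_mem _ ha hb
  · intro c a _ ha
    rw [map_smul]; exact Submodule.smul_mem _ _ ha

theorem singBd_mem_chainsIn (A : Set X) (n : ℕ) (x : C(Simp (n + 1), X) →₀ ℚ)
    (hx : x ∈ chainsIn A (n + 1)) : singBd X n x ∈ chainsIn A n :=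
  map_mem_chainsIn _ (fun σ hσ => by
    rw [← pushTuple_vertexTuple σ, singBd_pushTuple]
    exact pushTuple_mem_chainsIn hσ _ _) hx

theorem singSd_mem_chainsIn (A : Set X) (n : ℕ) (x : C(Simp n, X) →₀ ℚ)
    (hx : x ∈ chainsIn A n) : singSd X n x ∈ chainsIn A n :=
  map_mem_chainsIn _ (fun σ hσ => by
    rw [singSd_single]
    exact pushTuple_mem_chainsIn hσ _ _) hx

theorem singHomotopy_mem_chainsIn (A : Set X) (n : ℕ) (x : C(Simp n, X) →₀ ℚ)
    (hx : x ∈ chainsIn A n) : singHomotopy X n x ∈ chainsIn A (n + 1) :=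
  map_mem_chainsIn _ (fun σ hσ => by
    rw [singHomotopy_single]
    exact pushTuple_mem_chainsIn hσ _ _) hx

theorem map_mem_sup {n k : ℕ} {A B : Set X}
    (f : (C(Simp n, X) →₀ ℚ) →ₗ[ℚ] (C(Simp k, X) →₀ ℚ))
    (hA : ∀ x ∈ chainsIn A n, f x ∈ chainsIn A k) (hB : ∀ x ∈ chainsIn B n, f x ∈ chainsIn B k)
    (x : C(Simp n, X) →₀ ℚ) (hx : x ∈ chainsIn A n ⊔ chainsIn B n) :
    f x ∈ chainsIn A k ⊔ chainsIn B k := by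
  obtain ⟨a, ha, b, hb, rfl⟩ := Submodule.mem_sup.1 hx
  rw [map_add]
  exact Submodule.add_mem_sup (hA a ha) (hB b hb)

/-- Lebesgue's lemma: an iterated subdivision of a chain is a sum of chains in the members of an
open cover. -/
theorem exists_singSd_pow_mem {A B : Set X} (hA : IsOpen A) (hB : IsOpen B)
    (hAB : A ∪ B = Set.univ) (n : ℕ) (x : C(Simp n, X) →₀ ℚ) :
    ∃ k : ℕ, (singSd X n ^ k) x ∈ chainsIn A n ⊔ chainsIn B n := by
  have hstep : ∀ (j : ℕ) (y : C(Simp n, X) →₀ ℚ), y ∈ chainsIn A n ⊔ chainsIn B n →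
      (singSd X n ^ j) y ∈ chainsIn A n ⊔ chainsIn B n := by
    intro j y hy
    induction j with
    | zero => exact hy
    | succ j ih =>
      rw [pow_succ', Module.End.mul_apply]
      exact map_mem_sup _ (singSd_mem_chainsIn A n) (singSd_mem_chainsIn B n) _ ih
  induction x using Finsupp.induction_linear with
  | zero => exact ⟨0, by simp⟩
  | add x y hx hy =>
    obtain ⟨k, hk⟩ := hx
    obtain ⟨l, hl⟩ := hy
    refine ⟨k + l, ?_⟩
    rw [map_add]
    refine Submodule.add_mem _ ?_ ?_
    · rw [add_comm k l, pow_add]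
      exact hstep l _ hk
    · rw [pow_add]
      exact hstep k _ hl
  | single σ a =>
    obtain ⟨ε, hε, hball⟩ := lebesgue_number_lemma_of_metric (s := (Set.univ : Set (Simp n)))
      isCompact_univ (c := fun b : Bool => σ ⁻¹' (if b then A else B))
      (by
        intro b
        cases b
        · exact hB.preimage σ.continuous
        · exact hA.preimage σ.continuous)
      (by
        intro t _
        have : σ t ∈ A ∪ B := hAB ▸ Set.mem_univ _
        rcases this with h | h
        · exact Set.mem_iUnion.2 ⟨true, h⟩
        · exact Set.mem_iUnion.2 ⟨false, h⟩)
    set D := Metric.diam (Set.univ : Set (Simp n))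
    have hD : 0 ≤ D := Metric.diam_nonneg
    have hlt : (n : ℝ) / (n + 1) < 1 := by
      rw [div_lt_one (by positivity)]
      linarith
    have hlim := (tendsto_pow_atTop_nhds_zero_of_lt_one (by positivity) hlt).mul_const D
    rw [zero_mul] at hlim
    obtain ⟨k, hk⟩ := (hlim.eventually (gt_mem_nhds hε)).exists
    refine ⟨k, ?_⟩
    rw [← mul_one a, ← smul_eq_mul, ← Finsupp.smul_single, map_smul]
    refine Submodule.smul_mem _ _ ?_
    rw [← pushTuple_vertexTuple σ, singSd_pow_pushTuple]
    have hmem := tupleSd_pow_mem D hD k (vertexTuple n) (Finsupp.single_mem_supported _ _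
      fun i j => Metric.dist_le_diam_of_mem isCompact_univ.isBounded trivial trivial)
    have hmap := Submodule.mem_map_of_mem (f := pushTuple σ n) hmem
    rw [pushTuple, Finsupp.lmapDomain_supported] at hmap
    rw [chainsIn, chainsIn, ← Finsupp.supported_union]
    refine Finsupp.supported_mono ?_ hmap
    rintro _ ⟨w, hw, rfl⟩
    have hsub : ∀ t, affineMap w t ∈ Metric.ball (w 0) ε := fun t =>
      lt_of_le_of_lt (dist_affineMap_le (fun j => hw j 0) t) hk
    obtain ⟨b, hb⟩ := hball (w 0) trivial
    cases b
    · exact Or.inr fun t => hb (hsub t)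
    · exact Or.inl fun t => hb (hsub t)

/-- The complex of singular chains with rational coefficients. -/
def singComplex (X : Type) [TopologicalSpace X] : ChainComplex (ModuleCat.{0} ℚ) ℕ :=
  linComplex (M := fun n => C(Simp n, X) →₀ ℚ) (singBd X) singBd_singBd

end Singular

end

/-! ### Mayer-Vietoris and homotopy invariance of the Euler characteristic -/

section

open CategoryTheory Limits

section Comparison

open Simplicial Opposite

variable (X : Type) [TopologicalSpace X]

/-- The simplices of the singular set of Mathlib are continuous maps from the standard simplex. -/
def singEquiv (n : ℕ) : (TopCat.toSSet.obj (TopCat.of X)) _⦋n⦌ ≃ C(Simp n, X) :=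
  TopCat.toSSetObjEquiv (TopCat.of X) (op ⦋n⦌)

theorem singEquiv_δ (n : ℕ) (i : Fin (n + 2)) (x : (TopCat.toSSet.obj (TopCat.of X)) _⦋n + 1⦌) :
    singEquiv X n ((TopCat.toSSet.obj (TopCat.of X)).δ i x) =
      singFace X n i (singEquiv X (n + 1) x) := rfl

/-- Mathlib's complex of singular chains with rational coefficients. -/
abbrev mathlibComplex : ChainComplex (ModuleCat.{0} ℚ) ℕ :=
  (TopCat.toSSet.obj (TopCat.of X)).chainComplex (ModuleCat.of ℚ ℚ)

/-- The inclusion of the summand of a simplex into Mathlib's complex of singular chains. -/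
abbrev mathlibι {n : ℕ} (x : (TopCat.toSSet.obj (TopCat.of X)) _⦋n⦌) :
    ModuleCat.of ℚ ℚ ⟶ (mathlibComplex X).X n :=
  (TopCat.toSSet.obj (TopCat.of X)).ιChainComplex (R := ModuleCat.of ℚ ℚ) x

/-- The comparison of singular chains with Mathlib's. -/
def toMathlibChains (n : ℕ) : ModuleCat.of ℚ (C(Simp n, X) →₀ ℚ) ⟶ (mathlibComplex X).X n :=
  ModuleCat.ofHom (Finsupp.linearCombination ℚ fun σ =>
    (mathlibι X ((singEquiv X n).symm σ)).hom (1 : ℚ))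

/-- The inverse of the comparison of singular chains with Mathlib's. -/
def ofMathlibChains (n : ℕ) : (mathlibComplex X).X n ⟶ ModuleCat.of ℚ (C(Simp n, X) →₀ ℚ) :=
  ((TopCat.toSSet.obj (TopCat.of X)).isColimitChainComplexXCofan (ModuleCat.of ℚ ℚ) n).desc
    (Cofan.mk _ fun x => ModuleCat.ofHom (Finsupp.lsingle (singEquiv X n x)))

theorem mathlibι_ofMathlibChains {n : ℕ} (x : (TopCat.toSSet.obj (TopCat.of X)) _⦋n⦌) :
    mathlibι X x ≫ ofMathlibChains X n = ModuleCat.ofHom (Finsupp.lsingle (singEquiv X n x)) :=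
  ((TopCat.toSSet.obj (TopCat.of X)).isColimitChainComplexXCofan (ModuleCat.of ℚ ℚ) n).fac
    (Cofan.mk _ fun x => ModuleCat.ofHom (Finsupp.lsingle (singEquiv X n x))) ⟨x⟩

theorem ofHom_linearCombination_single {α : Type} (M : ModuleCat.{0} ℚ) (f : α → M) (a : α) :
    (ModuleCat.ofHom (Finsupp.linearCombination ℚ f)).hom (Finsupp.single a 1) = f a := by
  simp

theorem toMathlibChains_single (n : ℕ) (σ : C(Simp n, X)) :
    (toMathlibChains X n).hom (Finsupp.single σ 1) =
      (mathlibι X ((singEquiv X n).symm σ)).hom (1 : ℚ) :=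
  ofHom_linearCombination_single ((mathlibComplex X).X n) _ σ

theorem lsingle_toMathlibChains {n : ℕ} (x : (TopCat.toSSet.obj (TopCat.of X)) _⦋n⦌) :
    ModuleCat.ofHom (Finsupp.lsingle (singEquiv X n x)) ≫ toMathlibChains X n = mathlibι X x := by
  apply ModuleCat.hom_ext
  apply LinearMap.ext_ring
  refine (toMathlibChains_single X n _).trans ?_
  rw [Equiv.symm_apply_apply]

/-- The complex of singular chains is isomorphic to the one of Mathlib, in each degree. -/
def singComplexXIso (n : ℕ) :
    ModuleCat.of ℚ (C(Simp n, X) →₀ ℚ) ≅ (mathlibComplex X).X n where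
  hom := toMathlibChains X n
  inv := ofMathlibChains X n
  hom_inv_id := by
    apply ModuleCat.hom_ext
    ext1 σ
    apply LinearMap.ext_ring
    change (ofMathlibChains X n).hom ((toMathlibChains X n).hom (Finsupp.single σ 1)) =
      Finsupp.single σ 1
    rw [toMathlibChains_single]
    have := ConcreteCategory.congr_hom (mathlibι_ofMathlibChains X ((singEquiv X n).symm σ)) (1 : ℚ)
    refine this.trans ?_
    rw [Equiv.apply_symm_apply]
    rfl
  inv_hom_id := by
    apply SSet.chainComplex_hom_ext
    intro x
    change mathlibι X x ≫ _ ≫ _ = mathlibι X x ≫ _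
    rw [← Category.assoc, mathlibι_ofMathlibChains, lsingle_toMathlibChains, Category.comp_id]

/-- The complex of singular chains is isomorphic to the one of Mathlib. -/
def singComplexIso : singComplex X ≅ mathlibComplex X :=
  HomologicalComplex.Hom.isoOfComponents (singComplexXIso X) (by
    rintro _ n rfl
    have e : (singComplex X).d (n + 1) n = ModuleCat.ofHom (singBd X n) := linComplex_d ..
    rw [e]
    apply ModuleCat.hom_ext
    refine LinearMap.ext (finsupp_linearMap_ext (α := C(Simp (n + 1), X)) fun σ => ?_)
    change ((mathlibComplex X).d (n + 1) n).hom
      ((toMathlibChains X (n + 1)).hom (Finsupp.single σ 1)) =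
      (toMathlibChains X n).hom (singBd X n (Finsupp.single σ 1))
    rw [toMathlibChains_single, faceBoundary_single, map_sum]
    simp only [map_smul]
    have := ConcreteCategory.congr_hom (SSet.ιChainComplex_d (TopCat.toSSet.obj (TopCat.of X))
      (R := ModuleCat.of ℚ ℚ) ((singEquiv X (n + 1)).symm σ)) (1 : ℚ)
    refine this.trans ?_
    simp only [ModuleCat.hom_sum, LinearMap.sum_apply]
    refine Finset.sum_congr rfl fun i _ => ?_
    have hf : (TopCat.toSSet.obj (TopCat.of X)).δ i ((singEquiv X (n + 1)).symm σ) =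
        (singEquiv X n).symm (singFace X n i σ) := by
      rw [Equiv.eq_symm_apply, singEquiv_δ, Equiv.apply_symm_apply]
    rw [hf]
    rcases Nat.even_or_odd (i : ℕ) with h | h
    · simp only [h.neg_one_pow, one_smul]
      exact (toMathlibChains_single X n _).symm
    · simp only [h.neg_one_pow, neg_smul, one_smul, ModuleCat.hom_neg, LinearMap.neg_apply]
      exact congrArg _ (toMathlibChains_single X n _).symm)

theorem hasEulerCharacteristic_iff_singComplex {X : Type} [TopologicalSpace X] {e : ℤ} :
    HasEulerCharacteristic X e ↔ GradedChi (fun i => (singComplex X).homology i) e := by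
  have h : ∀ i, ((singComplex X).homology i ≃ₗ[ℚ] rationalHomology X i) := fun i =>
    ((HomologicalComplex.homologyFunctor (ModuleCat.{0} ℚ) _ i).mapIso
      (singComplexIso X)).toLinearEquiv
  rw [hasEulerCharacteristic_iff]
  exact ⟨fun H => H.of_equiv fun i => ⟨(h i).symm⟩, fun H => H.of_equiv fun i => ⟨h i⟩⟩

end Comparison

section MayerVietoris

variable {X : Type} [TopologicalSpace X]

/-- The singular chains with image in `A` form the singular chain complex of `A`. -/
theorem gradedChi_chainsIn {A : Set X} {e : ℤ} (h : HasEulerCharacteristic A e) :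
    GradedChi (fun i => (subComplex (singBd X) singBd_singBd (chainsIn A)
      (singBd_mem_chainsIn A)).homology i) e := by
  rw [hasEulerCharacteristic_iff_singComplex] at h
  let ι : ∀ n, C(Simp n, A) → C(Simp n, X) := fun n σ => (⟨Subtype.val, continuous_subtype_val⟩ :
    C(A, X)).comp σ
  have hinj : ∀ n, Function.Injective (ι n) := by
    intro n σ τ hστ
    ext t
    exact congrArg (fun ρ : C(Simp n, X) => ρ t) hστ
  have hrange : ∀ n, Set.range (ι n) = simplicesIn A n := by
    intro n
    ext σ
    constructor
    · rintro ⟨τ, rfl⟩ t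
      exact (τ t).2
    · intro hσ
      exact ⟨⟨fun t => ⟨σ t, hσ t⟩, by fun_prop⟩, rfl⟩
  have hmem : ∀ n (x : C(Simp n, A) →₀ ℚ), Finsupp.mapDomain (ι n) x ∈ chainsIn A n := by
    classical
    intro n x
    rw [chainsIn, ← hrange, Finsupp.mem_supported]
    refine (Finset.coe_subset.2 Finsupp.mapDomain_support).trans ?_
    rw [Finset.coe_image]
    exact Set.image_subset_range _ _
  let f : ∀ n, (C(Simp n, A) →₀ ℚ) →ₗ[ℚ] chainsIn A n := fun n =>
    (Finsupp.lmapDomain ℚ ℚ (ι n)).codRestrict _ (hmem n)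
  let φ : singComplex A ⟶ subComplex (singBd X) singBd_singBd (chainsIn A)
      (singBd_mem_chainsIn A) := linComplexMap f (fun n x => by
    apply Subtype.ext
    exact (faceBoundary_mapDomain (S := fun n => C(Simp n, A)) (S' := fun n => C(Simp n, X))
      (singFace A) (singFace X) ι (fun _ _ _ => rfl) n x).symm)
  have hφ : ∀ n, IsIso (φ.f n) := by
    intro n
    rw [ConcreteCategory.isIso_iff_bijective]
    constructor
    · intro x y hxy
      exact Finsupp.mapDomain_injective (hinj n) (congrArg Subtype.val hxy)
    · rintro ⟨y, hy⟩
      have hy' : y ∈ Submodule.map (Finsupp.lmapDomain ℚ ℚ (ι n))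
          (Finsupp.supported ℚ ℚ Set.univ) := by
        rw [Finsupp.lmapDomain_supported, Set.image_univ, hrange]
        exact hy
      obtain ⟨x, -, hx⟩ := hy'
      exact ⟨x, Subtype.ext hx⟩
  have : IsIso φ := HomologicalComplex.Hom.isIso_of_components φ
  exact h.of_equiv fun i => ⟨((HomologicalComplex.homologyFunctor (ModuleCat.{0} ℚ) _ i).mapIso
    (asIso φ)).toLinearEquiv⟩

/-- Small chains compute singular homology: for an open cover by two sets `A` and `B`, the sums of
chains in `A` and chains in `B` have the homology of the whole space. -/
theorem nonempty_homology_chainsIn_sup {A B : Set X} (hA : IsOpen A) (hB : IsOpen B)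
    (hAB : A ∪ B = Set.univ) (hs : ∀ n, ∀ x ∈ chainsIn A (n + 1) ⊔ chainsIn B (n + 1),
      singBd X n x ∈ chainsIn A n ⊔ chainsIn B n) (i : ℕ) :
    Nonempty ((subComplex (singBd X) singBd_singBd (fun n => chainsIn A n ⊔ chainsIn B n)
      hs).homology i ≃ₗ[ℚ] (singComplex X).homology i) := by
  have h1 : ∀ n, ∀ x ∈ chainsIn A n ⊔ chainsIn B n, singSd X n x ∈ chainsIn A n ⊔ chainsIn B n :=
    fun n => map_mem_sup (singSd X n) (singSd_mem_chainsIn A n) (singSd_mem_chainsIn B n)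
  have h2 : ∀ n, ∀ x ∈ chainsIn A n ⊔ chainsIn B n,
      singHomotopy X n x ∈ chainsIn A (n + 1) ⊔ chainsIn B (n + 1) :=
    fun n => map_mem_sup (singHomotopy X n) (singHomotopy_mem_chainsIn A n)
      (singHomotopy_mem_chainsIn B n)
  have h3 := exists_singSd_pow_mem hA hB hAB
  exact nonempty_homology_equiv_of_homotopy (M := fun n => C(Simp n, X) →₀ ℚ)
    (P := fun n => chainsIn A n ⊔ chainsIn B n) (singBd X) singBd_singBd hs
    (singSd X) (singHomotopy X) singBd_singHomotopy_zero singBd_singHomotopy singBd_singSd h1 h2 h3 i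

/-- The Mayer-Vietoris formula for an open cover by two sets. -/
theorem HasEulerCharacteristic.of_union {A B : Set X} (hA : IsOpen A) (hB : IsOpen B)
    (hAB : A ∪ B = Set.univ) {a b c : ℤ} (ha : HasEulerCharacteristic A a)
    (hb : HasEulerCharacteristic B b) (hc : HasEulerCharacteristic (A ∩ B : Set X) c) :
    HasEulerCharacteristic X (a + b - c) := by
  rw [hasEulerCharacteristic_iff_singComplex]
  have hinf : ∀ n, chainsIn (A ∩ B) n = chainsIn A n ⊓ chainsIn B n := by
    intro n
    rw [chainsIn, chainsIn, chainsIn, ← Finsupp.supported_inter]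
    congr 1
    ext σ
    exact forall_and
  have hi : ∀ n, ∀ x ∈ chainsIn A (n + 1) ⊓ chainsIn B (n + 1),
      singBd X n x ∈ chainsIn A n ⊓ chainsIn B n := fun n x hx =>
    ⟨singBd_mem_chainsIn A n x hx.1, singBd_mem_chainsIn B n x hx.2⟩
  have hc' : ∀ (P : ∀ n, Submodule ℚ (C(Simp n, X) →₀ ℚ))
      (hP : ∀ n, ∀ x ∈ P (n + 1), singBd X n x ∈ P n), P = chainsIn (A ∩ B) →
      GradedChi (fun i => (subComplex (singBd X) singBd_singBd P hP).homology i) c := by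
    rintro _ _ rfl
    exact gradedChi_chainsIn hc
  have hs : ∀ n, ∀ x ∈ chainsIn A (n + 1) ⊔ chainsIn B (n + 1),
      singBd X n x ∈ chainsIn A n ⊔ chainsIn B n := fun n x hx =>
    map_mem_sup _ (singBd_mem_chainsIn A n) (singBd_mem_chainsIn B n) x hx
  have hsup : GradedChi (fun i => (subComplex (singBd X) singBd_singBd
      (fun n => chainsIn A n ⊔ chainsIn B n) hs).homology i) (a + b - c) :=
    gradedChi_sup (M := fun n => C(Simp n, X) →₀ ℚ) (P := chainsIn A) (Q := chainsIn B)
      (singBd X) singBd_singBd (singBd_mem_chainsIn A)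
      (singBd_mem_chainsIn B) hi hs (gradedChi_chainsIn ha) (gradedChi_chainsIn hb)
      (hc' _ hi (funext fun n => (hinf n).symm))
  exact hsup.of_equiv fun i => nonempty_homology_chainsIn_sup hA hB hAB hs i

end MayerVietoris

section Homotopy

variable {X Y : Type} [TopologicalSpace X] [TopologicalSpace Y]

theorem HasEulerCharacteristic.of_homotopyEquiv {e : ℤ} (h : HasEulerCharacteristic X e)
    (φ : ContinuousMap.HomotopyEquiv X Y) : HasEulerCharacteristic Y e := by
  rw [hasEulerCharacteristic_iff] at h ⊢
  refine h.of_equiv fun i => ?_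
  let F := ((AlgebraicTopology.singularHomologyFunctor (ModuleCat.{0} ℚ) i).obj (ModuleCat.of ℚ ℚ))
  let f : TopCat.of X ⟶ TopCat.of Y := TopCat.ofHom φ.toFun
  let g : TopCat.of Y ⟶ TopCat.of X := TopCat.ofHom φ.invFun
  have hfg : F.map (f ≫ g) = 𝟙 _ := by
    rw [← F.map_id]
    exact TopCat.Homotopy.congr_homologyMap_singularChainComplexFunctor
      (f := f ≫ g) (g := 𝟙 _) φ.left_inv.some _ _
  have hgf : F.map (g ≫ f) = 𝟙 _ := by
    rw [← F.map_id]
    exact TopCat.Homotopy.congr_homologyMap_singularChainComplexFunctor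
      (f := g ≫ f) (g := 𝟙 _) φ.right_inv.some _ _
  let iso : F.obj (TopCat.of X) ≅ F.obj (TopCat.of Y) :=
    ⟨F.map f, F.map g, by rw [← F.map_comp, hfg], by rw [← F.map_comp, hgf]⟩
  exact ⟨iso.toLinearEquiv⟩

theorem HasEulerCharacteristic.of_homeomorph {e : ℤ} (h : HasEulerCharacteristic X e)
    (φ : X ≃ₜ Y) : HasEulerCharacteristic Y e :=
  h.of_homotopyEquiv φ.toHomotopyEquiv

theorem hasEulerCharacteristic_of_isEmpty [IsEmpty X] : HasEulerCharacteristic X 0 := by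
  rw [hasEulerCharacteristic_iff_singComplex]
  have hsub : ∀ i, Subsingleton ((singComplex X).homology i) := by
    intro i
    have hX : ∀ j, IsZero ((singComplex X).X j) := by
      intro j
      have : IsEmpty C(Simp j, X) := ⟨fun σ => isEmptyElim (σ (stdSimplex.vertex 0))⟩
      have : Subsingleton (C(Simp j, X) →₀ ℚ) := inferInstance
      exact ModuleCat.isZero_of_subsingleton (ModuleCat.of ℚ (C(Simp j, X) →₀ ℚ))
    have : (singComplex X).ExactAt i := ShortComplex.exact_of_isZero_X₂ _ (hX i)
    exact ModuleCat.subsingleton_of_isZero this.isZero_homology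
  exact ⟨fun i => inferInstance, 0, fun i _ => hsub i, by simp⟩

theorem hasEulerCharacteristic_unit : HasEulerCharacteristic Unit 1 := by
  have hsub : ∀ i, 1 ≤ i → Subsingleton (rationalHomology Unit i) := by
    intro i hi
    have : TotallyDisconnectedSpace (TopCat.of Unit) :=
      inferInstanceAs (TotallyDisconnectedSpace Unit)
    exact ModuleCat.subsingleton_of_isZero
      (AlgebraicTopology.isZero_singularHomologyFunctor_of_totallyDisconnectedSpace
        (ModuleCat.{0} ℚ) i (ModuleCat.of ℚ ℚ) (TopCat.of Unit) (by omega))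
  have e0 : Nonempty (rationalHomology Unit 0 ≃ₗ[ℚ] ℚ) := by
    have : PathConnectedSpace (TopCat.of Unit) := inferInstanceAs (PathConnectedSpace Unit)
    exact ⟨(asIso (TopCat.singularHomology₀ε (TopCat.of Unit)
      (ModuleCat.of ℚ ℚ))).toLinearEquiv⟩
  obtain ⟨e0⟩ := e0
  refine ⟨fun i => ?_, 1, hsub, ?_⟩
  · rcases Nat.eq_zero_or_pos i with rfl | hi
    · exact Module.Finite.equiv e0.symm
    · have := hsub i hi
      infer_instance
  · simp [e0.finrank_eq]

theorem hasEulerCharacteristic_of_contractible [ContractibleSpace X] :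
    HasEulerCharacteristic X 1 :=
  hasEulerCharacteristic_unit.of_homotopyEquiv
    (ContractibleSpace.hequiv_unit X).some.symm

end Homotopy

end

/-! ### Complements of linear subspaces -/

section Sets

variable {Y : Type} [TopologicalSpace Y]

theorem HasEulerCharacteristic.congr {S T : Set Y} {e e' : ℤ} (h : HasEulerCharacteristic S e)
    (hST : S = T) (he : e = e') : HasEulerCharacteristic T e' := by
  subst hST he
  exact h

theorem HasEulerCharacteristic.preimage_val {S T : Set Y} (hTS : T ⊆ S) {e : ℤ}
    (h : HasEulerCharacteristic T e) : HasEulerCharacteristic (Subtype.val ⁻¹' T : Set S) e :=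
  h.of_homeomorph
    { toFun := fun x => ⟨⟨x.1, hTS x.2⟩, x.2⟩
      invFun := fun x => ⟨x.1.1, x.2⟩
      left_inv := fun _ => rfl
      right_inv := fun _ => rfl
      continuous_toFun := by fun_prop
      continuous_invFun := by fun_prop }

/-- The Mayer-Vietoris formula for subsets. -/
theorem HasEulerCharacteristic.inter_union {Q A B : Set Y} (hA : IsOpen A) (hB : IsOpen B)
    {a b c : ℤ} (ha : HasEulerCharacteristic (Q ∩ A : Set Y) a)
    (hb : HasEulerCharacteristic (Q ∩ B : Set Y) b)
    (hc : HasEulerCharacteristic (Q ∩ (A ∩ B) : Set Y) c) :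
    HasEulerCharacteristic (Q ∩ (A ∪ B) : Set Y) (a + b - c) := by
  have hset : ∀ T : Set Y, (Subtype.val ⁻¹' T : Set ↥(Q ∩ (A ∪ B))) =
      Subtype.val ⁻¹' (Q ∩ T) := by
    intro T
    ext x
    exact ⟨fun h => ⟨x.2.1, h⟩, fun h => h.2⟩
  refine HasEulerCharacteristic.of_union (A := Subtype.val ⁻¹' A) (B := Subtype.val ⁻¹' B)
    (hA.preimage continuous_subtype_val) (hB.preimage continuous_subtype_val) ?_ ?_ ?_ ?_
  · ext x
    simpa using x.2.2
  · rw [hset]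
    exact ha.preimage_val (Set.inter_subset_inter_right _ Set.subset_union_left)
  · rw [hset]
    exact hb.preimage_val (Set.inter_subset_inter_right _ Set.subset_union_right)
  · rw [← Set.preimage_inter, hset]
    exact hc.preimage_val (Set.inter_subset_inter_right _
      (Set.inter_subset_left.trans Set.subset_union_left))

end Sets

section Spheres

/-- The complement of the kernel of a split surjection of real vector spaces is homotopy equivalent
to the complement of the origin in the target. -/
theorem hasEulerCharacteristic_ne_zero_of_split {E F : Type} [AddCommGroup E] [Module ℝ E]
    [TopologicalSpace E] [IsTopologicalAddGroup E] [ContinuousSMul ℝ E] [AddCommGroup F]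
    [Module ℝ F] [TopologicalSpace F] (f : E →L[ℝ] F) (s : F →L[ℝ] E) (hfs : ∀ y, f (s y) = y)
    {e : ℤ} (h : HasEulerCharacteristic {y : F | y ≠ 0} e) :
    HasEulerCharacteristic {x : E | f x ≠ 0} e := by
  let p : C({x : E | f x ≠ 0}, {y : F | y ≠ 0}) := ⟨fun x => ⟨f x.1, x.2⟩, by fun_prop⟩
  let i : C({y : F | y ≠ 0}, {x : E | f x ≠ 0}) :=
    ⟨fun y => ⟨s y.1, by rw [Set.mem_ofPred_eq, hfs]; exact y.2⟩, by fun_prop⟩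
  have H : ContinuousMap.Homotopy (i.comp p) (ContinuousMap.id _) :=
    { toFun := fun tx => ⟨(tx.1 : ℝ) • tx.2.1 + (1 - tx.1 : ℝ) • s (f tx.2.1), by
        rw [Set.mem_ofPred_eq, map_add, map_smul, map_smul, hfs, ← add_smul, add_sub_cancel,
          one_smul]
        exact tx.2.2⟩
      continuous_toFun := by fun_prop
      map_zero_left := fun x => by
        apply Subtype.ext
        simp [i, p]
      map_one_left := fun x => by
        apply Subtype.ext
        simp }
  refine h.of_homotopyEquiv ⟨i, p, ?_, ⟨H⟩⟩
  have : p.comp i = ContinuousMap.id _ := by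
    ext y
    exact hfs y.1
  rw [this]

/-- Suspension: the complement of the origin in `ℝ × F` is covered by two star-shaped sets, the
complements of two opposite rays, whose intersection retracts to the complement of the origin in
`F`. -/
theorem hasEulerCharacteristic_real_prod_ne_zero {F : Type} [NormedAddCommGroup F]
    [NormedSpace ℝ F] {e : ℤ} (h : HasEulerCharacteristic {y : F | y ≠ 0} e) :
    HasEulerCharacteristic {z : ℝ × F | z ≠ 0} (2 - e) := by
  let A : Set (ℝ × F) := {z | z.2 ≠ 0 ∨ 0 < z.1}
  let B : Set (ℝ × F) := {z | z.2 ≠ 0 ∨ z.1 < 0}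
  have hA : IsOpen A := (isOpen_ne.preimage continuous_snd).union (isOpen_lt continuous_const
    continuous_fst)
  have hB : IsOpen B := (isOpen_ne.preimage continuous_snd).union (isOpen_lt continuous_fst
    continuous_const)
  have cA : HasEulerCharacteristic A 1 := by
    have hstar : StarConvex ℝ ((1, 0) : ℝ × F) A := by
      rintro ⟨x, y⟩ hz a b ha hb hab
      by_cases hy : b • y = 0
      · right
        rcases smul_eq_zero.1 hy with rfl | rfl
        · simp at hab; simp [hab]
        · have hx : 0 < x := by simpa [A] using hz
          rcases ha.eq_or_lt with rfl | ha
          · simp at hab; simp [hab, hx]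
          · simp only [Prod.fst_add, Prod.smul_fst, smul_eq_mul, mul_one]
            positivity
      · left
        simpa using hy
    have := hstar.contractibleSpace ⟨(1, 0), Or.inr one_pos⟩
    exact hasEulerCharacteristic_of_contractible
  have cB : HasEulerCharacteristic B 1 := by
    have hstar : StarConvex ℝ ((-1, 0) : ℝ × F) B := by
      rintro ⟨x, y⟩ hz a b ha hb hab
      by_cases hy : b • y = 0
      · right
        rcases smul_eq_zero.1 hy with rfl | rfl
        · simp at hab; simp [hab]
        · have hx : x < 0 := by simpa [B] using hz
          rcases ha.eq_or_lt with rfl | ha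
          · simp at hab; simp [hab, hx]
          · simp only [Prod.fst_add, Prod.smul_fst, smul_eq_mul]
            nlinarith
      · left
        simpa using hy
    have := hstar.contractibleSpace ⟨(-1, 0), Or.inr (by simp)⟩
    exact hasEulerCharacteristic_of_contractible
  have cAB : HasEulerCharacteristic (A ∩ B : Set (ℝ × F)) e := by
    have := hasEulerCharacteristic_ne_zero_of_split (ContinuousLinearMap.snd ℝ ℝ F)
      (ContinuousLinearMap.inr ℝ ℝ F) (fun y => rfl) h
    refine this.congr ?_ rfl
    ext ⟨x, y⟩
    simp only [A, B, Set.mem_inter_iff, Set.mem_ofPred_eq, ContinuousLinearMap.coe_snd']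
    constructor
    · exact fun h => ⟨Or.inl h, Or.inl h⟩
    · rintro ⟨h1 | h1, h2 | h2⟩
      · exact h1
      · exact h1
      · exact h2
      · exact absurd h1 h2.not_gt
  have := HasEulerCharacteristic.inter_union (Q := Set.univ) hA hB (by rwa [Set.univ_inter])
    (by rwa [Set.univ_inter]) (by rwa [Set.univ_inter])
  rw [Set.univ_inter] at this
  refine this.congr ?_ (by ring)
  ext ⟨x, y⟩
  simp only [A, B, Set.mem_union, Set.mem_ofPred_eq, ne_eq, Prod.mk_eq_zero, not_and_or]
  rcases lt_trichotomy x 0 with hx | hx | hx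
  · simp [hx, hx.ne]
  · simp [hx]
  · simp [hx, hx.ne']

/-- The complement of the origin has the Euler characteristic of a sphere of dimension one less. -/
theorem hasEulerCharacteristic_ne_zero (F : Type) [NormedAddCommGroup F] [NormedSpace ℝ F]
    [FiniteDimensional ℝ F] :
    HasEulerCharacteristic {y : F | y ≠ 0} (1 - (-1) ^ Module.finrank ℝ F) := by
  have key : ∀ d : ℕ, HasEulerCharacteristic {y : Fin d → ℝ | y ≠ 0} (1 - (-1) ^ d) := by
    intro d
    induction d with
    | zero =>
      have : IsEmpty {y : Fin 0 → ℝ | y ≠ 0} := ⟨fun y => y.2 (Subsingleton.elim _ _)⟩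
      simpa using hasEulerCharacteristic_of_isEmpty (X := {y : Fin 0 → ℝ | y ≠ 0})
    | succ d ih =>
      let φ : (Fin (d + 1) → ℝ) ≃L[ℝ] ℝ × (Fin d → ℝ) :=
        ContinuousLinearEquiv.ofFinrankEq (by simp [add_comm])
      have := hasEulerCharacteristic_ne_zero_of_split φ.toContinuousLinearMap
        φ.symm.toContinuousLinearMap (fun y => by simp)
        (hasEulerCharacteristic_real_prod_ne_zero ih)
      refine this.congr ?_ (by rw [pow_succ]; ring)
      ext y
      simp
  let φ : F ≃L[ℝ] (Fin (Module.finrank ℝ F) → ℝ) := ContinuousLinearEquiv.ofFinrankEq (by simp)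
  have := hasEulerCharacteristic_ne_zero_of_split φ.toContinuousLinearMap
    φ.symm.toContinuousLinearMap (fun y => by simp) (key (Module.finrank ℝ F))
  refine this.congr ?_ rfl
  ext y
  simp

/-- The complement of a linear coordinate subspace of a complex affine space has the homotopy type
of an odd-dimensional sphere (or is empty). -/
theorem hasEulerCharacteristic_exists_ne_zero {κ : Type} [Fintype κ] (L : Set κ) :
    HasEulerCharacteristic {y : κ → ℂ | ∃ l ∈ L, y l ≠ 0} 0 := by
  classical
  have : Fintype L := Fintype.ofFinite L
  have h := hasEulerCharacteristic_ne_zero (L → ℂ)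
  have hd : Module.finrank ℝ (L → ℂ) = 2 * Fintype.card L := by
    rw [Module.finrank_pi_fintype]
    simp [Complex.finrank_real_complex, mul_comm]
  rw [hd, pow_mul, neg_one_sq, one_pow, sub_self] at h
  let f : (κ → ℂ) →L[ℝ] (L → ℂ) := ContinuousLinearMap.pi fun l => ContinuousLinearMap.proj l.1
  let s : (L → ℂ) →L[ℝ] (κ → ℂ) := ContinuousLinearMap.pi fun k =>
    if hk : k ∈ L then ContinuousLinearMap.proj (⟨k, hk⟩ : L) else 0
  have := hasEulerCharacteristic_ne_zero_of_split f s (fun y => by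
    ext l
    simp [f, s]) h
  refine this.congr ?_ rfl
  ext y
  simp [f, funext_iff]

end Spheres

/-! ### Projective space in the classical topology -/

section ProjectiveTopology

variable {ι κ : Type}

theorem isOpenQuotientMap_mk' :
    IsOpenQuotientMap (Projectivization.mk' ℂ : {v : ι → ℂ // v ≠ 0} → ℙ ℂ (ι → ℂ)) where
  surjective x := ⟨⟨x.rep, x.rep_nonzero⟩, x.mk_rep⟩
  continuous := continuous_coinduced_rng
  isOpenMap U hU := by
    -- the saturation of an open set is the union of its multiples
    rw [isOpen_coinduced]
    have : Projectivization.mk' ℂ ⁻¹' (Projectivization.mk' ℂ '' U) = ⋃ c : ℂˣ,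
        (fun v : {v : ι → ℂ // v ≠ 0} =>
          (⟨c • v.1, (smul_ne_zero_iff_ne c).2 v.2⟩ : {v : ι → ℂ // v ≠ 0})) ⁻¹' U := by
      ext v
      simp only [Set.mem_preimage, Set.mem_image, Set.mem_iUnion, Projectivization.mk'_eq_mk]
      constructor
      · rintro ⟨w, hw, h⟩
        obtain ⟨c, hc⟩ := (Projectivization.mk_eq_mk_iff ℂ _ _ w.2 v.2).1 h
        refine ⟨c, ?_⟩
        convert hw
      · rintro ⟨c, hc⟩
        exact ⟨_, hc, (Projectivization.mk_eq_mk_iff ℂ _ _ _ v.2).2 ⟨c, rfl⟩⟩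
    rw [this]
    refine isOpen_iUnion fun c => hU.preimage ?_
    exact Continuous.subtype_mk (continuous_subtype_val.const_smul c) _

/-- Continuity of a map on a subset of projective space can be checked on homogeneous
coordinates. -/
theorem continuous_of_comp_mk {S : Set (ℙ ℂ (ι → ℂ))} {Y : Type*} [TopologicalSpace Y] {g : S → Y}
    (h : Continuous fun v : {v : ι → ℂ // ∃ hv : v ≠ 0, Projectivization.mk ℂ v hv ∈ S} =>
      g ⟨Projectivization.mk ℂ v.1 v.2.1, v.2.2⟩) : Continuous g := by
  have hπ := isOpenQuotientMap_mk' (ι := ι)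
  have hq : IsOpenQuotientMap (S.restrictPreimage (Projectivization.mk' ℂ)) :=
    ⟨hπ.surjective.restrictPreimage S, hπ.continuous.restrictPreimage,
      hπ.isOpenMap.restrictPreimage S⟩
  rw [← hq.continuous_comp_iff]
  exact h.comp (f := fun v : (Projectivization.mk' ℂ ⁻¹' S : Set {v : ι → ℂ // v ≠ 0}) =>
    (⟨v.1.1, v.1.2, v.2⟩ : {v : ι → ℂ // ∃ hv : v ≠ 0, Projectivization.mk ℂ v hv ∈ S}))
    (by fun_prop)

theorem continuous_mk {Y : Type*} [TopologicalSpace Y] {f : Y → ι → ℂ} (hf : Continuous f)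
    (h0 : ∀ y, f y ≠ 0) : Continuous fun y => Projectivization.mk ℂ (f y) (h0 y) :=
  isOpenQuotientMap_mk'.continuous.comp (f := fun y => (⟨f y, h0 y⟩ : {v : ι → ℂ // v ≠ 0}))
    (by fun_prop)

theorem exists_rep_mk (v : ι → ℂ) (hv : v ≠ 0) :
    ∃ c : ℂ, c ≠ 0 ∧ (Projectivization.mk ℂ v hv).rep = c • v := by
  obtain ⟨c, hc⟩ := Projectivization.exists_smul_eq_mk_rep ℂ v hv
  exact ⟨c, c.ne_zero, hc.symm⟩

theorem isOpen_rep {p : (ι → ℂ) → Prop} (hp : ∀ (c : ℂ) v, c ≠ 0 → (p (c • v) ↔ p v))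
    (ho : IsOpen {v | p v}) : IsOpen {x : ℙ ℂ (ι → ℂ) | p x.rep} := by
  rw [← isOpenQuotientMap_mk'.isQuotientMap.isOpen_preimage]
  have : (Projectivization.mk' ℂ ⁻¹' {x : ℙ ℂ (ι → ℂ) | p x.rep} : Set {v : ι → ℂ // v ≠ 0}) =
      Subtype.val ⁻¹' {v | p v} := by
    ext v
    obtain ⟨c, hc, h⟩ := exists_rep_mk v.1 v.2
    simp only [Set.mem_preimage, Set.mem_ofPred_eq, Projectivization.mk'_eq_mk, h, hp c _ hc]
  rw [this]
  exact ho.preimage continuous_subtype_val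

theorem eval_smul_of_isHomogeneous {P : MvPolynomial ι ℂ} {d : ℕ} (hP : P.IsHomogeneous d) (c : ℂ)
    (v : ι → ℂ) : MvPolynomial.eval (c • v) P = c ^ d * MvPolynomial.eval v P := by
  rw [MvPolynomial.eval_eq, MvPolynomial.eval_eq, Finset.mul_sum]
  refine Finset.sum_congr rfl fun m hm => ?_
  simp only [Pi.smul_apply, smul_eq_mul, mul_pow, Finset.prod_mul_distrib]
  rw [Finset.prod_pow_eq_pow_sum, hP.degree_eq_sum_deg_support hm]
  ring

theorem eval_mk_rep_eq_zero_iff {P : MvPolynomial ι ℂ} {d : ℕ} (hP : P.IsHomogeneous d)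
    (v : ι → ℂ) (hv : v ≠ 0) : MvPolynomial.eval (Projectivization.mk ℂ v hv).rep P = 0 ↔
      MvPolynomial.eval v P = 0 := by
  obtain ⟨c, hc, h⟩ := exists_rep_mk v hv
  rw [h, eval_smul_of_isHomogeneous hP, mul_eq_zero, or_iff_right (pow_ne_zero _ hc)]

theorem continuous_eval (P : MvPolynomial ι ℂ) :
    Continuous fun v : ι → ℂ => MvPolynomial.eval v P := by
  simp only [MvPolynomial.eval_eq]
  fun_prop

/-- Regular maps are continuous in the classical topology. -/
theorem IsRegularMap.continuous {X : Set (ℙ ℂ (ι → ℂ))} {Z : Set (ℙ ℂ (κ → ℂ))} {φ : X → Z}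
    (h : IsRegularMap φ) : Continuous φ := by
  rw [continuous_iff_continuousAt]
  intro x
  obtain ⟨d, F, hF, hx, hφ⟩ := h x
  have hsmul : ∀ (c : ℂ) (v : ι → ℂ), (fun k => MvPolynomial.eval (c • v) (F k)) =
      c ^ d • fun k => MvPolynomial.eval v (F k) := by
    intro c v
    ext k
    simp [eval_smul_of_isHomogeneous (hF k)]
  have hcont : Continuous fun (v : ι → ℂ) k => MvPolynomial.eval v (F k) :=
    continuous_pi fun k => continuous_eval _
  let O : Set X := {y | (fun k => MvPolynomial.eval y.1.rep (F k)) ≠ 0}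
  have hO : IsOpen O := by
    refine (isOpen_rep (p := fun v => (fun k => MvPolynomial.eval v (F k)) ≠ 0) ?_ ?_).preimage
      continuous_subtype_val
    · intro c v hc
      rw [hsmul, ne_eq, ne_eq, smul_eq_zero, or_iff_right (pow_ne_zero _ hc)]
    · exact isOpen_ne.preimage hcont
  let S : Set (ℙ ℂ (ι → ℂ)) := {y | y ∈ X ∧ (fun k => MvPolynomial.eval y.rep (F k)) ≠ 0}
  let g : S → ℙ ℂ (κ → ℂ) := fun y => Projectivization.mk ℂ _ y.2.2
  have hne : ∀ v : {v : ι → ℂ // ∃ hv : v ≠ 0, Projectivization.mk ℂ v hv ∈ S},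
      (fun k => MvPolynomial.eval v.1 (F k)) ≠ 0 := by
    rintro ⟨v, hv, hvS⟩ h0
    apply hvS.2
    obtain ⟨c, hc, e⟩ := exists_rep_mk v hv
    rw [e, hsmul]
    rw [h0, smul_zero]
  have hg : Continuous g := by
    apply continuous_of_comp_mk
    refine (continuous_mk (f := fun v : {v : ι → ℂ // ∃ hv : v ≠ 0, Projectivization.mk ℂ v hv ∈ S}
      => fun k => MvPolynomial.eval v.1 (F k)) (hcont.comp continuous_subtype_val) hne).congr ?_
    rintro ⟨v, hv, hvS⟩
    obtain ⟨c, hc, e⟩ := exists_rep_mk v hv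
    refine (Projectivization.mk_eq_mk_iff' ℂ _ _ _ _).2 ⟨(c ^ d)⁻¹, ?_⟩
    change (c ^ d)⁻¹ • (fun k => MvPolynomial.eval (Projectivization.mk ℂ v hv).rep (F k)) = _
    rw [e, hsmul, inv_smul_smul₀ (pow_ne_zero _ hc)]
  have hcomp : Continuous (φ ∘ (Subtype.val : O → X)) := by
    rw [continuous_induced_rng]
    have : (Subtype.val ∘ φ ∘ (Subtype.val : O → X)) =
        g ∘ fun y : O => (⟨y.1.1, y.1.2, y.2⟩ : S) := by
      funext y
      exact hφ y.1 y.2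
    rw [this]
    exact hg.comp (by fun_prop)
  exact (hO.isOpenEmbedding_subtypeVal.continuousAt_iff (x := ⟨x, hx⟩)).1 hcomp.continuousAt

theorem AreIsomorphic.hasEulerCharacteristic {X : Set (ℙ ℂ (ι → ℂ))} {Z : Set (ℙ ℂ (κ → ℂ))}
    (h : AreIsomorphic X Z) {e : ℤ} (hZ : HasEulerCharacteristic Z e) :
    HasEulerCharacteristic X e := by
  obtain ⟨φ, h1, h2⟩ := h
  exact hZ.of_homeomorph ⟨φ.symm, h2.continuous, h1.continuous⟩

end ProjectiveTopology

section Quadrics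

variable {κ : Type}

/-- The projective quadric of a homogeneous quadratic function. -/
def quadric (q : (κ → ℂ) → ℂ) : Set (ℙ ℂ (κ → ℂ)) := {x | q x.rep = 0}

/-- The points with a nonzero coordinate in `L`. -/
def coordNonzero (L : Set κ) : Set (ℙ ℂ (κ → ℂ)) := {x | ∃ l ∈ L, x.rep l ≠ 0}

theorem exists_smul_ne_zero_iff (L : Set κ) {c : ℂ} (hc : c ≠ 0) (v : κ → ℂ) :
    (∃ l ∈ L, (c • v) l ≠ 0) ↔ ∃ l ∈ L, v l ≠ 0 := by
  simp [hc]

theorem mk_mem_coordNonzero {L : Set κ} {v : κ → ℂ} (hv : v ≠ 0) :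
    Projectivization.mk ℂ v hv ∈ coordNonzero L ↔ ∃ l ∈ L, v l ≠ 0 := by
  obtain ⟨c, hc, e⟩ := exists_rep_mk v hv
  rw [coordNonzero, Set.mem_ofPred_eq, e, exists_smul_ne_zero_iff L hc]

theorem mk_mem_quadric {q : (κ → ℂ) → ℂ} (hq : ∀ (c : ℂ) v, q (c • v) = c ^ 2 * q v) {v : κ → ℂ}
    (hv : v ≠ 0) : Projectivization.mk ℂ v hv ∈ quadric q ↔ q v = 0 := by
  obtain ⟨c, hc, e⟩ := exists_rep_mk v hv
  rw [quadric, Set.mem_ofPred_eq, e, hq, mul_eq_zero, or_iff_right (pow_ne_zero _ hc)]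

theorem isOpen_coordNonzero (L : Set κ) : IsOpen (coordNonzero L) := by
  refine isOpen_rep (p := fun v => ∃ l ∈ L, v l ≠ 0)
    (fun c v hc => exists_smul_ne_zero_iff L hc v) ?_
  have : {v : κ → ℂ | ∃ l ∈ L, v l ≠ 0} = ⋃ l ∈ L, {v | v l ≠ 0} := by
    ext v; simp
  rw [this]
  exact isOpen_biUnion fun l _ => isOpen_ne.preimage (continuous_apply l)

theorem coordNonzero_insert (j : κ) (L : Set κ) :
    coordNonzero (insert j L) = coordNonzero {j} ∪ coordNonzero L := by
  ext x
  simp [coordNonzero]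

/-- Adding a cell to an open subset of a quadric. Where the coordinate `j` does not vanish, the
equation `x j * x j' + g = 0` is solved for `x j'`, so that this part of the quadric is an affine
space; it meets the open set in the complement of a linear subspace. -/
theorem hasEulerCharacteristic_quadric_insert [Fintype κ] {q : (κ → ℂ) → ℂ}
    (hq : ∀ (c : ℂ) v, q (c • v) = c ^ 2 * q v) {j j' : κ} (hj : j ≠ j')
    (g : ({l // l ≠ j ∧ l ≠ j'} → ℂ) → ℂ) (hg : Continuous g)
    (hqg : ∀ v, v j = 1 → q v = v j' + g fun l => v l) (L : Set κ)
    (L' : Set {l // l ≠ j ∧ l ≠ j'})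
    (hL : ∀ v, v j = 1 → q v = 0 → ((∃ l ∈ L, v l ≠ 0) ↔ ∃ l ∈ L', v l.1 ≠ 0)) {e : ℤ}
    (h : HasEulerCharacteristic (quadric q ∩ coordNonzero L : Set (ℙ ℂ (κ → ℂ))) e) :
    HasEulerCharacteristic (quadric q ∩ coordNonzero (insert j L) : Set (ℙ ℂ (κ → ℂ)))
      (e + 1) := by
  classical
  let E := {l // l ≠ j ∧ l ≠ j'} → ℂ
  let ext : E → κ → ℂ := fun y l =>
    if h : l ≠ j ∧ l ≠ j' then y ⟨l, h⟩ else if l = j then 1 else -g y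
  have ext_j : ∀ y, ext y j = 1 := fun y => by simp [ext]
  have ext_j' : ∀ y, ext y j' = -g y := fun y => by simp [ext, hj.symm]
  have ext_l : ∀ y (l : {l // l ≠ j ∧ l ≠ j'}), ext y l.1 = y l := fun y l => dif_pos l.2
  have ext_ne : ∀ y, ext y ≠ 0 := fun y h0 => one_ne_zero ((ext_j y).symm.trans (congrFun h0 j))
  have ext_cont : Continuous ext := by
    refine continuous_pi fun l => ?_
    by_cases hl : l ≠ j ∧ l ≠ j'
    · simp only [ext, hl, dif_pos, ne_eq, not_false_eq_true, and_self]
      exact continuous_apply _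
    · by_cases hlj : l = j
      · simp only [ext, hlj, dite_false, if_true, ne_eq, not_true_eq_false, false_and]
        exact continuous_const
      · simp only [ext, hl, hlj, dite_false, if_false]
        exact hg.neg
  have ext_q : ∀ y, q (ext y) = 0 := fun y => by
    rw [hqg _ (ext_j y), ext_j']
    simp [ext_l]
  -- parts of the quadric in the affine chart are homeomorphic to parts of the affine space
  have key : ∀ (T : Set (ℙ ℂ (κ → ℂ))) (S : Set E) (e' : ℤ),
      T ⊆ quadric q ∩ coordNonzero {j} → (∀ y, Projectivization.mk ℂ (ext y) (ext_ne y) ∈ T ↔ y ∈ S)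
      → HasEulerCharacteristic S e' → HasEulerCharacteristic T e' := by
    intro T S e' hT hTS hS
    have hxj : ∀ x ∈ T, x.rep j ≠ 0 := fun x hx => by simpa [coordNonzero] using (hT hx).2
    have hinv : ∀ x (hx : x ∈ T), Projectivization.mk ℂ (ext fun l => x.rep l / x.rep j)
        (ext_ne _) = x := by
      intro x hx
      conv_rhs => rw [← x.mk_rep]
      refine (Projectivization.mk_eq_mk_iff' ℂ _ _ _ _).2 ⟨(x.rep j)⁻¹, ?_⟩
      have hx0 := hxj x hx
      have hq0 : q ((x.rep j)⁻¹ • x.rep) = 0 := by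
        rw [hq, (hT hx).1, mul_zero]
      rw [hqg _ (by simp [hx0])] at hq0
      funext l
      by_cases hl : l ≠ j ∧ l ≠ j'
      · refine Eq.trans ?_ (ext_l _ ⟨l, hl⟩).symm
        simp [div_eq_inv_mul]
      · by_cases hlj : l = j
        · subst hlj
          refine Eq.trans ?_ (ext_j _).symm
          simp [hx0]
        · have hlj' : l = j' := by
            by_contra h'
            exact hl ⟨hlj, h'⟩
          subst hlj'
          refine Eq.trans (eq_neg_of_add_eq_zero_left hq0) (Eq.trans ?_ (ext_j' _).symm)
          simp [div_eq_inv_mul]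
    refine hS.of_homeomorph
      { toFun := fun y => ⟨Projectivization.mk ℂ (ext y.1) (ext_ne y.1), (hTS y.1).2 y.2⟩
        invFun := fun x => ⟨fun l => x.1.rep l / x.1.rep j, (hTS _).1 (by
          rw [hinv x.1 x.2]; exact x.2)⟩
        left_inv := fun y => ?_
        right_inv := fun x => Subtype.ext (hinv x.1 x.2)
        continuous_toFun := ?_
        continuous_invFun := ?_ }
    · apply Subtype.ext
      obtain ⟨c, hc, h⟩ := exists_rep_mk (ext y.1) (ext_ne y.1)
      funext l
      simp only [h, Pi.smul_apply, smul_eq_mul, ext_j, mul_one, ext_l]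
      rw [mul_comm, mul_div_assoc, div_self hc, mul_one]
    · exact Continuous.subtype_mk (continuous_mk (ext_cont.comp continuous_subtype_val)
        fun y => ext_ne y.1) _
    · refine Continuous.subtype_mk ?_ _
      refine continuous_pi fun l => ?_
      apply continuous_of_comp_mk
      have hvj : ∀ v : {v : κ → ℂ // ∃ hv : v ≠ 0, Projectivization.mk ℂ v hv ∈ T}, v.1 j ≠ 0 := by
        rintro ⟨v, hv, hvT⟩
        simpa using (mk_mem_coordNonzero hv).1 (hT hvT).2
      refine Continuous.congr (f := fun v : {v : κ → ℂ // ∃ hv : v ≠ 0,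
        Projectivization.mk ℂ v hv ∈ T} => v.1 l / v.1 j) ?_ ?_
      · exact Continuous.div ((continuous_apply l.1).comp continuous_subtype_val)
          ((continuous_apply j).comp continuous_subtype_val) hvj
      · rintro ⟨v, hv, hvT⟩
        obtain ⟨c, hc, h⟩ := exists_rep_mk v hv
        simp only [h, Pi.smul_apply, smul_eq_mul]
        rw [mul_div_mul_left _ _ hc]
  have hU : HasEulerCharacteristic (quadric q ∩ coordNonzero {j} : Set (ℙ ℂ (κ → ℂ))) 1 := by
    refine key _ Set.univ 1 subset_rfl (fun y => ?_) ?_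
    · simp only [Set.mem_univ, iff_true]
      exact ⟨(mk_mem_quadric hq _).2 (ext_q y), (mk_mem_coordNonzero _).2 ⟨j, rfl, by
        rw [ext_j]; exact one_ne_zero⟩⟩
    · have : ContractibleSpace E := inferInstance
      exact (hasEulerCharacteristic_of_contractible (X := E)).of_homeomorph
        (Homeomorph.Set.univ E).symm
  have hUO : HasEulerCharacteristic
      (quadric q ∩ (coordNonzero {j} ∩ coordNonzero L) : Set (ℙ ℂ (κ → ℂ))) 0 := by
    refine key _ {y | ∃ l ∈ L', y l ≠ 0} 0
      (Set.inter_subset_inter_right _ Set.inter_subset_left) (fun y => ?_)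
      (hasEulerCharacteristic_exists_ne_zero L')
    have h1 := hL (ext y) (ext_j y) (ext_q y)
    simp only [ext_l] at h1
    rw [Set.mem_ofPred_eq, ← h1, ← mk_mem_coordNonzero (ext_ne y)]
    refine ⟨fun h => h.2.2, fun h => ⟨(mk_mem_quadric hq _).2 (ext_q y), ?_, h⟩⟩
    exact (mk_mem_coordNonzero _).2 ⟨j, rfl, by rw [ext_j]; exact one_ne_zero⟩
  rw [coordNonzero_insert]
  exact (HasEulerCharacteristic.inter_union (isOpen_coordNonzero _) (isOpen_coordNonzero _) hU h
    hUO).congr rfl (by ring)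

end Quadrics

/-! ### The Euler characteristic of a smooth quadric -/

section SplitQuadric

variable {ι ρ : Type} [Fintype ι] [Fintype ρ]

/-- The split quadratic form: a sum of hyperbolic planes, with coordinates `(i, true)` and
`(i, false)`, and of squares. -/
def splitForm (v : (ι × Bool) ⊕ ρ → ℂ) : ℂ :=
  ∑ i, v (.inl (i, true)) * v (.inl (i, false)) + ∑ w, v (.inr w) ^ 2

theorem splitForm_smul (c : ℂ) (v : (ι × Bool) ⊕ ρ → ℂ) :
    splitForm (c • v) = c ^ 2 * splitForm v := by
  simp only [splitForm, Pi.smul_apply, smul_eq_mul, mul_add, Finset.mul_sum]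
  congr 1 <;> exact Finset.sum_congr rfl fun _ _ => by ring

theorem continuous_splitForm : Continuous (splitForm : ((ι × Bool) ⊕ ρ → ℂ) → ℂ) := by
  unfold splitForm
  fun_prop

open Classical in
/-- Extension by zero of a vector in which the coordinates of one hyperbolic plane are missing. -/
def extendZero (i : ι) (c : Bool)
    (y : {l : (ι × Bool) ⊕ ρ // l ≠ .inl (i, c) ∧ l ≠ .inl (i, !c)} → ℂ) (l : (ι × Bool) ⊕ ρ) : ℂ :=
  if h : l ≠ .inl (i, c) ∧ l ≠ .inl (i, !c) then y ⟨l, h⟩ else 0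

omit [Fintype ι] [Fintype ρ] in
theorem continuous_extendZero (i : ι) (c : Bool) :
    Continuous (extendZero (ρ := ρ) i c) := by
  refine continuous_pi fun l => ?_
  by_cases h : l ≠ .inl (i, c) ∧ l ≠ .inl (i, !c)
  · simp only [extendZero, dif_pos h]
    fun_prop
  · simp only [extendZero, dif_neg h]
    fun_prop

theorem splitForm_eq_mul_add (i : ι) (c : Bool) (v : (ι × Bool) ⊕ ρ → ℂ) :
    splitForm v = v (.inl (i, c)) * v (.inl (i, !c)) +
      splitForm (extendZero i c fun l => v l.1) := by
  classical
  have h1 : ∑ w, (extendZero i c fun l => v l.1) (.inr w) ^ 2 = ∑ w, v (.inr w : (ι × Bool) ⊕ ρ) ^ 2 :=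
    Finset.sum_congr rfl fun w _ => by simp [extendZero]
  have h2 : ∑ k, (extendZero (ρ := ρ) i c fun l => v l.1) (.inl (k, true)) *
      (extendZero (ρ := ρ) i c fun l => v l.1) (.inl (k, false)) =
      ∑ k ∈ Finset.univ.erase i, v (.inl (k, true)) * v (.inl (k, false)) := by
    rw [← Finset.add_sum_erase _ _ (Finset.mem_univ i)]
    have : (extendZero (ρ := ρ) i c fun l => v l.1) (.inl (i, true)) = 0 := by
      cases c <;> simp [extendZero]
    rw [this, zero_mul, zero_add]
    refine Finset.sum_congr rfl fun k hk => ?_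
    have hk := Finset.ne_of_mem_erase hk
    simp [extendZero, hk]
  rw [splitForm, splitForm, h1, h2, ← Finset.add_sum_erase _ _ (Finset.mem_univ i)]
  cases c <;> simp <;> ring

theorem hasEulerCharacteristic_splitForm_insert (i : ι) (c : Bool) (L : Set ((ι × Bool) ⊕ ρ))
    (L' : Set ((ι × Bool) ⊕ ρ)) (h1 : .inl (i, c) ∉ L') (h2 : .inl (i, !c) ∉ L')
    (hL : ∀ v, v (.inl (i, c)) = 1 → splitForm v = 0 → ((∃ l ∈ L, v l ≠ 0) ↔ ∃ l ∈ L', v l ≠ 0)) {e : ℤ}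
    (h : HasEulerCharacteristic
      (quadric splitForm ∩ coordNonzero L : Set (ℙ ℂ ((ι × Bool) ⊕ ρ → ℂ))) e) :
    HasEulerCharacteristic
      (quadric splitForm ∩ coordNonzero (insert (.inl (i, c)) L) :
        Set (ℙ ℂ ((ι × Bool) ⊕ ρ → ℂ))) (e + 1) := by
  refine hasEulerCharacteristic_quadric_insert (j' := .inl (i, !c)) splitForm_smul (by simp)
    (fun y => splitForm (extendZero i c y))
    (continuous_splitForm.comp (continuous_extendZero i c)) (fun v hv => ?_) L
    (Subtype.val ⁻¹' L') (fun v hv1 hv => ?_) h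
  · rw [splitForm_eq_mul_add i c v, hv, one_mul]
  · rw [hL v hv1 hv]
    constructor
    · rintro ⟨l, hl, h⟩
      exact ⟨⟨l, fun e => h1 (e ▸ hl), fun e => h2 (e ▸ hl)⟩, hl, h⟩
    · rintro ⟨l, hl, h⟩
      exact ⟨l.1, hl, h⟩

theorem eq_zero_of_splitForm_eq_zero [Subsingleton ρ] {v : (ι × Bool) ⊕ ρ → ℂ}
    (hv : splitForm v = 0) (h : ∀ i, v (.inl (i, true)) * v (.inl (i, false)) = 0) (w : ρ) :
    v (.inr w) = 0 := by
  rw [splitForm, Finset.sum_eq_zero fun i _ => h i, zero_add, Fintype.sum_subsingleton _ w] at hv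
  exact pow_eq_zero_iff two_ne_zero |>.1 hv

/-- The Euler characteristic of a split quadric, by adding the coordinates of the hyperbolic planes
one at a time. -/
theorem hasEulerCharacteristic_splitForm [Subsingleton ρ] :
    HasEulerCharacteristic (quadric (splitForm : ((ι × Bool) ⊕ ρ → ℂ) → ℂ))
      (2 * (Fintype.card ι : ℤ)) := by
  classical
  -- all the coordinates `(i, false)` first, where there are no relations
  have step1 : ∀ s : Finset ι, HasEulerCharacteristic (quadric splitForm ∩
      coordNonzero {l | ∃ i ∈ s, l = .inl (i, false)} : Set (ℙ ℂ ((ι × Bool) ⊕ ρ → ℂ))) s.card := by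
    intro s
    induction s using Finset.induction_on with
    | empty =>
      have : IsEmpty (quadric splitForm ∩ coordNonzero {l | ∃ i ∈ (∅ : Finset ι),
          l = .inl (i, false)} : Set (ℙ ℂ ((ι × Bool) ⊕ ρ → ℂ))) := by
        rw [Set.isEmpty_coe_sort]
        ext x
        simp [coordNonzero]
      simpa using hasEulerCharacteristic_of_isEmpty
    | insert i s hi ih =>
      refine (hasEulerCharacteristic_splitForm_insert i false _
        {l | ∃ i ∈ s, l = .inl (i, false)} ?_ ?_ (fun v _ _ => Iff.rfl) ih).congr ?_ ?_
      · simpa using hi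
      · simp
      · congr 2
        ext l
        simp
      · rw [Finset.card_insert_of_notMem hi]
        push_cast
        rfl
  -- then the coordinates `(i, true)`
  have step2 : ∀ s : Finset ι, HasEulerCharacteristic (quadric splitForm ∩
      coordNonzero ({l | ∃ i ∈ s, l = .inl (i, true)} ∪ {l | ∃ i, l = .inl (i, false)}) :
        Set (ℙ ℂ ((ι × Bool) ⊕ ρ → ℂ))) (Fintype.card ι + s.card) := by
    intro s
    induction s using Finset.induction_on with
    | empty =>
      refine (step1 Finset.univ).congr ?_ (by simp)
      congr 2
      ext l
      simp
    | insert i s hi ih =>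
      refine (hasEulerCharacteristic_splitForm_insert i true _
        ({l | ∃ i ∈ s, l = .inl (i, true)} ∪ {l | ∃ k, k ≠ i ∧ l = .inl (k, false)} ∪
          Set.range .inr) ?_ ?_ ?_ ih).congr ?_ ?_
      · simpa using hi
      · simp
      · intro v hv1 hv
        constructor
        · rintro ⟨l, hl | ⟨k, rfl⟩, h⟩
          · exact ⟨l, .inl (.inl hl), h⟩
          · by_cases hk : k = i
            · -- the equation of the quadric expresses this coordinate by the others
              subst hk
              by_contra! h0
              have hb : ∀ l, l ≠ k → v (.inl (l, false)) = 0 := fun l hl =>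
                h0 _ (.inl (.inr ⟨l, hl, rfl⟩))
              have hw : ∀ w, v (.inr w) = 0 := fun w => h0 _ (.inr ⟨w, rfl⟩)
              rw [splitForm, Finset.sum_eq_single k (fun l _ hl => by rw [hb l hl, mul_zero])
                (by simp), hv1, one_mul] at hv
              exact h (by simpa [hw] using hv)
            · exact ⟨_, .inl (.inr ⟨k, hk, rfl⟩), h⟩
        · rintro ⟨l, (hl | ⟨k, hk, rfl⟩) | ⟨w, rfl⟩, h⟩
          · exact ⟨l, .inl hl, h⟩
          · exact ⟨_, .inr ⟨k, rfl⟩, h⟩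
          · by_contra! h0
            have h00 : ∀ k, v (.inl (k, false)) = 0 := fun k => h0 _ (.inr ⟨k, rfl⟩)
            exact h (eq_zero_of_splitForm_eq_zero hv (fun k => by rw [h00, mul_zero]) w)
      · congr 2
        ext l
        simp only [Finset.mem_insert, Set.mem_insert_iff, Set.mem_union, Set.mem_ofPred_eq]
        grind
      · rw [Finset.card_insert_of_notMem hi]
        push_cast
        ring
  refine (step2 Finset.univ).congr ?_ (by simp; ring)
  refine Set.inter_eq_left.2 fun x hx => ?_
  by_contra! hx0
  have h0 : ∀ l ∈ ({l | ∃ i ∈ (Finset.univ : Finset ι), l = .inl (i, true)} ∪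
      {l | ∃ i, l = .inl (i, false)} : Set ((ι × Bool) ⊕ ρ)), x.rep l = 0 := by
    simpa [coordNonzero] using hx0
  have hf : ∀ i, x.rep (.inl (i, false)) = 0 := fun i => h0 _ (.inr ⟨i, rfl⟩)
  apply x.rep_nonzero
  funext l
  rcases l with ⟨i, c⟩ | w
  · cases c
    · exact hf i
    · exact h0 _ (.inl ⟨i, Finset.mem_univ i, rfl⟩)
  · exact eq_zero_of_splitForm_eq_zero hx (fun i => by rw [hf, mul_zero]) w

omit [Fintype ι] [Fintype ρ] in
theorem continuous_map {κ κ' : Type} [Finite κ] (f : (κ → ℂ) →ₗ[ℂ] (κ' → ℂ))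
    (hf : Function.Injective f) : Continuous (Projectivization.map f hf) := by
  have h : Continuous fun x : (Set.univ : Set (ℙ ℂ (κ → ℂ))) => Projectivization.map f hf x := by
    apply continuous_of_comp_mk
    exact continuous_mk (f := fun v : {v : κ → ℂ // ∃ hv : v ≠ 0, Projectivization.mk ℂ v hv ∈ _} =>
      f v.1) (f.continuous_of_finiteDimensional.comp continuous_subtype_val)
      fun v => (map_ne_zero_iff f hf).2 v.2.1
  exact h.comp (f := fun x => ⟨x, Set.mem_univ x⟩) (by fun_prop)

omit [Fintype ι] [Fintype ρ] in
theorem hasEulerCharacteristic_quadric_of_linearEquiv {κ κ' : Type} [Finite κ] [Finite κ']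
    (e : (κ → ℂ) ≃ₗ[ℂ] (κ' → ℂ)) {q : (κ → ℂ) → ℂ} {q' : (κ' → ℂ) → ℂ}
    (hq : ∀ (c : ℂ) v, q (c • v) = c ^ 2 * q v) (he : ∀ v, q' (e v) = q v) {χ : ℤ}
    (h : HasEulerCharacteristic (quadric q') χ) : HasEulerCharacteristic (quadric q) χ := by
  have hq' : ∀ (c : ℂ) v, q' (c • v) = c ^ 2 * q' v := fun c v => by
    rw [← e.apply_symm_apply (c • v), he, map_smul, hq, ← he, e.apply_symm_apply]
  let f := Projectivization.map e.toLinearMap e.injective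
  let g := Projectivization.map e.symm.toLinearMap e.symm.injective
  have hfg : ∀ x, f (g x) = x := fun x => by
    induction x using Projectivization.ind with | h v hv => ?_
    simp [f, g, Projectivization.map_mk]
  have hgf : ∀ x, g (f x) = x := fun x => by
    induction x using Projectivization.ind with | h v hv => ?_
    simp [f, g, Projectivization.map_mk]
  have hmem : ∀ x, f x ∈ quadric q' ↔ x ∈ quadric q := fun x => by
    induction x using Projectivization.ind with | h v hv => ?_
    simp only [f, Projectivization.map_mk]
    rw [mk_mem_quadric hq', mk_mem_quadric hq, LinearEquiv.coe_coe, he]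
  refine h.of_homeomorph
    { toFun := fun x => ⟨g x.1, (hmem _).1 (by rw [hfg]; exact x.2)⟩
      invFun := fun x => ⟨f x.1, (hmem _).2 x.2⟩
      left_inv := fun x => Subtype.ext (hfg x)
      right_inv := fun x => Subtype.ext (hgf x)
      continuous_toFun := ((continuous_map _ _).comp continuous_subtype_val).subtype_mk _
      continuous_invFun := ((continuous_map _ _).comp continuous_subtype_val).subtype_mk _ }

/-- The change of coordinates `(a, b) ↦ (a + i b, a - i b)` that turns sums of two squares into
hyperbolic planes. -/
def splitEquiv (ι ρ : Type) : ((ι × Bool) ⊕ ρ → ℂ) ≃ₗ[ℂ] ((ι × Bool) ⊕ ρ → ℂ) where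
  toFun v := Sum.elim (fun i => v (.inl (i.1, true)) +
    (if i.2 then Complex.I else -Complex.I) * v (.inl (i.1, false))) fun w => v (.inr w)
  invFun v := Sum.elim (fun i => if i.2 then (v (.inl (i.1, true)) + v (.inl (i.1, false))) / 2
    else (v (.inl (i.1, true)) - v (.inl (i.1, false))) / (2 * Complex.I)) fun w => v (.inr w)
  map_add' v w := by
    funext l
    rcases l with ⟨i, _ | _⟩ | w <;> simp <;> ring
  map_smul' c v := by
    funext l
    rcases l with ⟨i, _ | _⟩ | w <;> simp <;> ring
  left_inv v := by
    funext l
    rcases l with ⟨i, _ | _⟩ | w <;> simp <;> field_simp <;> ring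
  right_inv v := by
    funext l
    rcases l with ⟨i, _ | _⟩ | w <;> simp <;> field_simp <;> ring

theorem splitForm_splitEquiv (v : (ι × Bool) ⊕ ρ → ℂ) :
    splitForm (splitEquiv ι ρ v) = ∑ l, v l ^ 2 := by
  rw [Fintype.sum_sum_type, Fintype.sum_prod_type, splitForm]
  congr 1
  refine Finset.sum_congr rfl fun i _ => ?_
  simp only [splitEquiv, LinearEquiv.coe_mk, LinearMap.coe_mk, AddHom.coe_mk, Sum.elim_inl,
    Fintype.sum_bool, if_true, Bool.false_eq_true, if_false]
  linear_combination (-v (.inl (i, false)) ^ 2) * Complex.I_sq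

omit [Fintype ι] [Fintype ρ] in
/-- The Euler characteristic of a smooth quadric in `ℙ^{m-1}` is the even number among `m` and
`m - 1`: over the complex numbers all nondegenerate quadratic forms are equivalent to a sum of
hyperbolic planes and at most one square. -/
theorem hasEulerCharacteristic_quadric {m k r : ℕ} (Q : QuadraticForm ℂ (Fin m → ℂ))
    (hQ : (QuadraticMap.associated (R := ℂ) Q).SeparatingLeft) (hr : r ≤ 1) (hm : 2 * k + r = m) :
    HasEulerCharacteristic (quadric fun v => Q v) (2 * k) := by
  obtain ⟨E⟩ := QuadraticForm.equivalent_weightedSumSquares_of_isAlgClosed Q hQ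
  have hcard : Module.finrank ℂ (Fin m → ℂ) = Fintype.card ((Fin k × Bool) ⊕ Fin r) := by
    simp [← hm, mul_comm]
  let σ : Fin (Module.finrank ℂ (Fin m → ℂ)) ≃ (Fin k × Bool) ⊕ Fin r :=
    Fintype.equivOfCardEq (by rw [Fintype.card_fin, hcard])
  have : Subsingleton (Fin r) := by
    rw [Fin.subsingleton_iff_le_one]
    exact hr
  have h := hasEulerCharacteristic_splitForm (ι := Fin k) (ρ := Fin r)
  rw [Fintype.card_fin] at h
  refine hasEulerCharacteristic_quadric_of_linearEquiv
    ((E.toLinearEquiv.trans (LinearEquiv.funCongrLeft ℂ ℂ σ.symm)).trans (splitEquiv _ _))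
    (fun c v => by rw [QuadraticMap.map_smul, smul_eq_mul, sq]) (fun v => ?_) h
  rw [LinearEquiv.trans_apply, splitForm_splitEquiv]
  have h1 := E.map_app v
  rw [QuadraticMap.weightedSumSquares_apply] at h1
  rw [← h1, ← Equiv.sum_comp σ]
  refine Finset.sum_congr rfl fun i _ => ?_
  simp [LinearEquiv.funCongrLeft_apply, sq]

end SplitQuadric

/-! ### Squares of binary forms -/

section Forms

variable {ι : Type}

/-- The functions on a coordinate space that are given by a homogeneous polynomial of
degree `d`. -/
def IsForm (d : ℕ) (f : (ι → ℂ) → ℂ) : Prop :=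
  ∃ P : MvPolynomial ι ℂ, P.IsHomogeneous d ∧ ∀ v, MvPolynomial.eval v P = f v

namespace IsForm

theorem coord (i : ι) : IsForm 1 fun v : ι → ℂ => v i :=
  ⟨_, MvPolynomial.isHomogeneous_X ℂ i, fun v => by simp⟩

theorem const (z : ℂ) : IsForm 0 fun _ : ι → ℂ => z :=
  ⟨_, MvPolynomial.isHomogeneous_C ι z, fun v => by simp⟩

theorem zero (d : ℕ) : IsForm d fun _ : ι → ℂ => 0 :=
  ⟨_, MvPolynomial.isHomogeneous_zero ι ℂ d, fun v => by simp⟩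

variable {d e : ℕ} {f g : (ι → ℂ) → ℂ}

theorem add (hf : IsForm d f) (hg : IsForm d g) : IsForm d fun v => f v + g v := by
  obtain ⟨P, hP, h⟩ := hf
  obtain ⟨Q, hQ, h'⟩ := hg
  exact ⟨P + Q, hP.add hQ, fun v => by rw [map_add, h, h']⟩

theorem mul (hf : IsForm d f) (hg : IsForm e g) : IsForm (d + e) fun v => f v * g v := by
  obtain ⟨P, hP, h⟩ := hf
  obtain ⟨Q, hQ, h'⟩ := hg
  exact ⟨P * Q, hP.mul hQ, fun v => by rw [map_mul, h, h']⟩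

theorem congr_degree (hf : IsForm d f) (h : d = e) : IsForm e f := h ▸ hf

theorem const_mul (hf : IsForm d f) (z : ℂ) : IsForm d fun v => z * f v :=
  ((const z).mul hf).congr_degree (zero_add d)

theorem mul_const (hf : IsForm d f) (z : ℂ) : IsForm d fun v => f v * z :=
  (hf.mul (const z)).congr_degree (add_zero d)

theorem sub (hf : IsForm d f) (hg : IsForm d g) : IsForm d fun v => f v - g v := by
  simpa [sub_eq_add_neg] using hf.add (hg.const_mul (-1))

theorem pow (hf : IsForm d f) (k : ℕ) : IsForm (d * k) fun v => f v ^ k := by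
  obtain ⟨P, hP, h⟩ := hf
  exact ⟨P ^ k, hP.pow k, fun v => by rw [map_pow, h]⟩

theorem sum {α : Type*} (s : Finset α) {F : α → (ι → ℂ) → ℂ} (h : ∀ a ∈ s, IsForm d (F a)) :
    IsForm d fun v => ∑ a ∈ s, F a v := by
  classical
  induction s using Finset.induction_on with
  | empty => simpa using zero d
  | insert a s ha ih =>
    simp only [Finset.sum_insert ha]
    exact (h a (by simp)).add (ih fun b hb => h b (by simp [hb]))

theorem prod {α : Type*} (s : Finset α) {F : α → (ι → ℂ) → ℂ} (δ : α → ℕ)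
    (h : ∀ a ∈ s, IsForm (δ a) (F a)) : IsForm (∑ a ∈ s, δ a) fun v => ∏ a ∈ s, F a v := by
  classical
  induction s using Finset.induction_on with
  | empty => simpa using const 1
  | insert a s ha ih =>
    simp only [Finset.sum_insert ha, Finset.prod_insert ha]
    exact (h a (by simp)).mul (ih fun b hb => h b (by simp [hb]))

theorem of_linearMap [Fintype ι] (φ : (ι → ℂ) →ₗ[ℂ] ℂ) : IsForm 1 fun v => φ v := by
  classical
  have : ∀ v, φ v = ∑ i, v i * φ (Pi.single i 1) := fun v => by
    conv_lhs => rw [← Finset.univ_sum_single v]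
    rw [map_sum]
    refine Finset.sum_congr rfl fun i _ => ?_
    rw [← smul_eq_mul, ← map_smul, ← Pi.single_smul, smul_eq_mul, mul_one]
  rw [funext this]
  exact sum _ fun i _ => (coord i).mul_const _

theorem eval_smul (hf : IsForm d f) (c : ℂ) (v : ι → ℂ) : f (c • v) = c ^ d * f v := by
  obtain ⟨P, hP, h⟩ := hf
  rw [← h, ← h, eval_smul_of_isHomogeneous hP]

end IsForm

/-- A set of points of projective space that is cut out by forms is Zariski closed. -/
theorem isZariskiClosed_of_forall_isForm {α : Type*} (d : ℕ) (F : α → (ι → ℂ) → ℂ)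
    (hF : ∀ a, IsForm d (F a)) : IsZariskiClosed {x : ℙ ℂ (ι → ℂ) | ∀ a, F a x.rep = 0} := by
  choose P hP h using hF
  refine ⟨Set.range P, ?_, ?_⟩
  · rintro _ ⟨a, rfl⟩
    exact ⟨d, hP a⟩
  · ext x
    simp [zeroLocus, h]

end Forms

section SquareRoot

open Polynomial

/-- The coefficients of the square root of the power series with coefficients `c`, with
denominators cleared: if `c` is the square of `b`, then the coefficient of index `k ≥ 1` is
`b k * b 0 ^ (2 * k - 1)`. It is a form of degree `k` in `c`. -/
def rootCoeff (c : ℕ → ℂ) : ℕ → ℂ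
  | 0 => 1
  | k + 1 => (c (k + 1) * c 0 ^ k - ∑ i : Fin k, rootCoeff c (i + 1) * rootCoeff c (k - i)) / 2

theorem isForm_rootCoeff {ι : Type} {c : (ι → ℂ) → ℕ → ℂ} (hc : ∀ k, IsForm 1 fun v => c v k)
    (k : ℕ) : IsForm k fun v => rootCoeff (c v) k := by
  induction k using Nat.strong_induction_on with
  | h k ih =>
    cases k with
    | zero => simpa [rootCoeff] using IsForm.const 1
    | succ k =>
      have : (fun v => rootCoeff (c v) (k + 1)) = fun v => (c v (k + 1) * c v 0 ^ k -
          ∑ i : Fin k, rootCoeff (c v) (i + 1) * rootCoeff (c v) (k - i)) * 2⁻¹ :=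
        funext fun v => by rw [rootCoeff, div_eq_mul_inv]
      rw [this]
      refine IsForm.mul_const (IsForm.sub ?_ (IsForm.sum _ fun i _ => ?_)) _
      · exact ((hc (k + 1)).mul ((hc 0).pow k)).congr_degree (by ring)
      · exact ((ih (i + 1) (by omega)).mul (ih (k - i) (by omega))).congr_degree (by omega)

theorem rootCoeff_coeff_sq (b : ℂ[X]) (k : ℕ) :
    rootCoeff (fun j => (b ^ 2).coeff j) (k + 1) = b.coeff (k + 1) * b.coeff 0 ^ (2 * k + 1) := by
  induction k using Nat.strong_induction_on with
  | h k ih =>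
    have h1 : (b ^ 2).coeff (k + 1) = 2 * (b.coeff 0 * b.coeff (k + 1)) +
        ∑ i ∈ Finset.range k, b.coeff (i + 1) * b.coeff (k - i) := by
      rw [sq, coeff_mul, Finset.Nat.sum_antidiagonal_eq_sum_range_succ_mk,
        Finset.sum_range_succ', Finset.sum_range_succ]
      simp only [Nat.sub_self, Nat.sub_zero, Nat.add_sub_add_right]
      ring
    have h0 : (b ^ 2).coeff 0 = b.coeff 0 ^ 2 := by simp [sq]
    have h2 : ∀ i ∈ Finset.range k, rootCoeff (fun j => (b ^ 2).coeff j) (i + 1) *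
        rootCoeff (fun j => (b ^ 2).coeff j) (k - i) =
        b.coeff (i + 1) * b.coeff (k - i) * b.coeff 0 ^ (2 * k) := fun i hi => by
      have hi := Finset.mem_range.1 hi
      obtain ⟨l, rfl⟩ : ∃ l, k = i + l + 1 := ⟨k - i - 1, by omega⟩
      rw [ih i hi, show i + l + 1 - i = l + 1 by omega, ih l (by omega)]
      ring
    rw [rootCoeff, Fin.sum_univ_eq_sum_range (fun i =>
        rootCoeff (fun j => (b ^ 2).coeff j) (i + 1) * rootCoeff (fun j => (b ^ 2).coeff j) (k - i)),
      Finset.sum_congr rfl h2,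
      ← Finset.sum_mul, h1, h0]
    ring

variable {n : ℕ}

/-- The polynomial of degree at most `d` with coefficient vector `a`, which is the binary form
`binaryForm d a` in the affine coordinate. -/
def dehom (d : ℕ) (a : Fin (d + 1) → ℂ) : ℂ[X] := ofFn (d + 1) a

theorem dehom_injective (d : ℕ) : Function.Injective (dehom d) := injective_ofFn _

theorem natDegree_dehom_lt (d : ℕ) (a : Fin (d + 1) → ℂ) : (dehom d a).natDegree < d + 1 :=
  ofFn_natDegree_lt (by omega) a

theorem dehom_toFn {d : ℕ} {p : ℂ[X]} (hp : p.natDegree < d + 1) : dehom d (toFn (d + 1) p) = p :=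
  ofFn_comp_toFn_eq_id_of_natDegree_lt hp

theorem toFn_dehom (d : ℕ) (a : Fin (d + 1) → ℂ) : toFn (d + 1) (dehom d a) = a :=
  toFn_comp_ofFn_eq_id _ a

theorem dehom_smul (d : ℕ) (t : ℂ) (a : Fin (d + 1) → ℂ) : dehom d (t • a) = C t * dehom d a := by
  rw [dehom, map_smul, smul_eq_C_mul]; rfl

theorem dehom_eq_zero_iff {d : ℕ} {a : Fin (d + 1) → ℂ} : dehom d a = 0 ↔ a = 0 := by
  rw [← (dehom_injective d).eq_iff (b := 0)]
  simp [dehom]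

theorem exists_eval_dehom_ne_zero {d : ℕ} {a : Fin (d + 1) → ℂ} (ha : a ≠ 0) :
    ∃ s, (dehom d a).eval s ≠ 0 := by
  by_contra! h
  exact ha (dehom_eq_zero_iff.1 (Polynomial.funext fun s => by rw [h s, eval_zero]))

theorem aeval_binaryForm (d : ℕ) (a : Fin (d + 1) → ℂ) :
    MvPolynomial.aeval ![(1 : ℂ[X]), X] (binaryForm d a) = dehom d a := by
  rw [dehom, ofFn_eq_sum_monomial, binaryForm, map_sum]
  refine Finset.sum_congr rfl fun i _ => ?_
  simp [← C_mul_X_pow_eq_monomial, algebraMap_eq]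

/-- The square of a form of degree `n`, on coefficient vectors. -/
def sqCoeff (n : ℕ) (a : Fin (n + 1) → ℂ) : Fin (2 * n + 1) → ℂ :=
  fun k => ∑ i : Fin (n + 1), ∑ j : Fin (n + 1), if (i : ℕ) + j = k then a i * a j else 0

theorem binaryForm_sqCoeff (a : Fin (n + 1) → ℂ) :
    binaryForm (2 * n) (sqCoeff n a) = binaryForm n a ^ 2 := by
  simp only [binaryForm, sqCoeff, map_sum, Finset.sum_mul]
  rw [sq, Fintype.sum_mul_sum, Finset.sum_comm]
  refine Finset.sum_congr rfl fun i _ => ?_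
  rw [Finset.sum_comm]
  refine Finset.sum_congr rfl fun j _ => ?_
  rw [Finset.sum_eq_single (⟨i + j, by omega⟩ : Fin (2 * n + 1))]
  · simp only [if_true, map_mul]
    rw [show 2 * n - ((i : ℕ) + j) = (n - i) + (n - j) by omega]
    ring
  · intro k _ hk
    rw [if_neg fun h => hk (Fin.ext h.symm), map_zero, zero_mul, zero_mul]
  · simp

theorem dehom_sqCoeff (a : Fin (n + 1) → ℂ) :
    dehom (2 * n) (sqCoeff n a) = dehom n a ^ 2 := by
  rw [← aeval_binaryForm, binaryForm_sqCoeff, map_pow, aeval_binaryForm]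

theorem eq_sqCoeff_iff {v : Fin (2 * n + 1) → ℂ} {a : Fin (n + 1) → ℂ} :
    v = sqCoeff n a ↔ dehom (2 * n) v = dehom n a ^ 2 := by
  rw [← dehom_sqCoeff, (dehom_injective _).eq_iff]

theorem sqCoeff_smul (t : ℂ) (a : Fin (n + 1) → ℂ) : sqCoeff n (t • a) = t ^ 2 • sqCoeff n a := by
  symm
  rw [eq_sqCoeff_iff, dehom_smul, dehom_smul, dehom_sqCoeff, map_pow, mul_pow]

theorem sqCoeff_ne_zero {a : Fin (n + 1) → ℂ} (ha : a ≠ 0) : sqCoeff n a ≠ 0 := by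
  intro h
  have := dehom_sqCoeff a
  rw [h, dehom_eq_zero_iff.2 rfl] at this
  exact ha (dehom_eq_zero_iff.1 (pow_eq_zero_iff two_ne_zero |>.1 this.symm))

theorem isForm_sqCoeff (k : Fin (2 * n + 1)) : IsForm 2 fun a => sqCoeff n a k := by
  refine IsForm.sum _ fun i _ => IsForm.sum _ fun j _ => ?_
  split_ifs
  · exact (IsForm.coord i).mul (IsForm.coord j)
  · exact IsForm.zero 2

theorem exists_smul_sqCoeff (t : ℂ) (a : Fin (n + 1) → ℂ) :
    ∃ u : ℂ, u ^ 2 = t ∧ t • sqCoeff n a = sqCoeff n (u • a) := by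
  obtain ⟨u, hu⟩ := IsAlgClosed.exists_pow_nat_eq t two_pos
  exact ⟨u, hu, by rw [sqCoeff_smul, hu]⟩

theorem mk_mem_squares {v : Fin (2 * n + 1) → ℂ} (hv : v ≠ 0) :
    Projectivization.mk ℂ v hv ∈ squares n ↔ ∃ a, v = sqCoeff n a := by
  constructor
  · rintro ⟨w, hw, hvw, a, ha⟩
    obtain ⟨t, rfl⟩ := (Projectivization.mk_eq_mk_iff' ℂ _ _ hv hw).1 hvw
    have hwa : w = sqCoeff n a := by
      rw [eq_sqCoeff_iff, ← aeval_binaryForm, ← aeval_binaryForm, ha, map_pow]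
    obtain ⟨u, -, hu⟩ := exists_smul_sqCoeff t a
    exact ⟨_, by rw [hwa, hu]⟩
  · rintro ⟨a, rfl⟩
    exact ⟨_, hv, rfl, a, binaryForm_sqCoeff a⟩

theorem mem_squares {x : ℙ ℂ (Fin (2 * n + 1) → ℂ)} :
    x ∈ squares n ↔ ∃ a, x.rep = sqCoeff n a := by
  rw [← mk_mem_squares x.rep_nonzero, x.mk_rep]

/-- A form without zero at `s` is recovered from its square, up to scalars, by a polynomial map:
expand at `s`, extract the square root, and expand back at the origin. The powers of the constant
coefficient make the components forms of degree `n + 1`. -/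
def sqrtCoeff (n : ℕ) (s : ℂ) (c : Fin (2 * n + 1) → ℂ) : Fin (n + 1) → ℂ :=
  let c' : ℕ → ℂ := fun k => (taylor s (dehom (2 * n) c)).coeff k
  toFn (n + 1) (∑ k ∈ Finset.range (n + 1), (c' 0 ^ (n + 1 - k) * rootCoeff c' k) •
    taylor (-s) (X ^ k))

theorem sqrtCoeff_sqCoeff (s : ℂ) (a : Fin (n + 1) → ℂ) :
    sqrtCoeff n s (sqCoeff n a) = (dehom n a).eval s ^ (2 * n + 1) • a := by
  have hb0 : (taylor s (dehom n a)).coeff 0 = (dehom n a).eval s := taylor_coeff_zero ..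
  have h0 : ((taylor s (dehom n a)) ^ 2).coeff 0 = (taylor s (dehom n a)).coeff 0 ^ 2 := by
    simp [sq]
  rw [sqrtCoeff]
  rw [dehom_sqCoeff, taylor_pow]
  have hk : ∀ k ∈ Finset.range (n + 1),
      ((taylor s (dehom n a) ^ 2).coeff 0 ^ (n + 1 - k) *
        rootCoeff (fun j => (taylor s (dehom n a) ^ 2).coeff j) k) • taylor (-s) (X ^ k) =
      (dehom n a).eval s ^ (2 * n + 1) •
        taylor (-s) ((taylor s (dehom n a)).coeff k • X ^ k) := by
    intro k hk
    have hk := Finset.mem_range.1 hk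
    rw [map_smul, smul_smul, h0, ← hb0]
    congr 1
    cases k with
    | zero => rw [rootCoeff]; simp only [Nat.sub_zero]; ring
    | succ k =>
      rw [rootCoeff_coeff_sq]
      obtain ⟨l, rfl⟩ : ∃ l, n = k + 1 + l := ⟨n - (k + 1), by omega⟩
      rw [show k + 1 + l + 1 - (k + 1) = l + 1 by omega]
      ring
  rw [Finset.sum_congr rfl hk, ← Finset.smul_sum, ← map_sum]
  have hsum : ∑ k ∈ Finset.range (n + 1), (taylor s (dehom n a)).coeff k • (X : ℂ[X]) ^ k =
      taylor s (dehom n a) := by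
    conv_rhs => rw [as_sum_range_C_mul_X_pow' (taylor s (dehom n a)) (n := n + 1)
      (by rw [natDegree_taylor]; exact natDegree_dehom_lt n a)]
    simp only [smul_eq_C_mul]
  rw [hsum, taylor_taylor, neg_add_cancel, taylor_zero, map_smul, toFn_dehom]

theorem isForm_sqrtCoeff (s : ℂ) (j : Fin (n + 1)) :
    IsForm (n + 1) fun c => sqrtCoeff n s c j := by
  have hc : ∀ k, IsForm 1 fun c => (taylor s (dehom (2 * n) c)).coeff k := fun k =>
    IsForm.of_linearMap ((lcoeff ℂ k).comp ((taylor s).comp (ofFn (2 * n + 1))))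
  simp only [sqrtCoeff, map_sum, map_smul, Finset.sum_apply, Pi.smul_apply, smul_eq_mul]
  refine IsForm.sum _ fun k hk => IsForm.mul_const ?_ _
  have hk := Finset.mem_range.1 hk
  exact (((hc 0).pow _).mul (isForm_rootCoeff hc k)).congr_degree (by omega)

/-- The equations of the variety of squares: they compare a form with the square of the candidate
for its square root. -/
def squareEquation (n : ℕ) (i : ℂ × Fin (2 * n + 1)) (c : Fin (2 * n + 1) → ℂ) : ℂ :=
  sqCoeff n (sqrtCoeff n i.1 c) i.2 - (dehom (2 * n) c).eval i.1 ^ (2 * n + 1) * c i.2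

theorem IsForm.comp {ι κ : Type} {d e : ℕ} {f : (κ → ℂ) → ℂ} {g : (ι → ℂ) → κ → ℂ}
    (hf : IsForm d f) (hg : ∀ k, IsForm e fun v => g v k) : IsForm (e * d) fun v => f (g v) := by
  obtain ⟨P, hP, h⟩ := hf
  choose Q hQ h' using hg
  refine ⟨MvPolynomial.aeval Q P, hP.aeval Q hQ, fun v => ?_⟩
  have : (MvPolynomial.eval v).comp (MvPolynomial.aeval Q : MvPolynomial κ ℂ →ₐ[ℂ] _).toRingHom =
      MvPolynomial.eval (g v) :=
    MvPolynomial.ringHom_ext (fun z => by simp) fun k => by simpa using h' k v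
  beta_reduce
  rw [← h, ← this]
  rfl

theorem isForm_squareEquation (i : ℂ × Fin (2 * n + 1)) :
    IsForm (2 * n + 2) (squareEquation n i) := by
  refine IsForm.sub ?_ ?_
  · exact ((isForm_sqCoeff i.2).comp fun j => isForm_sqrtCoeff i.1 j).congr_degree (by ring)
  · have : IsForm 1 fun c => (dehom (2 * n) c).eval i.1 :=
      IsForm.of_linearMap ((leval i.1).comp (ofFn (2 * n + 1)))
    exact ((this.pow (2 * n + 1)).mul (IsForm.coord i.2)).congr_degree (by ring)

theorem squareEquation_sqCoeff (i : ℂ × Fin (2 * n + 1)) (a : Fin (n + 1) → ℂ) :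
    squareEquation n i (sqCoeff n a) = 0 := by
  rw [squareEquation, sqrtCoeff_sqCoeff, sqCoeff_smul, dehom_sqCoeff, eval_pow, Pi.smul_apply,
    smul_eq_mul]
  ring

/-- At a point `s` where the form `c` does not vanish, the equations express it as a square. -/
theorem exists_eq_sqCoeff {c : Fin (2 * n + 1) → ℂ} (h : ∀ i, squareEquation n i c = 0) :
    ∃ a, c = sqCoeff n a := by
  by_cases hc : c = 0
  · refine ⟨0, ?_⟩
    funext k
    simp [hc, sqCoeff]
  obtain ⟨s, hs⟩ := exists_eval_dehom_ne_zero hc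
  have hs := pow_ne_zero (2 * n + 1) hs
  obtain ⟨u, -, hu⟩ := exists_smul_sqCoeff ((dehom (2 * n) c).eval s ^ (2 * n + 1))⁻¹
    (sqrtCoeff n s c)
  refine ⟨_, Eq.trans ?_ hu⟩
  rw [eq_inv_smul_iff₀ hs]
  funext k
  exact (sub_eq_zero.1 (h (s, k))).symm

theorem mem_squares_iff_squareEquation {x : ℙ ℂ (Fin (2 * n + 1) → ℂ)} :
    x ∈ squares n ↔ ∀ i, squareEquation n i x.rep = 0 := by
  rw [mem_squares]
  exact ⟨fun ⟨a, ha⟩ i => by rw [ha, squareEquation_sqCoeff], exists_eq_sqCoeff⟩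

theorem isZariskiClosed_squares (n : ℕ) : IsZariskiClosed (squares n) := by
  convert isZariskiClosed_of_forall_isForm (2 * n + 2) (squareEquation n) isForm_squareEquation
  ext x
  exact mem_squares_iff_squareEquation

/-- A form is determined by its square up to scalars. -/
theorem mk_eq_mk_of_sqCoeff_eq_smul {a b : Fin (n + 1) → ℂ} (ha : a ≠ 0) (hb : b ≠ 0) {t : ℂ}
    (h : t • sqCoeff n b = sqCoeff n a) :
    Projectivization.mk ℂ a ha = Projectivization.mk ℂ b hb := by
  obtain ⟨u, -, hu⟩ := exists_smul_sqCoeff t b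
  rw [hu, eq_sqCoeff_iff, dehom_sqCoeff, sq_eq_sq_iff_eq_or_eq_neg] at h
  rw [Projectivization.mk_eq_mk_iff']
  rcases h with h | h
  · exact ⟨u, dehom_injective n h⟩
  · refine ⟨-u, dehom_injective n ?_⟩
    rw [dehom_smul] at h ⊢
    rw [map_neg, neg_mul, h, neg_neg]

/-- Squaring is an isomorphism from a subset of `ℙ^n` to its image. -/
theorem areIsomorphic_of_sqCoeff {T : Set (ℙ ℂ (Fin (2 * n + 1) → ℂ))}
    {Z : Set (ℙ ℂ (Fin (n + 1) → ℂ))} (hT : T ⊆ squares n)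
    (hTZ : ∀ a (ha : a ≠ 0), Projectivization.mk ℂ _ (sqCoeff_ne_zero ha) ∈ T ↔
      Projectivization.mk ℂ a ha ∈ Z) : AreIsomorphic T Z := by
  have hψ : ∀ z ∈ Z, Projectivization.mk ℂ _ (sqCoeff_ne_zero z.rep_nonzero) ∈ T := fun z hz =>
    (hTZ z.rep z.rep_nonzero).2 (by rwa [z.mk_rep])
  let ψ : Z → T := fun z => ⟨Projectivization.mk ℂ _ (sqCoeff_ne_zero z.1.rep_nonzero), hψ z.1 z.2⟩
  have hbij : Function.Bijective ψ := by
    constructor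
    · intro z w h
      obtain ⟨t, ht⟩ := (Projectivization.mk_eq_mk_iff' ℂ _ _ _ _).1 (congrArg Subtype.val h)
      have := mk_eq_mk_of_sqCoeff_eq_smul z.1.rep_nonzero w.1.rep_nonzero ht
      rw [z.1.mk_rep, w.1.mk_rep] at this
      exact Subtype.ext this
    · intro x
      obtain ⟨a, ha⟩ := mem_squares.1 (hT x.2)
      have ha0 : a ≠ 0 := by
        rintro rfl
        refine x.1.rep_nonzero ?_
        rw [ha]
        funext k
        simp [sqCoeff]
      have hx : Projectivization.mk ℂ _ (sqCoeff_ne_zero ha0) = x.1 := by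
        conv_rhs => rw [← x.1.mk_rep]
        congr 1
        exact ha.symm
      refine ⟨⟨Projectivization.mk ℂ a ha0, (hTZ a ha0).1 (hx ▸ x.2)⟩, Subtype.ext ?_⟩
      refine Eq.trans ?_ hx
      rw [Projectivization.mk_eq_mk_iff']
      obtain ⟨c, hc, h⟩ := exists_rep_mk a ha0
      exact ⟨c ^ 2, by rw [h, sqCoeff_smul]⟩
  let φ := (Equiv.ofBijective ψ hbij).symm
  -- a representative of a point of `T` is the square of a multiple of the corresponding form
  have hφ : ∀ y : T, ∃ u : ℂ, u ≠ 0 ∧ y.1.rep = sqCoeff n (u • (φ y).1.rep) := fun y => by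
    have hy : y.1 = Projectivization.mk ℂ _ (sqCoeff_ne_zero (φ y).1.rep_nonzero) :=
      congrArg Subtype.val ((Equiv.ofBijective ψ hbij).apply_symm_apply y).symm
    obtain ⟨c, hc, h⟩ := exists_rep_mk _ (sqCoeff_ne_zero (φ y).1.rep_nonzero)
    obtain ⟨u, hu, h'⟩ := exists_smul_sqCoeff c (φ y).1.rep
    refine ⟨u, ?_, by rw [← h', ← h, ← hy]⟩
    rintro rfl
    exact hc (by rw [← hu]; simp)
  refine ⟨φ, fun x => ?_, fun z => ?_⟩
  · obtain ⟨u, hu, h⟩ := hφ x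
    obtain ⟨s, hs⟩ := exists_eval_dehom_ne_zero (smul_ne_zero hu (φ x).1.rep_nonzero)
    choose F hF hF' using isForm_sqrtCoeff (n := n) s
    have hF'' : ∀ v, (fun k => MvPolynomial.eval v (F k)) = sqrtCoeff n s v := fun v =>
      funext fun k => hF' k v
    refine ⟨n + 1, F, hF, ?_, fun y hy => ?_⟩
    · rw [hF'', h, sqrtCoeff_sqCoeff]
      exact smul_ne_zero (pow_ne_zero _ hs) (smul_ne_zero hu (φ x).1.rep_nonzero)
    · obtain ⟨w, hw, h⟩ := hφ y
      conv_lhs => rw [← (φ y).1.mk_rep]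
      symm
      rw [Projectivization.mk_eq_mk_iff']
      exact ⟨(dehom n (w • (φ y).1.rep)).eval s ^ (2 * n + 1) * w, by
        rw [hF'', h, sqrtCoeff_sqCoeff, smul_smul]⟩
  · choose F hF hF' using isForm_sqCoeff (n := n)
    have hF'' : ∀ v, (fun k => MvPolynomial.eval v (F k)) = sqCoeff n v := fun v =>
      funext fun k => hF' k v
    refine ⟨2, F, hF, ?_, fun y hy => ?_⟩
    · rw [hF'']
      exact sqCoeff_ne_zero z.1.rep_nonzero
    · simp only [hF'']
      rfl

end SquareRoot

/-! ### The secant variety of the rational normal curve -/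

section SecantVariety

open Polynomial

variable {ι : Type} {n : ℕ}

theorem choose_ne_zero (d : ℕ) (k : Fin (d + 1)) : (d.choose k : ℂ) ≠ 0 :=
  Nat.cast_ne_zero.2 (Nat.choose_pos (by omega)).ne'

/-- The `N`-th power of the linear form `p x + q y`. -/
def veronese (N : ℕ) (p q : ℂ) : Fin (N + 1) → ℂ :=
  fun k => (N.choose k : ℂ) * p ^ (N - (k : ℕ)) * q ^ (k : ℕ)

theorem binaryForm_veronese (N : ℕ) (l : Fin 2 → ℂ) :
    binaryForm N (veronese N (l 0) (l 1)) = binaryForm 1 l ^ N := by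
  have h : binaryForm 1 l = MvPolynomial.C (l 1) * MvPolynomial.X 1 +
      MvPolynomial.C (l 0) * MvPolynomial.X 0 := by
    simp [binaryForm, Fin.sum_univ_two, add_comm]
  rw [h, add_pow, binaryForm, Finset.sum_range]
  refine Finset.sum_congr rfl fun k _ => ?_
  simp only [veronese, map_mul, map_pow, map_natCast, mul_pow]
  ring

theorem binaryForm_injective (d : ℕ) : Function.Injective (binaryForm d) := fun v w h =>
  dehom_injective d (by rw [← aeval_binaryForm, h, aeval_binaryForm])

theorem veronese_mul (N : ℕ) (t p q : ℂ) :
    veronese N (t * p) (t * q) = t ^ N • veronese N p q := by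
  funext k
  have : t ^ N = t ^ (N - (k : ℕ)) * t ^ (k : ℕ) := by
    rw [← pow_add]
    congr 1
    omega
  simp only [veronese, Pi.smul_apply, smul_eq_mul, mul_pow, this]
  ring

theorem veronese_one_ne_zero (N : ℕ) (t : ℂ) : veronese N 1 t ≠ 0 := fun h => by
  simpa [veronese] using congrFun h 0

theorem exists_smul_veronese {N : ℕ} (hN : 0 < N) (c p q : ℂ) :
    ∃ p' q', c • veronese N p q = veronese N p' q' := by
  obtain ⟨t, ht⟩ := IsAlgClosed.exists_pow_nat_eq c hN
  exact ⟨t * p, t * q, by rw [veronese_mul, ht]⟩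

theorem exists_rep_eq_veronese {N : ℕ} (hN : 0 < N) {x : ℙ ℂ (Fin (N + 1) → ℂ)}
    (hx : x ∈ rationalNormalCurve N) : ∃ p q, x.rep = veronese N p q := by
  obtain ⟨v, hv, rfl, l, hl⟩ := hx
  obtain ⟨c, -, h⟩ := exists_rep_mk v hv
  obtain ⟨p, q, hpq⟩ := exists_smul_veronese hN c (l 0) (l 1)
  refine ⟨p, q, ?_⟩
  rw [h, ← hpq, binaryForm_injective N (hl.trans (binaryForm_veronese N l).symm)]

theorem mk_veronese_mem (N : ℕ) (t : ℂ) :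
    Projectivization.mk ℂ _ (veronese_one_ne_zero N t) ∈ rationalNormalCurve N :=
  ⟨_, _, rfl, ![1, t], by simpa using binaryForm_veronese N ![1, t]⟩

theorem isForm_veronese {N : ℕ} (i j : ι) (k : Fin (N + 1)) :
    IsForm N fun v : ι → ℂ => veronese N (v i) (v j) k := by
  simp only [veronese]
  exact ((((IsForm.coord i).pow (N - (k : ℕ))).const_mul _).mul
    ((IsForm.coord j).pow (k : ℕ))).congr_degree (by omega)

/-- A form that vanishes wherever some other nonzero form does not vanish is zero. -/
theorem IsForm.eq_zero_of_mul {d e : ℕ} {f g : (ι → ℂ) → ℂ} (hf : IsForm d f) (hg : IsForm e g)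
    (h : ∀ v, g v ≠ 0 → f v = 0) {v₀ : ι → ℂ} (h₀ : g v₀ ≠ 0) (v : ι → ℂ) : f v = 0 := by
  obtain ⟨P, -, hP⟩ := hf
  obtain ⟨Q, -, hQ⟩ := hg
  have hPQ : P * Q = 0 := MvPolynomial.funext fun w => by
    rw [map_mul, map_zero, hP, hQ, mul_eq_zero]
    by_contra! h'
    exact h'.1 (h w h'.2)
  rcases mul_eq_zero.1 hPQ with h' | h'
  · rw [← hP, h', map_zero]
  · exact absurd (by rw [← hQ, h', map_zero]) h₀

/-- The form whose nonvanishing says that the points `[v (i, 0) : v (i, 1)]` of the projective line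
are different and different from `[0 : 1]`. -/
def genericity (n : ℕ) (v : Fin n × Fin 2 → ℂ) : ℂ :=
  (∏ i, v (i, 0)) * ∏ i : Fin n, ∏ j : Fin n,
    if i = j then 1 else v (i, 0) * v (j, 1) - v (j, 0) * v (i, 1)

theorem isForm_genericity (n : ℕ) : ∃ e, IsForm e (genericity n) := by
  refine ⟨_, (IsForm.prod _ (fun _ => 1) fun i _ => IsForm.coord _).mul
    (IsForm.prod _ (fun i => ∑ j, if i = j then 0 else 1 + 1) fun i _ =>
      IsForm.prod _ (fun j => if i = j then 0 else 1 + 1) fun j _ => ?_)⟩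
  split_ifs
  · exact IsForm.const 1
  · exact ((IsForm.coord _).mul (IsForm.coord _)).sub ((IsForm.coord _).mul (IsForm.coord _))

theorem genericity_ne_zero : genericity n (fun x => if x.2 = 0 then 1 else (x.1 : ℂ)) ≠ 0 := by
  simp only [genericity, if_true, Finset.prod_const_one, one_mul, Fin.isValue, one_ne_zero,
    if_false]
  refine Finset.prod_ne_zero_iff.2 fun i _ => Finset.prod_ne_zero_iff.2 fun j _ => ?_
  split_ifs with h
  · exact one_ne_zero
  · rw [sub_ne_zero]
    exact_mod_cast fun h' => h (Fin.ext h').symm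

theorem ne_zero_of_genericity {v : Fin n × Fin 2 → ℂ} (h : genericity n v ≠ 0) (i : Fin n) :
    v (i, 0) ≠ 0 :=
  Finset.prod_ne_zero_iff.1 (left_ne_zero_of_mul h) i (Finset.mem_univ i)

theorem injective_of_genericity {v : Fin n × Fin 2 → ℂ} (h : genericity n v ≠ 0) :
    Function.Injective fun i => v (i, 1) / v (i, 0) := by
  intro i j hij
  by_contra hne
  have h1 := Finset.prod_ne_zero_iff.1 (Finset.prod_ne_zero_iff.1 (right_ne_zero_of_mul h) i
    (Finset.mem_univ i)) j (Finset.mem_univ j)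
  rw [if_neg hne] at h1
  have := (div_eq_div_iff (ne_zero_of_genericity h i) (ne_zero_of_genericity h j)).1 hij
  exact h1 (by linear_combination -this)

/-- A general point of the secant variety: a linear combination of powers of the linear forms
`x + t i * y`. -/
def secantPoint (n : ℕ) (l t : Fin n → ℂ) : Fin (2 * n + 1) → ℂ :=
  ∑ i, l i • veronese (2 * n) 1 (t i)

/-- Forms vanish on the secant variety if they vanish at its general points. -/
theorem eval_rep_eq_zero_of_mem_secantVariety (hn : 1 ≤ n) {d : ℕ}
    {F : (Fin (2 * n + 1) → ℂ) → ℂ} (hF : IsForm d F)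
    (h : ∀ l t : Fin n → ℂ, (∀ i, l i ≠ 0) → Function.Injective t → F (secantPoint n l t) = 0)
    {y : ℙ ℂ (Fin (2 * n + 1) → ℂ)} (hy : y ∈ secantVariety n (rationalNormalCurve (2 * n))) :
    F y.rep = 0 := by
  have hN : 0 < 2 * n := by omega
  have hclosed := isZariskiClosed_of_forall_isForm (α := Unit) d (fun _ => F) fun _ => hF
  refine hy _ ⟨hclosed, ?_⟩ ()
  rintro x ⟨p, hp, hx⟩ -
  obtain ⟨c, hc⟩ := (Submodule.mem_span_range_iff_exists_fun ℂ).1 hx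
  have hv : ∀ i, ∃ a b, c i • (p i).rep = veronese (2 * n) a b := fun i => by
    obtain ⟨a, b, h⟩ := exists_rep_eq_veronese hN (hp i)
    obtain ⟨a', b', h'⟩ := exists_smul_veronese hN (c i) a b
    exact ⟨a', b', by rw [h, h']⟩
  choose a b hab using hv
  have hG : IsForm (2 * n * d) fun v : Fin n × Fin 2 → ℂ =>
      F fun k => ∑ i, veronese (2 * n) (v (i, 0)) (v (i, 1)) k :=
    hF.comp fun k => IsForm.sum _ fun i _ => isForm_veronese _ _ k
  obtain ⟨e, he⟩ := isForm_genericity n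
  have := hG.eq_zero_of_mul he (fun v hv => ?_) genericity_ne_zero
    (fun x => if x.2 = 0 then a x.1 else b x.1)
  · rw [← hc]
    convert this using 1
    congr 1
    funext k
    simp [hab]
  · -- rescale the linear forms to `x + t i * y`
    have := h (fun i => v (i, 0) ^ (2 * n)) (fun i => v (i, 1) / v (i, 0))
      (fun i => pow_ne_zero _ (ne_zero_of_genericity hv i)) (injective_of_genericity hv)
    convert this using 1
    congr 1
    funext k
    rw [secantPoint, Finset.sum_apply]
    refine Finset.sum_congr rfl fun i _ => ?_
    rw [← veronese_mul, mul_one, mul_div_cancel₀ _ (ne_zero_of_genericity hv i)]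

theorem mk_secantPoint_mem (l t : Fin n → ℂ) (h : secantPoint n l t ≠ 0) :
    Projectivization.mk ℂ _ h ∈ secantVariety n (rationalNormalCurve (2 * n)) := by
  refine Set.mem_sInter.2 fun Z hZ => hZ.2 ?_
  refine ⟨fun i => _, fun i => mk_veronese_mem (2 * n) (t i), ?_⟩
  obtain ⟨c, -, hc⟩ := exists_rep_mk _ h
  rw [hc]
  refine Submodule.smul_mem _ _ (Submodule.sum_mem _ fun i _ => Submodule.smul_mem _ _ ?_)
  obtain ⟨c, hc0, hc⟩ := exists_rep_mk _ (veronese_one_ne_zero (2 * n) (t i))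
  have := Submodule.smul_mem _ c⁻¹ (Submodule.subset_span (R := ℂ)
    (s := Set.range fun i => (Projectivization.mk ℂ _ (veronese_one_ne_zero (2 * n) (t i))).rep)
    ⟨i, rfl⟩)
  beta_reduce at this
  rwa [hc, inv_smul_smul₀ hc0] at this

theorem secantPoint_zero (l t : Fin n → ℂ) : secantPoint n l t 0 = ∑ i, l i := by
  simp [secantPoint, veronese]

/-- `P` is a homogeneous equation of degree `d` of the secant variety. -/
def IsSecantEquation (n d : ℕ) (P : MvPolynomial (Fin (2 * n + 1)) ℂ) : Prop :=
  P.IsHomogeneous d ∧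
    ∀ y ∈ secantVariety n (rationalNormalCurve (2 * n)), MvPolynomial.eval y.rep P = 0

variable {d : ℕ} {P : MvPolynomial (Fin (2 * n + 1)) ℂ}

theorem IsSecantEquation.eval_secantPoint (hn : 1 ≤ n) (hP : IsSecantEquation n d P)
    (l t : Fin n → ℂ) : MvPolynomial.eval (secantPoint n l t) P = 0 := by
  have key : ∀ l : Fin n → ℂ, secantPoint n l t ≠ 0 →
      MvPolynomial.eval (secantPoint n l t) P = 0 := fun l h => by
    rw [← eval_mk_rep_eq_zero_iff hP.1 _ h]
    exact hP.2 _ (mk_secantPoint_mem l t h)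
  by_cases h : secantPoint n l t = 0
  · have h1 := key (fun _ => 1) fun h0 => by
      have := secantPoint_zero (fun _ => 1) t
      rw [h0, Pi.zero_apply, Finset.sum_const, Finset.card_univ, Fintype.card_fin, nsmul_one] at this
      exact Nat.cast_ne_zero.2 (Nat.one_le_iff_ne_zero.1 hn) this.symm
    have h2 := eval_smul_of_isHomogeneous hP.1 0 (secantPoint n (fun _ => 1) t)
    rw [h1, mul_zero, zero_smul] at h2
    rw [h, h2]
  · exact key l h

theorem IsSecantEquation.of_secantPoint (hn : 1 ≤ n) (hP : P.IsHomogeneous d)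
    (h : ∀ l t : Fin n → ℂ, (∀ i, l i ≠ 0) → Function.Injective t →
      MvPolynomial.eval (secantPoint n l t) P = 0) : IsSecantEquation n d P :=
  ⟨hP, fun _ hy => eval_rep_eq_zero_of_mem_secantVariety hn ⟨P, hP, fun _ => rfl⟩ h hy⟩

/-- The chain rule for a polynomial along a polynomial curve. -/
theorem derivative_aeval {ι : Type} [Fintype ι] (c : ι → ℂ[X]) (P : MvPolynomial ι ℂ) :
    derivative (MvPolynomial.aeval c P) =
      ∑ k, MvPolynomial.aeval c (MvPolynomial.pderiv k P) * derivative (c k) := by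
  classical
  induction P using MvPolynomial.induction_on with
  | C a => simp
  | add p q hp hq => simp [hp, hq, add_mul, Finset.sum_add_distrib]
  | mul_X p i hp =>
    have hk : ∀ k, MvPolynomial.aeval c (MvPolynomial.pderiv k (p * MvPolynomial.X i)) *
        derivative (c k) = (if k = i then MvPolynomial.aeval c p * derivative (c i) else 0) +
          MvPolynomial.aeval c (MvPolynomial.pderiv k p) * derivative (c k) * c i := fun k => by
      rw [Derivation.leibniz, MvPolynomial.pderiv_X, smul_eq_mul, smul_eq_mul, map_add, map_mul,
        map_mul, MvPolynomial.aeval_X]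
      by_cases h : k = i
      · subst h
        simp only [Pi.single_eq_same, map_one, if_true]
        ring
      · rw [Pi.single_eq_of_ne (Ne.symm h), if_neg h, map_zero]
        ring
    rw [Finset.sum_congr rfl fun k _ => hk k, Finset.sum_add_distrib, Finset.sum_ite_eq',
      if_pos (Finset.mem_univ i), ← Finset.sum_mul, ← hp, map_mul, derivative_mul,
      MvPolynomial.aeval_X]
    ring

theorem eval_aeval {ι : Type} (c : ι → ℂ[X]) (P : MvPolynomial ι ℂ) (t : ℂ) :
    (MvPolynomial.aeval c P).eval t = MvPolynomial.eval (fun k => (c k).eval t) P := by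
  induction P using MvPolynomial.induction_on with
  | C a => simp
  | add p q hp hq => simp [hp, hq]
  | mul_X p i hp => simp [hp]

/-- The derivative along a curve on which the polynomial is known. -/
theorem sum_pderiv_mul_derivative {ι : Type} [Fintype ι] (c : ι → ℂ[X]) (P : MvPolynomial ι ℂ)
    (R : ℂ[X]) (h : ∀ t, MvPolynomial.eval (fun k => (c k).eval t) P = R.eval t) (t : ℂ) :
    ∑ k, MvPolynomial.eval (fun k => (c k).eval t) (MvPolynomial.pderiv k P) *
      (derivative (c k)).eval t = (derivative R).eval t := by
  have : MvPolynomial.aeval c P = R := Polynomial.funext fun s => by rw [eval_aeval, h]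
  rw [← this, derivative_aeval, eval_finsetSum]
  exact Finset.sum_congr rfl fun k _ => by rw [eval_mul, eval_aeval]

/-- The gradient of `P`, carried over to the space of forms by the Bombieri-Weyl form. -/
def dualGradient (n : ℕ) (P : MvPolynomial (Fin (2 * n + 1)) ℂ) (y : Fin (2 * n + 1) → ℂ) :
    Fin (2 * n + 1) → ℂ :=
  fun k => ((2 * n).choose k : ℂ) * MvPolynomial.eval y (MvPolynomial.pderiv k P)

theorem dehom_dualGradient (P : MvPolynomial (Fin (2 * n + 1)) ℂ) (y : Fin (2 * n + 1) → ℂ) :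
    dehom (2 * n) (dualGradient n P y) = ∑ k : Fin (2 * n + 1),
      C (MvPolynomial.eval y (MvPolynomial.pderiv k P)) *
        (C ((2 * n).choose k : ℂ) * X ^ (k : ℕ)) := by
  rw [dehom, ofFn_eq_sum_monomial]
  refine Finset.sum_congr rfl fun k _ => ?_
  rw [dualGradient, ← C_mul_X_pow_eq_monomial, mul_comm ((2 * n).choose k : ℂ), C_mul, mul_assoc]

/-- The dual gradient at `y`, as a polynomial in the affine coordinate, has as its value at `s` the
derivative of `P` at `y` in the direction of the point `s` of the rational normal curve. -/
theorem eval_dehom_dualGradient (y : Fin (2 * n + 1) → ℂ) (s : ℂ) (R : ℂ[X])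
    (h : ∀ t : ℂ, MvPolynomial.eval (y + t • veronese (2 * n) 1 s) P = R.eval t) :
    (dehom (2 * n) (dualGradient n P y)).eval s = (derivative R).eval 0 := by
  have hc : ∀ t, (fun k => (C (y k) + X * C (veronese (2 * n) 1 s k)).eval t) =
      y + t • veronese (2 * n) 1 s := fun t => by
    funext k
    simp only [eval_add, eval_C, eval_mul, eval_X, Pi.add_apply, Pi.smul_apply, smul_eq_mul]
  have := sum_pderiv_mul_derivative (fun k => C (y k) + X * C (veronese (2 * n) 1 s k)) P R
    (fun t => by rw [hc, h]) 0
  rw [hc, zero_smul, add_zero] at this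
  rw [← this, dehom_dualGradient, eval_finsetSum]
  refine Finset.sum_congr rfl fun k _ => ?_
  simp [veronese]

/-- If `P` vanishes as the point `s` moves along the rational normal curve, then the derivative of
the dual gradient vanishes at `s`. -/
theorem eval_derivative_dehom_dualGradient (y : Fin (2 * n + 1) → ℂ) (l s : ℂ) (hl : l ≠ 0)
    (h : ∀ t : ℂ, MvPolynomial.eval (y + l • veronese (2 * n) 1 t) P = 0) :
    (derivative (dehom (2 * n) (dualGradient n P (y + l • veronese (2 * n) 1 s)))).eval s = 0 := by
  have := sum_pderiv_mul_derivative (fun k : Fin (2 * n + 1) => C (y k) +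
    C (l * (2 * n).choose k) * X ^ (k : ℕ)) P 0 (fun t => by
      rw [eval_zero, ← h t]; congr 2; ext k; simp [veronese, mul_assoc]) s
  have hy : (fun k : Fin (2 * n + 1) => (C (y k) + C (l * (2 * n).choose k) * X ^ (k : ℕ)).eval s) =
      y + l • veronese (2 * n) 1 s := by
    ext k; simp [veronese, mul_assoc]
  rw [hy] at this
  rw [dehom_dualGradient, derivative_sum, eval_finsetSum]
  apply mul_left_cancel₀ hl
  rw [mul_zero, Finset.mul_sum]
  simp only [derivative_zero, eval_zero] at this
  rw [← this]
  refine Finset.sum_congr rfl fun k _ => ?_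
  simp
  ring

end SecantVariety

/-! ### The dual of the secant variety -/

section Contact

open Polynomial

variable {n d : ℕ} {P : MvPolynomial (Fin (2 * n + 1)) ℂ}

/-- The monic polynomial with roots `t i`. -/
def nodePoly (t : Fin n → ℂ) : ℂ[X] := ∏ i, (X - C (t i))

theorem monic_nodePoly (t : Fin n → ℂ) : (nodePoly t).Monic := monic_prod_X_sub_C t _

theorem natDegree_nodePoly (t : Fin n → ℂ) : (nodePoly t).natDegree = n := by
  simp [nodePoly, natDegree_finsetProd_X_sub_C_eq_card]

/-- The binary form whose zeros are the points `[1 : t i]`. -/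
def nodeCoeff (n : ℕ) (t : Fin n → ℂ) : Fin (n + 1) → ℂ := toFn (n + 1) (nodePoly t)

theorem dehom_nodeCoeff (t : Fin n → ℂ) : dehom n (nodeCoeff n t) = nodePoly t :=
  dehom_toFn (by rw [natDegree_nodePoly]; omega)

theorem nodeCoeff_ne_zero (t : Fin n → ℂ) : nodeCoeff n t ≠ 0 := by
  rw [ne_eq, ← dehom_eq_zero_iff, dehom_nodeCoeff]
  exact (monic_nodePoly t).ne_zero

theorem secantPoint_update (l t : Fin n → ℂ) (i : Fin n) (a s : ℂ) :
    secantPoint n (Function.update l i a) (Function.update t i s) =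
      secantPoint n (Function.update l i 0) t + a • veronese (2 * n) 1 s := by
  rw [secantPoint, secantPoint, ← Finset.add_sum_erase _ _ (Finset.mem_univ i),
    ← Finset.add_sum_erase _ _ (Finset.mem_univ i)]
  simp only [Function.update_self, zero_smul, zero_add]
  rw [add_comm (a • _)]
  congr 1
  refine Finset.sum_congr rfl fun j hj => ?_
  have hj := Finset.ne_of_mem_erase hj
  simp only [Function.update_of_ne hj]

theorem secantPoint_eq_add (l t : Fin n → ℂ) (i : Fin n) :
    secantPoint n l t =
      secantPoint n (Function.update l i 0) t + l i • veronese (2 * n) 1 (t i) := by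
  rw [← secantPoint_update, Function.update_eq_self, Function.update_eq_self]

theorem X_sub_C_sq_dvd {g : ℂ[X]} {a : ℂ} (h : g.eval a = 0) (h' : (derivative g).eval a = 0) :
    (X - C a) ^ 2 ∣ g := by
  obtain ⟨q, rfl⟩ := dvd_iff_isRoot.2 h
  have : (X - C a) ∣ q := by
    rw [dvd_iff_isRoot, IsRoot]
    simpa using h'
  rw [sq]
  exact mul_dvd_mul_left _ this

/-- The tangent hyperplanes at a general point of the secant variety touch the rational normal
curve at the points that span the secant, so that they are squares. -/
theorem IsSecantEquation.exists_dualGradient_eq (hn : 1 ≤ n) (hP : IsSecantEquation n d P)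
    {l t : Fin n → ℂ} (hl : ∀ i, l i ≠ 0) (ht : Function.Injective t) :
    ∃ κ : ℂ, dualGradient n P (secantPoint n l t) = κ • sqCoeff n (nodeCoeff n t) := by
  set g := dehom (2 * n) (dualGradient n P (secantPoint n l t)) with hg
  have h0 : ∀ i, g.eval (t i) = 0 := fun i => by
    rw [hg, eval_dehom_dualGradient (secantPoint n l t) (t i) 0 fun z => ?_, derivative_zero,
      eval_zero]
    rw [eval_zero, secantPoint_eq_add l t i, add_assoc, ← add_smul, ← secantPoint_update]
    exact hP.eval_secantPoint hn _ _
  have h1 : ∀ i, (derivative g).eval (t i) = 0 := fun i => by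
    rw [hg, secantPoint_eq_add l t i]
    refine eval_derivative_dehom_dualGradient _ _ _ (hl i) fun z => ?_
    rw [← secantPoint_update]
    exact hP.eval_secantPoint hn _ _
  have hdvd : nodePoly t ^ 2 ∣ g := by
    rw [nodePoly, ← Finset.prod_pow]
    refine Finset.prod_dvd_of_coprime (fun i _ j _ hij => ?_) fun i _ =>
      X_sub_C_sq_dvd (h0 i) (h1 i)
    exact (isCoprime_X_sub_C_of_isUnit_sub
      (sub_ne_zero.2 fun h => hij (ht h)).isUnit).pow
  obtain ⟨q, hq⟩ := hdvd
  have hmon : (nodePoly t ^ 2).Monic := (monic_nodePoly t).pow 2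
  have hq0 : q.natDegree = 0 := by
    by_cases hq' : q = 0
    · simp [hq']
    have h2 := natDegree_dehom_lt (2 * n) (dualGradient n P (secantPoint n l t))
    rw [← hg, hq, hmon.natDegree_mul' hq', natDegree_pow, natDegree_nodePoly] at h2
    omega
  refine ⟨q.coeff 0, dehom_injective _ ?_⟩
  rw [dehom_smul, dehom_sqCoeff, dehom_nodeCoeff, ← hg, hq, mul_comm]
  congr 1
  exact eq_C_of_natDegree_eq_zero hq0

end Contact

section Hankel

open Matrix

variable {n : ℕ}

/-- The Hankel matrix of a sequence. -/
def hankel (n : ℕ) (c : Fin (2 * n + 1) → ℂ) : Matrix (Fin (n + 1)) (Fin (n + 1)) ℂ :=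
  Matrix.of fun i j => c ⟨i + j, by omega⟩

/-- The Hankel matrix of weighted power sums is congruent to the diagonal matrix of the weights. -/
theorem det_hankel_sum_pow (w s : Fin (n + 1) → ℂ) :
    (hankel n fun k => ∑ i, w i * s i ^ (k : ℕ)).det = (∏ i, w i) * (vandermonde s).det ^ 2 := by
  have : (hankel n fun k => ∑ i, w i * s i ^ (k : ℕ)) =
      (vandermonde s)ᵀ * diagonal w * vandermonde s := by
    ext i j
    rw [mul_apply]
    simp only [hankel, of_apply, mul_diagonal, transpose_apply, vandermonde_apply]
    exact Finset.sum_congr rfl fun k _ => by ring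
  rw [this, det_mul, det_mul, det_transpose, det_diagonal]
  ring

theorem isForm_det_hankel {ι : Type} {e : ℕ} {c : (ι → ℂ) → Fin (2 * n + 1) → ℂ}
    (hc : ∀ k, IsForm e fun v => c v k) :
    IsForm ((n + 1) * e) fun v => (hankel n (c v)).det := by
  simp only [det_apply']
  refine IsForm.sum _ fun σ _ => IsForm.const_mul ?_ _
  exact (IsForm.prod _ (fun _ => e) fun i _ => hc _).congr_degree (by simp)

theorem det_vandermonde_cons_sq (s : ℂ) (t : Fin n → ℂ) :
    (vandermonde (Fin.cons s t : Fin (n + 1) → ℂ)).det ^ 2 =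
      (vandermonde t).det ^ 2 * (nodePoly t).eval s ^ 2 := by
  rw [det_vandermonde, det_vandermonde, Fin.prod_univ_succ, Fin.prod_Ioi_zero]
  simp only [Fin.cons_succ, Fin.cons_zero, Fin.prod_Ioi_succ, nodePoly, Polynomial.eval_prod,
    mul_pow]
  rw [mul_comm]
  congr 1
  rw [← Finset.prod_pow, ← Finset.prod_pow]
  refine Finset.prod_congr rfl fun i _ => ?_
  simp
  ring

open Polynomial in
/-- The Hankel determinant is an equation of the secant variety whose gradient does not vanish at
its general points. -/
theorem exists_isSecantEquation_dualGradient_eq (hn : 1 ≤ n) :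
    ∃ D, IsSecantEquation n (n + 1) D ∧ ∀ l t : Fin n → ℂ, (∀ i, l i ≠ 0) →
      Function.Injective t → ∃ κ : ℂ, κ ≠ 0 ∧
        dualGradient n D (secantPoint n l t) = κ • sqCoeff n (nodeCoeff n t) := by
  have hF : IsForm (n + 1) fun c : Fin (2 * n + 1) → ℂ =>
      (hankel n fun k => c k * ((2 * n).choose k : ℂ)⁻¹).det :=
    (isForm_det_hankel fun k => (IsForm.coord k).mul_const _).congr_degree (mul_one _)
  obtain ⟨D, hD, hDF⟩ := hF
  -- adding a further point `s` with weight `z` makes the matrix a sum of `n + 1` matrices of rank one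
  have key : ∀ (l t : Fin n → ℂ) (z s : ℂ),
      MvPolynomial.eval (secantPoint n l t + z • veronese (2 * n) 1 s) D =
        z * ((∏ i, l i) * ((vandermonde t).det ^ 2 * (nodePoly t).eval s ^ 2)) := by
    intro l t z s
    have := det_hankel_sum_pow (Fin.cons z l : Fin (n + 1) → ℂ) (Fin.cons s t : Fin (n + 1) → ℂ)
    rw [det_vandermonde_cons_sq, Fin.prod_univ_succ] at this
    simp only [Fin.cons_zero, Fin.cons_succ] at this
    rw [hDF, ← mul_assoc z, ← this]
    refine congrArg (fun c => (hankel n c).det) (funext fun k => ?_)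
    have hk := choose_ne_zero (2 * n) k
    rw [Fin.sum_univ_succ]
    simp only [Fin.cons_zero, Fin.cons_succ, secantPoint, veronese, Pi.add_apply, Pi.smul_apply,
      Finset.sum_apply, smul_eq_mul, one_pow, mul_one]
    rw [add_comm, add_mul, Finset.sum_mul]
    congr 1
    · field_simp
    · refine Finset.sum_congr rfl fun i _ => ?_
      field_simp
  refine ⟨D, IsSecantEquation.of_secantPoint hn hD fun l t _ _ => ?_, fun l t hl ht => ?_⟩
  · simpa using key l t 0 0
  · refine ⟨(∏ i, l i) * (vandermonde t).det ^ 2, mul_ne_zero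
      (Finset.prod_ne_zero_iff.2 fun i _ => hl i)
      (pow_ne_zero 2 (det_vandermonde_ne_zero_iff.2 ht)), dehom_injective _ ?_⟩
    refine Polynomial.funext fun s => ?_
    rw [eval_dehom_dualGradient (secantPoint n l t) s
      (X * C ((∏ i, l i) * ((vandermonde t).det ^ 2 * (nodePoly t).eval s ^ 2)))
      (fun z => by rw [key, eval_mul, eval_X, eval_C]), dehom_smul, dehom_sqCoeff, dehom_nodeCoeff]
    simp only [derivative_mul, derivative_X, derivative_C, one_mul, mul_zero, add_zero]
    rw [eval_C, eval_mul, eval_C, eval_pow, mul_assoc]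

end Hankel

section DualVariety

variable {n d : ℕ} {P : MvPolynomial (Fin (2 * n + 1)) ℂ}

theorem bombieriWeyl_apply (d : ℕ) (b v : Fin (d + 1) → ℂ) :
    bombieriWeyl d b v = ∑ k, b k * (d.choose k : ℂ)⁻¹ * v k := by
  rw [bombieriWeyl, Matrix.toBilin'_apply]
  refine Finset.sum_congr rfl fun i _ => ?_
  rw [Finset.sum_eq_single i (fun j _ hj => by rw [Matrix.diagonal_apply_ne' _ hj]; ring)
    (by simp), Matrix.diagonal_apply_eq]

theorem bombieriWeyl_dualGradient (y v : Fin (2 * n + 1) → ℂ) :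
    bombieriWeyl (2 * n) (dualGradient n P y) v =
      ∑ k, MvPolynomial.eval y (MvPolynomial.pderiv k P) * v k := by
  rw [bombieriWeyl_apply]
  refine Finset.sum_congr rfl fun k _ => ?_
  have := choose_ne_zero (2 * n) k
  rw [dualGradient]
  field_simp

theorem bombieriWeyl_ne_zero {b : Fin (d + 1) → ℂ} (hb : b ≠ 0) : bombieriWeyl d b ≠ 0 := by
  obtain ⟨k, hk⟩ := Function.ne_iff.1 hb
  intro h
  have := LinearMap.congr_fun h (Pi.single k 1)
  rw [bombieriWeyl_apply, Finset.sum_eq_single k (fun j _ hj => by simp [hj]) (by simp)] at this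
  simp only [Pi.single_eq_same, mul_one, LinearMap.zero_apply] at this
  exact mul_ne_zero hk (inv_ne_zero (choose_ne_zero d k)) this

theorem mem_coneTangentSpace {x : ℙ ℂ (Fin (2 * n + 1) → ℂ)} {v : Fin (2 * n + 1) → ℂ} :
    v ∈ coneTangentSpace (secantVariety n (rationalNormalCurve (2 * n))) x ↔
      ∀ P d, IsSecantEquation n d P → bombieriWeyl (2 * n) (dualGradient n P x.rep) v = 0 := by
  simp only [bombieriWeyl_dualGradient]
  exact ⟨fun h P d hP => h P d hP.1 hP.2, fun h P d hP hX => h P d ⟨hP, hX⟩⟩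

theorem isForm_dualGradient (hP : P.IsHomogeneous d) (k : Fin (2 * n + 1)) :
    IsForm (d - 1) fun y => dualGradient n P y k :=
  IsForm.const_mul ⟨_, hP.pderiv, fun _ => rfl⟩ _

theorem dualGradient_X_pow_mul (y : Fin (2 * n + 1) → ℂ) (i : Fin (2 * n + 1)) (e : ℕ) (z : ℂ)
    (hy : MvPolynomial.eval y P = 0) :
    dualGradient n (MvPolynomial.C z * MvPolynomial.X i ^ e * P) y =
      (z * y i ^ e) • dualGradient n P y := by
  funext k
  simp [dualGradient, Derivation.leibniz, hy]
  ring

/-- The gradients at `x` of the equations of the secant variety form a linear space; equations of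
different degrees are multiplied by powers of a coordinate that does not vanish at `x`. -/
def gradientSpace (n : ℕ) (x : ℙ ℂ (Fin (2 * n + 1) → ℂ))
    (hx : x ∈ secantVariety n (rationalNormalCurve (2 * n))) :
    Submodule ℂ (Fin (2 * n + 1) → ℂ) where
  carrier := {b | ∃ P d, IsSecantEquation n d P ∧ dualGradient n P x.rep = b}
  zero_mem' := ⟨0, 0, ⟨MvPolynomial.isHomogeneous_zero _ _ _, by simp⟩, by
    funext k; simp [dualGradient]⟩
  smul_mem' := by
    rintro z _ ⟨P, d, hP, rfl⟩
    refine ⟨MvPolynomial.C z * P, d, ⟨hP.1.C_mul z, fun y hy => by simp [hP.2 y hy]⟩, ?_⟩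
    funext k
    simp [dualGradient, mul_left_comm]
  add_mem' := by
    rintro _ _ ⟨P, d, hP, rfl⟩ ⟨Q, e, hQ, rfl⟩
    obtain ⟨i, hi⟩ := Function.ne_iff.1 x.rep_nonzero
    have hdeg : ∀ (m : ℕ) (z : ℂ), (MvPolynomial.C z * MvPolynomial.X i ^ m :
        MvPolynomial (Fin (2 * n + 1)) ℂ).IsHomogeneous m := fun m z => by
      simpa using (((MvPolynomial.isHomogeneous_X ℂ i).pow m).C_mul z)
    refine ⟨MvPolynomial.C (x.rep i ^ e)⁻¹ * MvPolynomial.X i ^ e * P +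
      MvPolynomial.C (x.rep i ^ d)⁻¹ * MvPolynomial.X i ^ d * Q, e + d, ⟨?_, fun y hy => ?_⟩, ?_⟩
    · exact ((hdeg _ _).mul hP.1).add (add_comm d e ▸ (hdeg _ _).mul hQ.1)
    · simp [hP.2 y hy, hQ.2 y hy]
    · have hadd : ∀ R S, dualGradient n (R + S) x.rep =
          dualGradient n R x.rep + dualGradient n S x.rep := fun R S => by
        funext k
        simp [dualGradient, mul_add]
      rw [hadd, dualGradient_X_pow_mul _ _ _ _ (hP.2 x hx),
        dualGradient_X_pow_mul _ _ _ _ (hQ.2 x hx), inv_mul_cancel₀ (pow_ne_zero _ hi),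
        inv_mul_cancel₀ (pow_ne_zero _ hi), one_smul, one_smul]

/-- The hyperplanes that contain the tangent space are given by gradients of equations. -/
theorem exists_dualGradient_eq_of_forall {x : ℙ ℂ (Fin (2 * n + 1) → ℂ)}
    (hx : x ∈ secantVariety n (rationalNormalCurve (2 * n))) {b : Fin (2 * n + 1) → ℂ}
    (hb : ∀ v ∈ coneTangentSpace (secantVariety n (rationalNormalCurve (2 * n))) x,
      bombieriWeyl (2 * n) b v = 0) :
    ∃ P d, IsSecantEquation n d P ∧ dualGradient n P x.rep = b := by
  -- a vector outside the space of gradients is separated from it by a tangent vector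
  by_contra hne
  obtain ⟨φ, hφb, hφ⟩ := Submodule.exists_le_ker_of_notMem (p := gradientSpace n x hx) (v := b) hne
  let v : Fin (2 * n + 1) → ℂ := fun k => (2 * n).choose k * φ (Pi.single k 1)
  have hv : ∀ c, bombieriWeyl (2 * n) c v = φ c := fun c => by
    conv_rhs => rw [← Finset.univ_sum_single c]
    rw [bombieriWeyl_apply, map_sum]
    refine Finset.sum_congr rfl fun k _ => ?_
    have hk := choose_ne_zero (2 * n) k
    have : Pi.single k (c k) = c k • (Pi.single k 1 : Fin (2 * n + 1) → ℂ) := by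
      rw [← Pi.single_smul, smul_eq_mul, mul_one]
    rw [this, map_smul, smul_eq_mul]
    simp only [v]
    field_simp
  refine hφb ?_
  rw [← hv]
  refine hb v (mem_coneTangentSpace.2 fun P d hP => ?_)
  rw [hv]
  exact hφ ⟨P, d, hP, rfl⟩

/-- A hyperplane that contains the tangent space at a point of the secant variety is a square: the
equations of the squares hold for the gradients at general points, hence at all points. -/
theorem mem_squares_of_forall (hn : 1 ≤ n) {x b : ℙ ℂ (Fin (2 * n + 1) → ℂ)}
    (hx : x ∈ secantVariety n (rationalNormalCurve (2 * n)))
    (hb : ∀ v ∈ coneTangentSpace (secantVariety n (rationalNormalCurve (2 * n))) x,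
      bombieriWeyl (2 * n) b.rep v = 0) : b ∈ squares n := by
  obtain ⟨P, d, hP, h⟩ := exists_dualGradient_eq_of_forall hx hb
  rw [mem_squares_iff_squareEquation]
  intro i
  rw [← h]
  refine eval_rep_eq_zero_of_mem_secantVariety hn
    ((isForm_squareEquation i).comp fun k => isForm_dualGradient hP.1 k) (fun l t hl ht => ?_) hx
  obtain ⟨κ, hκ⟩ := hP.exists_dualGradient_eq hn hl ht
  obtain ⟨u, -, hu⟩ := exists_smul_sqCoeff κ (nodeCoeff n t)
  rw [hκ, hu, squareEquation_sqCoeff]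

/-- The gradients of any two equations are proportional at every point of the secant variety, since
they are so at its general points. -/
theorem dualGradient_mul_comm (hn : 1 ≤ n) {e : ℕ} {Q : MvPolynomial (Fin (2 * n + 1)) ℂ}
    (hP : IsSecantEquation n d P) (hQ : IsSecantEquation n e Q) {y : ℙ ℂ (Fin (2 * n + 1) → ℂ)}
    (hy : y ∈ secantVariety n (rationalNormalCurve (2 * n))) (i j : Fin (2 * n + 1)) :
    dualGradient n P y.rep i * dualGradient n Q y.rep j =
      dualGradient n P y.rep j * dualGradient n Q y.rep i := by
  rw [← sub_eq_zero]
  refine eval_rep_eq_zero_of_mem_secantVariety hn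
    (((isForm_dualGradient hP.1 i).mul (isForm_dualGradient hQ.1 j)).sub
      ((isForm_dualGradient hP.1 j).mul (isForm_dualGradient hQ.1 i))) (fun l t hl ht => ?_) hy
  obtain ⟨κ, hκ⟩ := hP.exists_dualGradient_eq hn hl ht
  obtain ⟨κ', hκ'⟩ := hQ.exists_dualGradient_eq hn hl ht
  simp only [hκ, hκ', Pi.smul_apply, smul_eq_mul]
  ring

theorem finrank_ker_bombieriWeyl {b : Fin (d + 1) → ℂ} (hb : b ≠ 0) :
    Module.finrank ℂ (LinearMap.ker (bombieriWeyl d b)) = d := by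
  have := Module.Dual.finrank_ker_add_one_of_ne_zero (bombieriWeyl_ne_zero hb)
  rw [Module.finrank_fin_fun] at this
  omega

/-- All tangent spaces of the secant variety have codimension at most one. -/
theorem le_finrank_coneTangentSpace (hn : 1 ≤ n) {y : ℙ ℂ (Fin (2 * n + 1) → ℂ)}
    (hy : y ∈ secantVariety n (rationalNormalCurve (2 * n))) :
    2 * n ≤ Module.finrank ℂ
      (coneTangentSpace (secantVariety n (rationalNormalCurve (2 * n))) y) := by
  by_cases h : ∀ P d, IsSecantEquation n d P → dualGradient n P y.rep = 0
  · have : coneTangentSpace (secantVariety n (rationalNormalCurve (2 * n))) y = ⊤ :=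
      eq_top_iff.2 fun v _ => mem_coneTangentSpace.2 fun P d hP => by
        rw [h P d hP, map_zero, LinearMap.zero_apply]
    rw [this, finrank_top, Module.finrank_fin_fun]
    omega
  · push Not at h
    obtain ⟨Q, e, hQ, hQ0⟩ := h
    obtain ⟨j, hj⟩ := Function.ne_iff.1 hQ0
    refine (finrank_ker_bombieriWeyl hQ0).ge.trans ?_
    refine Submodule.finrank_mono fun v hv => mem_coneTangentSpace.2 fun P d hP => ?_
    have : dualGradient n Q y.rep j • dualGradient n P y.rep =
        dualGradient n P y.rep j • dualGradient n Q y.rep := by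
      funext i
      have := dualGradient_mul_comm hn hP hQ hy i j
      simp only [Pi.smul_apply, smul_eq_mul]
      linear_combination this
    have h2 := congrArg (fun b => bombieriWeyl (2 * n) b v) this
    simp only [map_smul, LinearMap.smul_apply, LinearMap.mem_ker.1 hv, smul_zero,
      smul_eq_zero] at h2
    exact h2.resolve_left hj

/-- The square of a form with simple zeros is tangent to the secant variety at a smooth point, the sum
of the powers of the linear forms that correspond to the zeros. -/
theorem mk_sqCoeff_nodeCoeff_mem (hn : 1 ≤ n) {t : Fin n → ℂ} (ht : Function.Injective t) :
    Projectivization.mk ℂ _ (sqCoeff_ne_zero (nodeCoeff_ne_zero t)) ∈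
      {b | ∃ x ∈ smoothLocus (secantVariety n (rationalNormalCurve (2 * n))),
        ∀ v ∈ coneTangentSpace (secantVariety n (rationalNormalCurve (2 * n))) x,
          bombieriWeyl (2 * n) b.rep v = 0} := by
  have h0 : secantPoint n (fun _ => 1) t ≠ 0 := fun h => by
    have := secantPoint_zero (fun _ => 1) t
    rw [h, Pi.zero_apply, Finset.sum_const, Finset.card_univ, Fintype.card_fin, nsmul_one] at this
    exact Nat.cast_ne_zero.2 (Nat.one_le_iff_ne_zero.1 hn) this.symm
  obtain ⟨c, hc, hrep⟩ := exists_rep_mk _ h0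
  -- the chosen representative is again a general point, with all coefficients equal to `c`
  have hrep' : (Projectivization.mk ℂ _ h0).rep = secantPoint n (fun _ => c) t := by
    rw [hrep, secantPoint, secantPoint, Finset.smul_sum]
    exact Finset.sum_congr rfl fun i _ => by rw [one_smul]
  obtain ⟨D, hD, hκ⟩ := exists_isSecantEquation_dualGradient_eq hn
  obtain ⟨κ, hκ0, hκ⟩ := hκ (fun _ => c) t (fun _ => hc) ht
  have hT : ∀ v ∈ coneTangentSpace (secantVariety n (rationalNormalCurve (2 * n)))
      (Projectivization.mk ℂ _ h0), bombieriWeyl (2 * n) (sqCoeff n (nodeCoeff n t)) v = 0 := by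
    intro v hv
    have := mem_coneTangentSpace.1 hv D (n + 1) hD
    rw [hrep', hκ, map_smul, LinearMap.smul_apply, smul_eq_zero] at this
    exact this.resolve_left hκ0
  refine ⟨_, ⟨mk_secantPoint_mem _ _ h0, fun y hy => ?_⟩, fun v hv => ?_⟩
  · refine le_trans ?_ (le_finrank_coneTangentSpace hn hy)
    exact (Submodule.finrank_mono hT).trans
      (finrank_ker_bombieriWeyl (sqCoeff_ne_zero (nodeCoeff_ne_zero t))).le
  · obtain ⟨a, -, ha⟩ := exists_rep_mk _ (sqCoeff_ne_zero (nodeCoeff_ne_zero t))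
    rw [ha, map_smul, LinearMap.smul_apply, hT v hv, smul_zero]

section Factorization

open Polynomial

/-- The product of the linear polynomials `v (i, 0) * X - v (i, 1)`; every binary form of degree `n`
is of this kind, up to a scalar, where zeros at infinity are the factors with `v (i, 0) = 0`. -/
def linearProduct (v : Fin n × Fin 2 → ℂ) : ℂ[X] := ∏ i, (C (v (i, 0)) * X - C (v (i, 1)))

theorem exists_eq_linearProduct (p : ℂ[X]) (hp : p.natDegree ≤ n) :
    ∃ (z : ℂ) (v : Fin n × Fin 2 → ℂ), p = C z * linearProduct v := by
  induction n generalizing p with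
  | zero => exact ⟨p.coeff 0, 0, by
      rw [eq_C_of_natDegree_eq_zero (Nat.le_zero.1 hp)]; simp [linearProduct]⟩
  | succ n ih =>
    have hext : ∀ (a b : ℂ) (v : Fin n × Fin 2 → ℂ), ∃ w : Fin (n + 1) × Fin 2 → ℂ,
        linearProduct w = (C a * X - C b) * linearProduct v := fun a b v =>
      ⟨fun x => Fin.cons (α := fun _ => ℂ) (![a, b] x.2) (fun i => v (i, x.2)) x.1, by
        simp [linearProduct, Fin.prod_univ_succ]⟩
    by_cases hpn : p.natDegree ≤ n
    · obtain ⟨z, v, hv⟩ := ih p hpn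
      -- the factor `0 * X - (-1)` is trivial
      obtain ⟨w, hw⟩ := hext 0 (-1) v
      exact ⟨z, w, by rw [hw, hv]; simp⟩
    · obtain ⟨r, hr⟩ := IsAlgClosed.exists_root p (by
        intro h
        have := natDegree_eq_zero_iff_degree_le_zero.2 h.le
        omega)
      obtain ⟨q, hq⟩ := dvd_iff_isRoot.2 hr
      have hq0 : q ≠ 0 := by
        rintro rfl
        rw [hq] at hpn
        simp at hpn
      have hqn : q.natDegree ≤ n := by
        rw [hq, (monic_X_sub_C r).natDegree_mul' hq0, natDegree_X_sub_C] at hp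
        omega
      obtain ⟨z, v, hv⟩ := ih q hqn
      obtain ⟨w, hw⟩ := hext 1 r v
      refine ⟨z, w, ?_⟩
      rw [hw, hq, hv, C_1, one_mul]
      ring

theorem isForm_coeff_linearProduct (k : ℕ) :
    IsForm n fun v : Fin n × Fin 2 → ℂ => (linearProduct v).coeff k := by
  have key : ∀ (s : Finset (Fin n)) k, IsForm s.card fun v : Fin n × Fin 2 → ℂ =>
      (∏ i ∈ s, (C (v (i, 0)) * X - C (v (i, 1)))).coeff k := by
    intro s
    induction s using Finset.induction_on with
    | empty =>
      intro k
      simpa using IsForm.const _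
    | insert i s hi ih =>
      intro k
      simp only [Finset.prod_insert hi, coeff_mul]
      refine IsForm.sum _ fun a _ => ?_
      rw [Finset.card_insert_of_notMem hi, add_comm]
      refine IsForm.mul ?_ (ih _)
      simp only [coeff_sub, coeff_C_mul, coeff_C]
      refine ((IsForm.coord _).mul_const _).sub ?_
      split_ifs
      · exact IsForm.coord _
      · exact IsForm.zero _
  exact (key Finset.univ k).congr_degree (by simp)

theorem linearProduct_of_genericity {v : Fin n × Fin 2 → ℂ} (hv : genericity n v ≠ 0) :
    linearProduct v = C (∏ i, v (i, 0)) * nodePoly fun i => v (i, 1) / v (i, 0) := by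
  rw [linearProduct, nodePoly, map_prod, ← Finset.prod_mul_distrib]
  refine Finset.prod_congr rfl fun i _ => ?_
  rw [mul_sub, ← C_mul, mul_div_cancel₀ _ (ne_zero_of_genericity hv i)]

/-- Squares of forms without multiple zeros are Zariski dense in the squares. -/
theorem squares_subset_of_isZariskiClosed {Z : Set (ℙ ℂ (Fin (2 * n + 1) → ℂ))}
    (hZ : IsZariskiClosed Z) (h : ∀ t : Fin n → ℂ, Function.Injective t →
      Projectivization.mk ℂ _ (sqCoeff_ne_zero (nodeCoeff_ne_zero t)) ∈ Z) : squares n ⊆ Z := by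
  obtain ⟨S, hS, rfl⟩ := hZ
  intro x hx P hP
  obtain ⟨d, hd⟩ := hS P hP
  obtain ⟨a, ha⟩ := mem_squares.1 hx
  obtain ⟨z, v, hv⟩ := exists_eq_linearProduct (dehom n a)
    (Nat.le_of_lt_succ (natDegree_dehom_lt n a))
  have ha' : a = z • toFn (n + 1) (linearProduct v) := by
    rw [← toFn_dehom n a, hv, ← smul_eq_C_mul, map_smul]
  have hform : IsForm (n * (2 * d)) fun v : Fin n × Fin 2 → ℂ =>
      MvPolynomial.eval (sqCoeff n (toFn (n + 1) (linearProduct v))) P :=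
    (IsForm.comp (IsForm.comp (f := fun c => MvPolynomial.eval c P) ⟨P, hd, fun _ => rfl⟩
      fun k => isForm_sqCoeff k) fun k => isForm_coeff_linearProduct (k : ℕ))
  obtain ⟨e, he⟩ := isForm_genericity n
  rw [ha, ha', sqCoeff_smul, eval_smul_of_isHomogeneous hd,
    hform.eq_zero_of_mul he (fun w hw => ?_) genericity_ne_zero v, mul_zero]
  rw [linearProduct_of_genericity hw, ← smul_eq_C_mul, map_smul, sqCoeff_smul,
    eval_smul_of_isHomogeneous hd]
  have := h _ (injective_of_genericity hw) P hP
  rw [eval_mk_rep_eq_zero_iff hd] at this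
  rw [nodeCoeff] at this
  rw [this, mul_zero]

end Factorization

theorem dualOfSecant_eq_squares (hn : 1 ≤ n) : dualOfSecant n = squares n := by
  refine Set.Subset.antisymm ?_ ?_
  · refine Set.sInter_subset_of_mem ⟨isZariskiClosed_squares n, ?_⟩
    rintro b ⟨x, hx, hb⟩
    exact mem_squares_of_forall hn hx.1 hb
  · refine Set.subset_sInter fun Z hZ => ?_
    exact squares_subset_of_isZariskiClosed hZ.1 fun t ht => hZ.2 (mk_sqCoeff_nodeCoeff_mem hn ht)

end DualVariety

/-! ### General hyperplane sections -/

section HyperplaneSections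

open Matrix

variable {n : ℕ}

/-- The quadratic form of a symmetric matrix, as a polynomial. -/
def quadraticPoly {m : ℕ} (A : Matrix (Fin m) (Fin m) ℂ) : MvPolynomial (Fin m) ℂ :=
  ∑ i, ∑ j, MvPolynomial.C (A i j) * MvPolynomial.X i * MvPolynomial.X j

theorem isHomogeneous_quadraticPoly {m : ℕ} (A : Matrix (Fin m) (Fin m) ℂ) :
    (quadraticPoly A).IsHomogeneous 2 :=
  MvPolynomial.IsHomogeneous.sum _ _ _ fun i _ => MvPolynomial.IsHomogeneous.sum _ _ _ fun j _ =>
    ((MvPolynomial.isHomogeneous_X ℂ i).C_mul _).mul (MvPolynomial.isHomogeneous_X ℂ j)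

theorem eval_quadraticPoly {m : ℕ} (A : Matrix (Fin m) (Fin m) ℂ) (v : Fin m → ℂ) :
    MvPolynomial.eval v (quadraticPoly A) = ∑ i, ∑ j, A i j * v i * v j := by
  simp [quadraticPoly]

theorem eval_pderiv_quadraticPoly {m : ℕ} {A : Matrix (Fin m) (Fin m) ℂ} (hA : A.IsSymm)
    (v : Fin m → ℂ) (k : Fin m) :
    MvPolynomial.eval v (MvPolynomial.pderiv k (quadraticPoly A)) = 2 * (A *ᵥ v) k := by
  have h : ∀ i j, MvPolynomial.eval v (MvPolynomial.pderiv k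
      (MvPolynomial.C (A i j) * MvPolynomial.X i * MvPolynomial.X j)) =
      (if i = k then A i j * v j else 0) + if j = k then A i j * v i else 0 := fun i j => by
    rw [mul_assoc, Derivation.leibniz, Derivation.leibniz, MvPolynomial.pderiv_X,
      MvPolynomial.pderiv_X, MvPolynomial.pderiv_C]
    by_cases hi : i = k <;> by_cases hj : j = k <;> simp [hi, hj]; ring
  simp only [quadraticPoly, map_sum, h, Finset.sum_add_distrib]
  rw [Finset.sum_comm]
  simp only [Finset.sum_ite_eq', Finset.mem_univ, if_true, mulVec, dotProduct]
  rw [two_mul]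
  congr 1
  exact Finset.sum_congr rfl fun i _ => by rw [hA.apply]

theorem isSymm_hankel (c : Fin (2 * n + 1) → ℂ) : (hankel n c).IsSymm :=
  Matrix.IsSymm.ext fun i j => congrArg c (Fin.ext (add_comm (j : ℕ) i))

theorem eval_quadraticPoly_hankel (c : Fin (2 * n + 1) → ℂ) (a : Fin (n + 1) → ℂ) :
    MvPolynomial.eval a (quadraticPoly (hankel n c)) = ∑ k, c k * sqCoeff n a k := by
  rw [eval_quadraticPoly]
  symm
  simp only [sqCoeff, Finset.mul_sum]
  rw [Finset.sum_comm]
  refine Finset.sum_congr rfl fun i _ => ?_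
  rw [Finset.sum_comm]
  refine Finset.sum_congr rfl fun j _ => ?_
  rw [Finset.sum_eq_single (⟨i + j, by omega⟩ : Fin (2 * n + 1))]
  · simp [hankel, mul_assoc]
  · intro k _ hk
    rw [if_neg fun h => hk (Fin.ext h.symm), mul_zero]
  · simp

theorem isSmoothQuadric_zeroLocus {m : ℕ} {A : Matrix (Fin m) (Fin m) ℂ} (hA : A.IsSymm)
    (hdet : A.det ≠ 0) : IsSmoothQuadric (zeroLocus {quadraticPoly A}) := by
  refine ⟨_, isHomogeneous_quadraticPoly A, rfl, fun x _ => ?_⟩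
  by_contra! h
  refine x.rep_nonzero (Matrix.eq_zero_of_mulVec_eq_zero hdet (funext fun k => ?_))
  have := h k
  rw [eval_pderiv_quadraticPoly hA] at this
  exact (mul_eq_zero.1 this).resolve_left two_ne_zero

theorem hasEulerCharacteristic_zeroLocus {m k r : ℕ} {A : Matrix (Fin m) (Fin m) ℂ}
    (hA : A.IsSymm) (hdet : A.det ≠ 0) (hr : r ≤ 1) (hm : 2 * k + r = m) :
    HasEulerCharacteristic (zeroLocus {quadraticPoly A}) (2 * k) := by
  let B : LinearMap.BilinForm ℂ (Fin m → ℂ) := Matrix.toLinearMap₂' ℂ A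
  have hB : ∀ v w, B v w = ∑ i, ∑ j, A i j * v i * w j := fun v w => by
    rw [Matrix.toLinearMap₂'_apply]
    exact Finset.sum_congr rfl fun i _ => Finset.sum_congr rfl fun j _ => by
      simp only [smul_eq_mul]; ring
  have hsymm : ∀ v w, B v w = B w v := fun v w => by
    rw [hB, hB, Finset.sum_comm]
    exact Finset.sum_congr rfl fun i _ => Finset.sum_congr rfl fun j _ => by rw [hA.apply]; ring
  have hsep : (QuadraticMap.associated (R := ℂ) B.toQuadraticMap).SeparatingLeft := by
    rw [QuadraticMap.associated_left_inverse ℂ hsymm]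
    exact LinearMap.separatingLeft_toLinearMap₂'_of_det_ne_zero' hdet
  refine (hasEulerCharacteristic_quadric _ hsep hr hm).congr ?_ rfl
  ext x
  simp [quadric, zeroLocus, eval_quadraticPoly, hB]

theorem mem_hyperplane_mk {c : ℙ ℂ (Fin (2 * n + 1) → ℂ)} {v : Fin (2 * n + 1) → ℂ} (hv : v ≠ 0) :
    Projectivization.mk ℂ v hv ∈ hyperplane c ↔ ∑ k, c.rep k * v k = 0 := by
  obtain ⟨t, ht, h⟩ := exists_rep_mk v hv
  rw [hyperplane, Set.mem_ofPred_eq, h]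
  simp only [Pi.smul_apply, smul_eq_mul, mul_left_comm _ t, ← Finset.mul_sum]
  rw [mul_eq_zero, or_iff_right ht]

/-- A hyperplane section of the variety of squares is a quadric in `ℙ^n`, whose matrix is the
Hankel matrix of the hyperplane. -/
theorem areIsomorphic_squares_inter_hyperplane (c : ℙ ℂ (Fin (2 * n + 1) → ℂ)) :
    AreIsomorphic (squares n ∩ hyperplane c : Set (ℙ ℂ (Fin (2 * n + 1) → ℂ)))
      (zeroLocus {quadraticPoly (hankel n c.rep)}) := by
  refine areIsomorphic_of_sqCoeff Set.inter_subset_left fun a ha => ?_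
  rw [Set.mem_inter_iff, and_iff_right ((mk_mem_squares _).2 ⟨a, rfl⟩), mem_hyperplane_mk,
    ← eval_quadraticPoly_hankel]
  simp [zeroLocus, eval_mk_rep_eq_zero_iff (isHomogeneous_quadraticPoly _)]

theorem areIsomorphic_squares_univ :
    AreIsomorphic (squares n) (Set.univ : Set (ℙ ℂ (Fin (n + 1) → ℂ))) :=
  areIsomorphic_of_sqCoeff subset_rfl fun a ha => by
    simpa using (mk_mem_squares _).2 ⟨a, rfl⟩

/-- The hyperplanes with nondegenerate Hankel matrix form a nonempty Zariski open set. -/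
theorem forGeneralHyperplane_of_det_hankel_ne_zero {p : Set (ℙ ℂ (Fin (2 * n + 1) → ℂ)) → Prop}
    (hp : ∀ c : ℙ ℂ (Fin (2 * n + 1) → ℂ), (hankel n c.rep).det ≠ 0 → p (hyperplane c)) :
    ForGeneralHyperplane p := by
  have hform : IsForm (n + 1) fun c : Fin (2 * n + 1) → ℂ => (hankel n c).det :=
    (isForm_det_hankel fun k => IsForm.coord k).congr_degree (mul_one _)
  refine ⟨{c | (hankel n c.rep).det ≠ 0}, ?_, ?_, hp⟩
  · convert isZariskiClosed_of_forall_isForm (α := Unit) (n + 1) (fun _ => _) fun _ => hform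
    ext c
    simp
  · -- the Hankel matrix of the power sums of different numbers is nondegenerate
    let c : Fin (2 * n + 1) → ℂ := fun k => ∑ i : Fin (n + 1), 1 * (i : ℂ) ^ (k : ℕ)
    have hdet : (hankel n c).det ≠ 0 := by
      rw [det_hankel_sum_pow]
      simp only [Finset.prod_const_one, one_mul]
      exact pow_ne_zero 2 (det_vandermonde_ne_zero_iff.2 fun i j h =>
        Fin.ext (Nat.cast_injective h))
    have hc : c ≠ 0 := by
      intro h
      have h0 := hform.eval_smul 0 c
      rw [zero_smul, zero_pow (Nat.succ_ne_zero n), zero_mul, ← h] at h0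
      exact hdet h0
    obtain ⟨t, ht, h⟩ := exists_rep_mk c hc
    refine ⟨Projectivization.mk ℂ c hc, ?_⟩
    rw [Set.mem_ofPred_eq, h, hform.eval_smul]
    exact mul_ne_zero (pow_ne_zero _ ht) hdet

end HyperplaneSections

end SquareVariety

end

theorem mainTheorem4 (n : ℕ) (hn : 1 ≤ n) :
    SquareVariety.dualOfSecant n = SquareVariety.squares n ∧
    SquareVariety.AreIsomorphic (SquareVariety.dualOfSecant n)
      (Set.univ : Set (ℙ ℂ (Fin (n + 1) → ℂ))) ∧
    SquareVariety.ForGeneralHyperplane fun H : Set (ℙ ℂ (Fin (2 * n + 1) → ℂ)) =>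
      (∃ Z : Set (ℙ ℂ (Fin (n + 1) → ℂ)), SquareVariety.IsSmoothQuadric Z ∧
        SquareVariety.AreIsomorphic
          (SquareVariety.dualOfSecant n ∩ H : Set (ℙ ℂ (Fin (2 * n + 1) → ℂ))) Z) ∧
      SquareVariety.HasEulerCharacteristic
        (SquareVariety.dualOfSecant n ∩ H : Set (ℙ ℂ (Fin (2 * n + 1) → ℂ)))
        (if Even n then (n : ℤ) else (n : ℤ) + 1) := by
  rw [SquareVariety.dualOfSecant_eq_squares hn]
  refine ⟨rfl, SquareVariety.areIsomorphic_squares_univ,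
    SquareVariety.forGeneralHyperplane_of_det_hankel_ne_zero fun c hc => ?_⟩
  have hsymm := SquareVariety.isSymm_hankel c.rep
  have hiso := SquareVariety.areIsomorphic_squares_inter_hyperplane c
  refine ⟨⟨_, SquareVariety.isSmoothQuadric_zeroLocus hsymm hc, hiso⟩,
    hiso.hasEulerCharacteristic ?_⟩
  split_ifs with h
  · obtain ⟨k, rfl⟩ := h
    have := SquareVariety.hasEulerCharacteristic_zeroLocus (k := k) (r := 1) hsymm hc le_rfl
      (by omega)
    exact this.congr rfl (by push_cast; ring)
  · obtain ⟨k, rfl⟩ := Nat.not_even_iff_odd.1 h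
    have := SquareVariety.hasEulerCharacteristic_zeroLocus (k := k + 1) (r := 0) hsymm hc zero_le_one
      (by omega)
    exact this.congr rfl (by push_cast; ring)
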